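/- **Bloch decomposition.** Let $d,N,L\in\mathbb N$, $M=2L+1$, and let $\Omega_0$ be a compact metrizable space. Let $\phi$ be a real antisymmetric $d\times d$ matrix satisfying the flux quantization $\phi_{ij}=2\pi n_{ij}/M$ with $n_{ij}\in\mathbb Z$. Let $(\tau_y\omega)_x=\omega_{x-y}$ be the translations of $\Omega_0^{\mathbb Z^d}$, let $\tilde\Omega=\{\tilde\omega\in\Omega_0^{\mathbb Z^d}:\tau_{e_j}^{M}\tilde\omega=\tilde\omega,\ j=1,\dots,d\}$, let $\hat\Omega=\Omega_0^{(\mathbb Z/M\mathbb Z)^d}$ with its translations $\hat\tau_y$, let $V_L=\{-L,\dots,L\}^d$, and let $\hat{\mathfrak q}:\tilde\Omega\to\hat\Omega$ be the homeomorphism $(\hat{\mathfrak q}\tilde\omega)_{\hat x}=\tilde\omega_{x}$ ($x\in V_L$), where $\hat x$ is the class of $x$. For compact $X$, $C_N(X)$ is the C\*-algebra of continuous functions $X\to M_N(\mathbb C)$. The periodic algebra $\tilde{\mathcal A}_d$ is the universal C\*-algebra generated by (a unital copy of) $C_N(\tilde\Omega)$ and unitaries $u_1,\dots,u_d$ with $u_iu_j=e^{i\phi_{ij}}u_ju_i$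 and $fu_j=u_j(f\circ\tau_{e_j})$. For $k\in\mathbb T^d=(\mathbb R/2\pi\mathbb Z)^d$, the Bloch algebra $\hat{\mathcal A}_d(k)$ is the universal C\*-algebra generated by (a unital copy of) $C_N(\hat\Omega)$ and unitaries $\hat u_1(k),\dots,\hat u_d(k)$ with the same relations ($\hat\tau$ in place of $\tau$) and, in addition, $\hat u_j(k)^{M}=e^{ik_j}$. In both, put $u_x=e^{-\frac i2\sum_{i<j}\phi_{ij}x_ix_j}u_1^{x_1}\cdots u_d^{x_d}$, $x\in\mathbb Z^d$ (and likewise $\hat u_x(k)$). The Fourier coefficients $\tilde a_x\in C_N(\tilde\Omega)$, $x\in\mathbb Z^d$, of $\tilde a\in\tilde{\mathcal A}_d$ are defined by $\tilde a_x=\big[\int_{\mathbb T^d}\frac{dt}{(2\pi)^d}\,e^{it\cdot x}\rho_t(\tilde a)\big]u_x^*$, where $\rho_t(f)=f$ and $\rho_t(u_j)=e^{-it_j}u_j$. The Fourier coefficients $\hat a_x\in C_N(\hat\Omega)$, $x\in V_L$, of $\hat a\in\hat{\mathcal A}_d(k)$ are defined by $\hat a=\sum_{x\in V_L}\hat a_x\hat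 u_x(k)$. Put $$\Gamma=\Big\{\mathfrak s\in\prod_{k\in\mathbb T^d}\hat{\mathcal A}_d(k)\ :\ \mathfrak s(k)=\sum_{x\in V_L}\hat a_x(k)\,\hat u_x(k),\ \ \hat a_x\in C\big(\mathbb T^d,C_N(\hat\Omega)\big)\Big\}.$$ Then: 1. Every element of $\tilde{\mathcal A}_d$ and every element of every $\hat{\mathcal A}_d(k)$ has well-defined Fourier coefficients: they exist in $C_N(\tilde\Omega)$, respectively $C_N(\hat\Omega)$, and are unique. 2. $\big(\{\hat{\mathcal A}_d(k)\}_{k\in\mathbb T^d},\Gamma\big)$ is a continuous field of C\*-algebras in the sense of Dixmier: $\Gamma$ is a \*-subalgebra of $\prod_k\hat{\mathcal A}_d(k)$; $\{\mathfrak s(k):\mathfrak s\in\Gamma\}$ is dense in $\hat{\mathcal A}_d(k)$ for each $k$; $k\mapsto\|\mathfrak s(k)\|$ is continuous for each $\mathfrak s\in\Gamma$; and every $\mathfrak s\in\prod_k\hat{\mathcal A}_d(k)$ that can be approximated locally uniformly by elements of $\Gamma$ near each point of $\mathbb T^d$ belongs to $\Gamma$. 3. There is an injective unital \*-homomorphism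 $\Theta:\tilde{\mathcal A}_d\to\prod_k\hat{\mathcal A}_d(k)$ with range $\Gamma$ and $\|\tilde a\|=\sup_k\|\Theta(\tilde a)(k)\|$, hence an isometric \*-isomorphism of $\tilde{\mathcal A}_d$ onto the C\*-algebra $\Gamma$ of the field, such that $\Theta(u_j)(k)=\hat u_j(k)$ and $\Theta(\tilde f)(k)=\tilde f\circ\hat{\mathfrak q}^{-1}$ for $\tilde f\in C_N(\tilde\Omega)$. It is determined by the folding relations: for $\tilde a\in\tilde{\mathcal A}_d$ with Fourier coefficients $\tilde a_x$, and $\mathfrak s\in\Gamma$ such that $\mathfrak s(k)$ has Fourier coefficients $\hat a_{k,x}$, the identity $\Theta(\tilde a)=\mathfrak s$ is equivalent to each of $$\hat a_{k,x}(\hat{\mathfrak q}\tilde\omega)=\sum_{y\in\mathbb Z^d}\varepsilon(x,y)\,e^{ik\cdot y}\,\tilde a_{x+My}(\tilde\omega)\qquad(x\in V_L,\ k\in\mathbb T^d,\ \tilde\omega\in\tilde\Omega),\tag{Bloch1}$$ $$\tilde a_{x+My}(\tilde\omega)=\varepsilon(x,y)\,\frac1{(2\pi)^d}\int_{\mathbb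 T^d}dk\,e^{-ik\cdot y}\,\hat a_{k,x}(\hat{\mathfrak q}\tilde\omega)\qquad(x\in V_L,\ y\in\mathbb Z^d,\ \tilde\omega\in\tilde\Omega),\tag{Bloch2}$$ where $\varepsilon(x,y)=(-1)^{\sum_{i<j}n_{ij}(x_iy_j+x_jy_i+y_iy_j)}$ is the sign for which $\hat u_{x+My}(k)=\varepsilon(x,y)e^{ik\cdot y}\hat u_x(k)$ (so $\varepsilon\equiv1$ when all $n_{ij}$ are even), and the series in (Bloch1) is a Fourier series, summed in the Cesàro sense: the means $\sum_{|y_j|\le m}\prod_j\big(1-\tfrac{|y_j|}{m+1}\big)(\cdots)$ converge as $m\to\infty$, uniformly in $k$ and $\tilde\omega$. -/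

import Mathlib

open scoped ENNReal Topology ComplexOrder

universe u

noncomputable section

namespace Bloch

/-! ## Universal C*-algebras attached to a twisted dynamical system -/

/-- The C*-algebra `C_N(X)` of continuous functions from a compact space to `M_N(ℂ)`, with the
supremum of the operator norms. -/
abbrev MatFun (N : ℕ) (X : Type u) [TopologicalSpace X] [CompactSpace X] : Type u :=
  C(X, CStarMatrix (Fin N) (Fin N) ℂ)

section Universal

variable {d : ℕ} {X : Type u} [TopologicalSpace X] [CompactSpace X]

/-- A representation of the commutation relations in a unital C*-algebra `B`: a unital
*-homomorphism `π` on `C_N(X)` and unitaries `u_1, …, u_d` with `u_i u_j = e^{i φ_ij} u_j u_i` and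
`f u_j = u_j (f ∘ τ_j)`. -/
structure CovRep (N : ℕ) (τ : Fin d → C(X, X)) (φ : Matrix (Fin d) (Fin d) ℝ)
    (B : Type*) [CStarAlgebra B] where
  π : MatFun N X →⋆ₐ[ℂ] B
  u : Fin d → unitary B
  comm : ∀ i j, (u i : B) * (u j : B) = Complex.exp (Complex.I * φ i j) • ((u j : B) * (u i : B))
  cov : ∀ (f : MatFun N X) (j : Fin d), π f * (u j : B) = (u j : B) * π (f.comp (τ j))

/-- The symmetric monomials
`u_x = exp(-(i/2) ∑_{i<j} φ_ij x_i x_j) u_1^{x_1} ⋯ u_d^{x_d}`, `x ∈ ℤ^d`. -/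
def CovRep.mono {N : ℕ} {τ : Fin d → C(X, X)} {φ : Matrix (Fin d) (Fin d) ℝ} {B : Type*}
    [CStarAlgebra B] (R : CovRep N τ φ B) (x : Fin d → ℤ) : B :=
  Complex.exp (-(Complex.I / 2) *
      ∑ i, ∑ j, if i < j then (φ i j : ℂ) * (x i : ℂ) * (x j : ℂ) else 0) •
    (((List.ofFn fun j => R.u j ^ x j).prod : unitary B) : B)

/-- Multiplying the unitary generators by phases. -/
def CovRep.twist {N : ℕ} {τ : Fin d → C(X, X)} {φ : Matrix (Fin d) (Fin d) ℝ} {B : Type*}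
    [CStarAlgebra B] (R : CovRep N τ φ B) (z : Fin d → Circle) : CovRep N τ φ B where
  π := R.π
  u j := ⟨(z j : ℂ) • (R.u j : B), by
    have h : (starRingEnd ℂ) (z j : ℂ) * (z j : ℂ) = 1 := by
      rw [← Circle.coe_inv_eq_conj, ← Circle.coe_mul]; simp
    constructor
    · simp [star_smul, smul_smul, mul_comm (z j : ℂ), h]
    · simp [star_smul, smul_smul, h]⟩
  comm i j := by
    have := R.comm i j
    simp only [smul_mul_smul_comm, this, smul_smul]
    congr 1; ring
  cov f j := by
    simp only [mul_smul_comm, smul_mul_assoc, R.cov]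

/-- Additional constraints on the unitary generators. -/
abbrev Constraint (d : ℕ) : Type (u + 1) :=
  ∀ (B : Type u) [CStarAlgebra B], (Fin d → unitary B) → Prop

/-- All representations, in nonzero unital C*-algebras, of the commutation relations together with
the constraint `P`. -/
structure RepIndex (N : ℕ) (τ : Fin d → C(X, X)) (φ : Matrix (Fin d) (Fin d) ℝ)
    (P : Constraint.{u} d) : Type (u + 1) where
  B : Type u
  [cstar : CStarAlgebra B]
  [nontriv : Nontrivial B]
  rep : CovRep N τ φ B
  constr : P B rep.u

attribute [instance] RepIndex.cstar RepIndex.nontriv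

instance instCStarAlgebraLp {I : Type*} (B : I → Type*) [∀ i, CStarAlgebra (B i)]
    [∀ i, Nontrivial (B i)] : CStarAlgebra (lp B ∞) where
  __ := lp.inftyNormedRing
  __ := lp.inftyStarRing
  __ := lp.inftyNormedAlgebra (𝕜 := ℂ)
  __ := (inferInstance : CompleteSpace (lp B ∞))
  __ := (inferInstance : CStarRing (lp B ∞))
  __ := (inferInstance : StarModule ℂ (lp B ∞))

variable (N : ℕ) (τ : Fin d → C(X, X)) (φ : Matrix (Fin d) (Fin d) ℝ) (P : Constraint.{u} d)

/-- The C*-product of all representations. -/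
abbrev BigProd : Type (u + 1) := lp (fun r : RepIndex N τ φ P => r.B) ∞

/-- The direct product of all representations. -/
def bigRep : CovRep N τ φ (BigProd N τ φ P) where
  π :=
    { toFun := fun f => ⟨fun r => r.rep.π f, memℓp_infty ⟨‖f‖, by
        rintro _ ⟨r, rfl⟩
        exact NonUnitalStarAlgHom.norm_apply_le r.rep.π f⟩⟩
      map_one' := by ext r; exact r.rep.π.map_one'
      map_mul' := fun f g => by ext r; exact map_mul r.rep.π f g
      map_zero' := by ext r; exact map_zero r.rep.π
      map_add' := fun f g => by ext r; exact map_add r.rep.π f g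
      commutes' := fun c => by ext r; exact AlgHomClass.commutes r.rep.π c
      map_star' := fun f => by ext r; exact map_star r.rep.π f }
  u j := ⟨⟨fun r => (r.rep.u j : r.B), memℓp_infty ⟨1, by
        rintro _ ⟨r, rfl⟩
        exact (CStarRing.norm_coe_unitary (r.rep.u j)).le⟩⟩, by
      constructor
      · ext r; exact Unitary.coe_star_mul_self (r.rep.u j)
      · ext r; exact Unitary.coe_mul_star_self (r.rep.u j)⟩
  comm i j := by ext r; exact r.rep.comm i j
  cov f j := by ext r; exact r.rep.cov f j

/-- The closed *-subalgebra generated by the image of `C_N(X)` and the unitaries. -/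
def univSubalgebra : StarSubalgebra ℂ (BigProd N τ φ P) :=
  (StarAlgebra.adjoin ℂ (Set.range (bigRep N τ φ P).π ∪
    Set.range fun j => ((bigRep N τ φ P).u j : BigProd N τ φ P))).topologicalClosure

/-- The universal C*-algebra generated by `C_N(X)` and `u_1, …, u_d` subject to the commutation
relations and to the constraint `P`. Its norm is the supremum of the norms in all representations
of the relations. (Representations in C*-algebras of the universe of `X` suffice: the C*-subalgebra
generated by a representation in any universe has a copy in that one.) -/
def UnivAlg : Type (u + 1) := univSubalgebra N τ φ P

instance instCStarAlgebraUnivAlg : CStarAlgebra (UnivAlg N τ φ P) :=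
  StarSubalgebra.cstarAlgebra (univSubalgebra N τ φ P)
    (h_closed := StarSubalgebra.isClosed_topologicalClosure _)

variable {N τ φ P} in
theorem bigRep_π_mem (f : MatFun N X) : (bigRep N τ φ P).π f ∈ univSubalgebra N τ φ P :=
  StarSubalgebra.le_topologicalClosure _
    (StarAlgebra.subset_adjoin ℂ _ (Or.inl ⟨f, rfl⟩))

variable {N τ φ P} in
theorem bigRep_u_mem (j : Fin d) :
    ((bigRep N τ φ P).u j : BigProd N τ φ P) ∈ univSubalgebra N τ φ P :=
  StarSubalgebra.le_topologicalClosure _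
    (StarAlgebra.subset_adjoin ℂ _ (Or.inr ⟨j, rfl⟩))

/-- The generators of the universal C*-algebra. -/
def univRep : CovRep N τ φ (UnivAlg N τ φ P) where
  π :=
    { toFun := fun f => ⟨(bigRep N τ φ P).π f, bigRep_π_mem f⟩
      map_one' := Subtype.ext (bigRep N τ φ P).π.map_one'
      map_mul' := fun f g => Subtype.ext ((bigRep N τ φ P).π.map_mul' f g)
      map_zero' := Subtype.ext (bigRep N τ φ P).π.map_zero'
      map_add' := fun f g => Subtype.ext ((bigRep N τ φ P).π.map_add' f g)
      commutes' := fun c => Subtype.ext ((bigRep N τ φ P).π.commutes' c)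
      map_star' := fun f => Subtype.ext ((bigRep N τ φ P).π.map_star' f) }
  u j := ⟨⟨(bigRep N τ φ P).u j, bigRep_u_mem j⟩, by
      constructor
      · exact Subtype.ext (Unitary.coe_star_mul_self ((bigRep N τ φ P).u j))
      · exact Subtype.ext (Unitary.coe_mul_star_self ((bigRep N τ φ P).u j))⟩
  comm i j := Subtype.ext ((bigRep N τ φ P).comm i j)
  cov f j := Subtype.ext ((bigRep N τ φ P).cov f j)

/-- The universal property: representations of the relations are the same thing as *-homomorphisms
out of the universal C*-algebra. -/
theorem univRep_universal (B : Type u) [CStarAlgebra B] (R : CovRep N τ φ B) (hR : P B R.u) :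
    ∃! ψ : UnivAlg N τ φ P →⋆ₐ[ℂ] B,
      (∀ f, ψ ((univRep N τ φ P).π f) = R.π f) ∧
      ∀ j, ψ ((univRep N τ φ P).u j : UnivAlg N τ φ P) = (R.u j : B) := by
  have uniq : ∀ ψ₁ ψ₂ : UnivAlg N τ φ P →⋆ₐ[ℂ] B,
      (∀ f, ψ₁ ((univRep N τ φ P).π f) = ψ₂ ((univRep N τ φ P).π f)) →
      (∀ j, ψ₁ ((univRep N τ φ P).u j : UnivAlg N τ φ P) =
        ψ₂ ((univRep N τ φ P).u j : UnivAlg N τ φ P)) → ψ₁ = ψ₂ := by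
    intro ψ₁ ψ₂ h1 h2
    have c1 : Continuous ψ₁ := AddMonoidHomClass.continuous_of_bound ψ₁ 1
      (fun x => by simpa using NonUnitalStarAlgHom.norm_apply_le ψ₁ x)
    have c2 : Continuous ψ₂ := AddMonoidHomClass.continuous_of_bound ψ₂ 1
      (fun x => by simpa using NonUnitalStarAlgHom.norm_apply_le ψ₂ x)
    refine StarAlgHom.ext_topologicalClosure (φ := ψ₁) (ψ := ψ₂) c1 c2 ?_
    refine StarAlgHom.ext_adjoin ?_
    rintro ⟨x, hx⟩ (⟨f, rfl⟩ | ⟨j, rfl⟩)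
    · exact h1 f
    · exact h2 j
  refine existsUnique_of_exists_of_unique ?_ ?_
  · rcases subsingleton_or_nontrivial B with hB | hB
    · exact ⟨{ toFun := fun _ => 0
               map_one' := Subsingleton.elim _ _
               map_mul' := fun _ _ => Subsingleton.elim _ _
               map_zero' := Subsingleton.elim _ _
               map_add' := fun _ _ => Subsingleton.elim _ _
               commutes' := fun _ => Subsingleton.elim _ _
               map_star' := fun _ => Subsingleton.elim _ _ },
        fun _ => Subsingleton.elim _ _, fun _ => Subsingleton.elim _ _⟩
    · exact ⟨{ toFun := fun a => a.1 ⟨B, R, hR⟩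
               map_one' := rfl
               map_mul' := fun _ _ => rfl
               map_zero' := rfl
               map_add' := fun _ _ => rfl
               commutes' := fun _ => rfl
               map_star' := fun _ => rfl }, fun _ => rfl, fun _ => rfl⟩
  · intro ψ₁ ψ₂ h1 h2
    exact uniq ψ₁ ψ₂ (fun f => (h1.1 f).trans (h2.1 f).symm)
      (fun j => (h1.2 j).trans (h2.2 j).symm)

/-- The absence of additional constraints. -/
abbrev noConstraint : Constraint.{u} d := fun _ _ _ => True

/-- Relabelling of the product of all representations by `u_j ↦ z_j u_j`. -/
def bigGauge (z : Fin d → Circle) :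
    BigProd N τ φ noConstraint →⋆ₐ[ℂ] BigProd N τ φ noConstraint where
  toFun a := ⟨fun r => a ⟨r.B, r.rep.twist z, trivial⟩, memℓp_infty ⟨‖a‖, by
    rintro _ ⟨r, rfl⟩
    exact lp.norm_apply_le_norm ENNReal.top_ne_zero a _⟩⟩
  map_one' := rfl
  map_mul' _ _ := rfl
  map_zero' := rfl
  map_add' _ _ := rfl
  commutes' _ := rfl
  map_star' _ := rfl

theorem bigGauge_mem (z : Fin d → Circle) (a : BigProd N τ φ noConstraint)
    (ha : a ∈ univSubalgebra N τ φ noConstraint) :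
    bigGauge N τ φ z a ∈ univSubalgebra N τ φ noConstraint := by
  have hc : Continuous (bigGauge N τ φ z) :=
    AddMonoidHomClass.continuous_of_bound (bigGauge N τ φ z) 1
      (fun x => by simpa using NonUnitalStarAlgHom.norm_apply_le (bigGauge N τ φ z) x)
  have hle : univSubalgebra N τ φ noConstraint ≤
      (univSubalgebra N τ φ noConstraint).comap (bigGauge N τ φ z) := by
    refine StarSubalgebra.topologicalClosure_minimal ?_
      ((StarSubalgebra.isClosed_topologicalClosure _).preimage hc)
    refine StarAlgebra.adjoin_le ?_
    rintro _ (⟨f, rfl⟩ | ⟨j, rfl⟩)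
    · exact bigRep_π_mem f
    · exact (univSubalgebra N τ φ noConstraint).smul_mem (bigRep_u_mem j) (z j : ℂ)
  exact hle ha

/-- The gauge action: the *-endomorphism of the universal C*-algebra with `f ↦ f` and
`u_j ↦ z_j u_j`. -/
def gauge (z : Fin d → Circle) :
    UnivAlg N τ φ noConstraint →⋆ₐ[ℂ] UnivAlg N τ φ noConstraint where
  toFun a := ⟨bigGauge N τ φ z a.1, bigGauge_mem N τ φ z a.1 a.2⟩
  map_one' := rfl
  map_mul' _ _ := rfl
  map_zero' := rfl
  map_add' _ _ := rfl
  commutes' _ := rfl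
  map_star' _ := rfl

theorem gauge_π (z : Fin d → Circle) (f : MatFun N X) :
    gauge N τ φ z ((univRep N τ φ noConstraint).π f) = (univRep N τ φ noConstraint).π f := rfl

theorem gauge_u (z : Fin d → Circle) (j : Fin d) :
    gauge N τ φ z ((univRep N τ φ noConstraint).u j : UnivAlg N τ φ noConstraint) =
      (z j : ℂ) • ((univRep N τ φ noConstraint).u j : UnivAlg N τ φ noConstraint) := rfl

end Universal

/-! ## Periodic and finite-volume configurations -/

section Configurations

variable (d L : ℕ) (Ω₀ : Type u)

/-- The translation `(τ_y ω)_x = ω_{x-y}` of lattice configurations. -/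
def shift {d : ℕ} {Ω₀ : Type u} (y : Fin d → ℤ) (ω : (Fin d → ℤ) → Ω₀) : (Fin d → ℤ) → Ω₀ :=
  fun x => ω (x - y)

/-- The `(2L+1)`-periodic configurations: `τ_j^{2L+1} ω = ω` for all `j`. -/
def PerConf : Type u :=
  {ω : (Fin d → ℤ) → Ω₀ // ∀ j : Fin d, (shift (Pi.single j 1))^[2 * L + 1] ω = ω}

instance [TopologicalSpace Ω₀] : TopologicalSpace (PerConf d L Ω₀) :=
  inferInstanceAs (TopologicalSpace {ω : (Fin d → ℤ) → Ω₀ //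
    ∀ j : Fin d, (shift (Pi.single j 1))^[2 * L + 1] ω = ω})

/-- The finite-volume configurations `∏_{(ℤ/(2L+1)ℤ)^d} Ω₀`. -/
abbrev FinConf : Type u := (Fin d → ZMod (2 * L + 1)) → Ω₀

/-- The class in `(ℤ/(2L+1)ℤ)^d` of a lattice point. -/
def cls {d : ℕ} (x : Fin d → ℤ) : Fin d → ZMod (2 * L + 1) := fun i => (x i : ZMod (2 * L + 1))

/-- The representative in `{-L, …, L}^d` of a class. -/
def rep {d L : ℕ} (x : Fin d → ZMod (2 * L + 1)) : Fin d → ℤ := fun i => (x i).valMinAbs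

variable {d L Ω₀}

theorem shift_iterate (y : Fin d → ℤ) (m : ℕ) (ω : (Fin d → ℤ) → Ω₀) :
    (shift y)^[m] ω = shift (m • y) ω := by
  induction m with
  | zero => funext x; simp [shift]
  | succ m ih =>
    rw [Function.iterate_succ_apply', ih]
    funext x
    simp only [shift]
    congr 1
    rw [succ_nsmul]; abel

theorem shift_shift (y z : Fin d → ℤ) (ω : (Fin d → ℤ) → Ω₀) :
    shift y (shift z ω) = shift (y + z) ω := by
  funext x; simp only [shift]; congr 1; abel

theorem PerConf.congr (ω : PerConf d L Ω₀) {x y : Fin d → ℤ} (h : cls L x = cls L y) :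
    ω.1 x = ω.1 y := by
  let H : AddSubgroup (Fin d → ℤ) :=
    { carrier := {z | ∀ x, ω.1 (x + z) = ω.1 x}
      zero_mem' := fun x => by simp
      add_mem' := fun {a b} ha hb x => by rw [← add_assoc, hb, ha]
      neg_mem' := fun {a} ha x => by have := ha (x + -a); simpa using this.symm }
  have hj : ∀ j : Fin d, (Pi.single j ((2 * L + 1 : ℕ) : ℤ) : Fin d → ℤ) ∈ H := by
    intro j x
    have h1 := congrFun (ω.2 j) (x + Pi.single j ((2 * L + 1 : ℕ) : ℤ))
    rw [shift_iterate] at h1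
    rw [← h1]
    simp only [shift]
    rw [← Pi.single_smul, nsmul_eq_mul, mul_one, add_sub_cancel_right]
  have hz : x - y ∈ H := by
    have : x - y = ∑ j, Pi.single j ((x - y) j) := (Finset.univ_sum_single _).symm
    rw [this]
    refine H.sum_mem fun j _ => ?_
    have hd : ((2 * L + 1 : ℕ) : ℤ) ∣ (x - y) j := by
      rw [← ZMod.intCast_zmod_eq_zero_iff_dvd]
      have := congrFun h j
      simp only [cls] at this
      simp [this]
    obtain ⟨c, hc⟩ := hd
    have := H.zsmul_mem (hj j) c
    rwa [← Pi.single_smul, smul_eq_mul, mul_comm, ← hc] at this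
  have := hz y
  simpa using this

theorem cls_rep (x : Fin d → ZMod (2 * L + 1)) : cls L (rep x) = x := by
  funext i; exact ZMod.coe_valMinAbs (x i)

variable [TopologicalSpace Ω₀]

theorem continuous_shift (y : Fin d → ℤ) :
    Continuous (shift y : ((Fin d → ℤ) → Ω₀) → (Fin d → ℤ) → Ω₀) :=
  continuous_pi fun x => continuous_apply (x - y)

/-- The restriction of the translation by `e_j` to the periodic configurations. -/
def perShift (j : Fin d) : C(PerConf d L Ω₀, PerConf d L Ω₀) where
  toFun ω := ⟨shift (Pi.single j 1) ω.1, fun i => by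
    rw [shift_iterate, shift_shift, add_comm, ← shift_shift, ← shift_iterate, ω.2 i]⟩
  continuous_toFun := ((continuous_shift _).comp continuous_subtype_val).subtype_mk _

/-- The translation by `e_j` of the finite-volume configurations. -/
def finShift (j : Fin d) : C(FinConf d L Ω₀, FinConf d L Ω₀) where
  toFun ω x := ω (x - cls L (Pi.single j 1))
  continuous_toFun := continuous_pi fun _ => continuous_apply _

/-- The homeomorphism `(q ω)_{x̂} = ω_{s(x̂)}` from the periodic configurations to the finite-volume
configurations, with inverse `(q⁻¹ ω̂)_x = ω̂_{x̂}`. -/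
def qHat : PerConf d L Ω₀ ≃ₜ FinConf d L Ω₀ where
  toFun ω := fun x => ω.1 (rep x)
  invFun ω := ⟨fun x => ω (cls L x), fun j => by
    rw [shift_iterate]; funext x
    simp only [shift]
    congr 1
    funext i
    have h : ((2 * L + 1 : ℕ) : ZMod (2 * L + 1)) = 0 := ZMod.natCast_self _
    simp only [cls, Pi.sub_apply, nsmul_eq_mul]
    push_cast at h ⊢
    simp [h]⟩
  left_inv ω := Subtype.ext (funext fun x => ω.congr (cls_rep _))
  right_inv ω := funext fun x => congrArg ω (cls_rep x)
  continuous_toFun := continuous_pi fun x =>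
    (continuous_apply (rep x)).comp continuous_subtype_val
  continuous_invFun := (continuous_pi fun x => continuous_apply (cls L x)).subtype_mk _

/-- `q` as a continuous map. -/
abbrev qMap : C(PerConf d L Ω₀, FinConf d L Ω₀) := ⟨qHat, qHat.continuous⟩

/-- `q⁻¹` as a continuous map. -/
abbrev qInvMap : C(FinConf d L Ω₀, PerConf d L Ω₀) := ⟨qHat.symm, qHat.symm.continuous⟩

instance [CompactSpace Ω₀] : CompactSpace (PerConf d L Ω₀) :=
  (qHat (d := d) (L := L) (Ω₀ := Ω₀)).symm.compactSpace

end Configurations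

/-! ## Continuous fields of C*-algebras -/

/-- `(E, Γ)` is a continuous field of (unital) C*-algebras over `T`. -/
structure IsContinuousField {T : Type*} [TopologicalSpace T] (E : T → Type*)
    [∀ t, CStarAlgebra (E t)] (Γ : Set (∀ t, E t)) : Prop where
  zero_mem : 0 ∈ Γ
  add_mem : ∀ s ∈ Γ, ∀ s' ∈ Γ, s + s' ∈ Γ
  smul_mem : ∀ (c : ℂ), ∀ s ∈ Γ, c • s ∈ Γ
  mul_mem : ∀ s ∈ Γ, ∀ s' ∈ Γ, s * s' ∈ Γ
  star_mem : ∀ s ∈ Γ, star s ∈ Γ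
  dense : ∀ t, Dense ((fun s : ∀ t, E t => s t) '' Γ)
  continuous_norm : ∀ s ∈ Γ, Continuous fun t => ‖s t‖
  mem_of_locally_approx : ∀ s : ∀ t, E t,
    (∀ t, ∀ ε > 0, ∃ s' ∈ Γ, ∀ᶠ t' in 𝓝 t, ‖s t' - s' t'‖ ≤ ε) → s ∈ Γ

/-! ## The periodic algebra, the Bloch algebras and their Fourier coefficients -/

section Algebras

instance instFactTwoPi : Fact (0 < 2 * Real.pi) := ⟨Real.two_pi_pos⟩

/-- The torus `𝕋^d = (ℝ/2πℤ)^d`. -/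
abbrev Torus (d : ℕ) : Type := Fin d → AddCircle (2 * Real.pi)

/-- The phase `e^{i k·y}`. -/
def phase {d : ℕ} (k : Torus d) (y : Fin d → ℤ) : ℂ :=
  ((∏ j, (k j).toCircle ^ y j : Circle) : ℂ)

/-- The cube `V_L = {-L, …, L}^d`. -/
def VL (d L : ℕ) : Finset (Fin d → ℤ) := Fintype.piFinset fun _ => Finset.Icc (-(L : ℤ)) L

variable {d : ℕ} (N L : ℕ) (Ω₀ : Type u) [TopologicalSpace Ω₀] [CompactSpace Ω₀]
  (φ : Matrix (Fin d) (Fin d) ℝ)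

/-- The periodic algebra `Ã_d`. -/
abbrev PerAlg : Type (u + 1) :=
  UnivAlg N (perShift (d := d) (L := L) (Ω₀ := Ω₀)) φ noConstraint

/-- The generators of the periodic algebra. -/
abbrev perGen : CovRep N (perShift (d := d) (L := L) (Ω₀ := Ω₀)) φ (PerAlg N L Ω₀ φ) :=
  univRep N (perShift (d := d) (L := L) (Ω₀ := Ω₀)) φ noConstraint

/-- The constraint `u_j^{2L+1} = e^{i k_j}`. -/
abbrev powConstraint (k : Torus d) : Constraint.{u} d :=
  fun B _ v => ∀ j, (v j : B) ^ (2 * L + 1) = ((k j).toCircle : ℂ) • (1 : B)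

/-- The Bloch algebra `Â_d(k)`. -/
abbrev BlochAlg (k : Torus d) : Type (u + 1) :=
  UnivAlg N (finShift (d := d) (L := L) (Ω₀ := Ω₀)) φ (powConstraint L k)

/-- The generators of the Bloch algebra. -/
abbrev blochGen (k : Torus d) :
    CovRep N (finShift (d := d) (L := L) (Ω₀ := Ω₀)) φ (BlochAlg N L Ω₀ φ k) :=
  univRep N (finShift (d := d) (L := L) (Ω₀ := Ω₀)) φ (powConstraint L k)

theorem blochGen_pow (k : Torus d) (j : Fin d) :
    ((blochGen N L Ω₀ φ k).u j : BlochAlg N L Ω₀ φ k) ^ (2 * L + 1) =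
      ((k j).toCircle : ℂ) • (1 : BlochAlg N L Ω₀ φ k) :=
  Subtype.ext (by
    ext r
    exact r.constr j)

variable {N L Ω₀ φ}

/-- The Fourier coefficient
`Φ_x(a) = (∫_{𝕋^d} dμ(λ) λ^x ρ_λ(a)) u_x^*`, with `ρ_λ(u_j) = λ_j^{-1} u_j` and `μ` the normalized
Haar measure, as an element of the periodic algebra. -/
def fourierCoeff (a : PerAlg N L Ω₀ φ) (x : Fin d → ℤ) : PerAlg N L Ω₀ φ :=
  (((2 * Real.pi) ^ d)⁻¹ • ∫ t : Torus d,
      phase t x • gauge N perShift φ (fun j => (t j).toCircle⁻¹) a) *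
    star ((perGen N L Ω₀ φ).mono x)

/-- The functions `c x ∈ C_N(Ω̃)` are the Fourier coefficients of `a`. -/
def IsFourier (a : PerAlg N L Ω₀ φ) (c : (Fin d → ℤ) → MatFun N (PerConf d L Ω₀)) : Prop :=
  ∀ x, (perGen N L Ω₀ φ).π (c x) = fourierCoeff a x

/-- The functions `c x ∈ C_N(Ω̂)`, `x ∈ V_L`, are the Fourier coefficients of the element `b` of the
Bloch algebra at `k`, i.e. `b = ∑_{x ∈ V_L} c_x û_x(k)`. -/
def IsBlochFourier (k : Torus d) (b : BlochAlg N L Ω₀ φ k)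
    (c : VL d L → MatFun N (FinConf d L Ω₀)) : Prop :=
  b = ∑ x : VL d L, (blochGen N L Ω₀ φ k).π (c x) * (blochGen N L Ω₀ φ k).mono x

variable (N L Ω₀ φ) in
/-- The sections `k ↦ ∑_{x ∈ V_L} â_x(k) û_x(k)` with continuous `â_x : 𝕋^d → C_N(Ω̂)`. -/
def blochSections : Set (∀ k : Torus d, BlochAlg N L Ω₀ φ k) :=
  {s | ∃ c : VL d L → C(Torus d, MatFun N (FinConf d L Ω₀)),
    ∀ k, IsBlochFourier k (s k) fun x => c x k}

/-- The sign relating `û_{x+(2L+1)y}(k)` to `e^{i k·y} û_x(k)` for the flux matrix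
`2π n / (2L+1)`. It is `1` if the entries of `n` are even. -/
def foldSign (n : Matrix (Fin d) (Fin d) ℤ) (x y : Fin d → ℤ) : ℂ :=
  (-1) ^ (∑ i, ∑ j, if i < j then n i j * (x i * y j + x j * y i + y i * y j) else 0)

/-- The relation `â_{k,x}(ω̂) = ∑_y ± e^{i k·y} ã_{x+(2L+1)y}(ω̃)`, `ω̂ = q ω̃`, where the Fourier
series over `y ∈ ℤ^d` is summed in the sense of Cesàro, uniformly in `k` and `ω̃`. -/
def BlochRelation₁ (n : Matrix (Fin d) (Fin d) ℤ)
    (c : (Fin d → ℤ) → MatFun N (PerConf d L Ω₀))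
    (c' : Torus d → VL d L → MatFun N (FinConf d L Ω₀)) : Prop :=
  ∀ x : VL d L, TendstoUniformly
    (fun (m : ℕ) (k : Torus d) => ∑ y ∈ VL d m,
      ((∏ j, (1 - |(y j : ℝ)| / (m + 1)) : ℝ) : ℂ) •
        (foldSign n x y * phase k y) • c (x + (2 * L + 1 : ℤ) • y))
    (fun k => (c' k x).comp qMap) Filter.atTop

/-- The relation `ã_{x+(2L+1)y}(ω̃) = ± (2π)^{-d} ∫_{𝕋^d} dk e^{-i k·y} â_{k,x}(ω̂)`, `ω̂ = q ω̃`. -/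
def BlochRelation₂ (n : Matrix (Fin d) (Fin d) ℤ)
    (c : (Fin d → ℤ) → MatFun N (PerConf d L Ω₀))
    (c' : Torus d → VL d L → MatFun N (FinConf d L Ω₀)) : Prop :=
  ∀ (x : VL d L) (y : Fin d → ℤ) (ω : PerConf d L Ω₀),
    c (x + (2 * L + 1 : ℤ) • y) ω =
      foldSign n x y • ((2 * Real.pi) ^ d)⁻¹ •
        ∫ k : Torus d, phase k (-y) • c' k x (qHat ω)

end Algebras

end Bloch

namespace Bloch

open MeasureTheory

/-! ## Fourier analysis on the torus -/

section Phase

variable {d : ℕ}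

/-! Write `M = 2L + 1`. Everything rests on one identity: in a representation with `u_j ^ M = e^{i
k_j}` one has `u_{x+My} = ε(x,y) e^{i k·y} u_x` (`CovRep.mono_add_smul`). The periodic algebra is
the closed span of the elements `f u_z`, `z ∈ ℤ^d`. Sending its generators to those of the Bloch
algebra at `k` therefore folds `ℤ^d` onto the cube `V_L`, and the part of the index lost in folding
reappears as a Fourier frequency in `k`.

A Bloch algebra is a finite free module over `C_N(Ω̂)`. Averaging over multiplication of the
generators by `M`-th roots of unity projects contractively onto one residue class of indices. An
explicit regular representation by matrices over `C(Ω̂)` shows that `C_N(Ω̂)` embeds isometrically.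
Hence `(c_x) ↦ ∑ c_x û_x(k)` does not decrease the norm; its range is closed and, by folding, dense,
so it is a bijection (`blochSynth_bijective`).

The field becomes trivial after pulling back along the covering `t ↦ Mt` of the torus, because `û_j
↦ e^{i t_j} û_j` is an isomorphism from the algebra at `Mt` onto the one at `0`. A section lies in
`Γ` exactly when its pullback is a continuous function into that fixed algebra
(`mem_blochSections_iff`), and the axioms of a continuous field follow from this. The pullback of a
folded element is the image of its orbit under the gauge action (`trivialization_fold`), hence
continuous.

The Fourier coefficients of `a` are, up to the sign, the Fourier coefficients in `k` of its folded
coefficients (`fourierCoeff_add_smul`). Together with Fejér's theorem for Banach-valued functions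
this yields the rest. An element with zero Fourier coefficients is zero, so folding is injective and
the homomorphism into functions on the covering is isometric. Its range is closed and contains the
Fejér means of every section, so folding reaches all of `Γ`. The second folding relation is the
formula for the coefficients, the first is its Cesàro inversion, and uniqueness of limits closes the
circle of equivalences. -/

theorem phase_zero_right (k : Torus d) : phase k 0 = 1 := by simp [phase]

theorem phase_zero_left (y : Fin d → ℤ) : phase 0 y = 1 := by simp [phase]

theorem phase_add_right (k : Torus d) (y z : Fin d → ℤ) :
    phase k (y + z) = phase k y * phase k z := by
  simp [phase, zpow_add, Finset.prod_mul_distrib]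

theorem phase_add_left (k l : Torus d) (y : Fin d → ℤ) :
    phase (k + l) y = phase k y * phase l y := by
  simp [phase, AddCircle.toCircle_add, mul_zpow, Finset.prod_mul_distrib]

theorem phase_neg_left (k : Torus d) (y : Fin d → ℤ) : phase (-k) y = phase k (-y) := by
  simp [phase, AddCircle.toCircle_neg]

theorem phase_mul_phase_neg (k : Torus d) (y : Fin d → ℤ) : phase k y * phase k (-y) = 1 := by
  rw [← phase_add_right, add_neg_cancel, phase_zero_right]

theorem norm_phase (k : Torus d) (y : Fin d → ℤ) : ‖phase k y‖ = 1 := Circle.norm_coe _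

theorem phase_eq_prod (k : Torus d) (y : Fin d → ℤ) :
    phase k y = ∏ j, ((k j).toCircle : ℂ) ^ y j := by
  exact (map_prod Circle.coeHom _ _).trans (Finset.prod_congr rfl fun j _ => Circle.coe_zpow _ _)

theorem phase_single (k : Torus d) (j : Fin d) (l : ℤ) :
    phase k (Pi.single j l) = ((k j).toCircle : ℂ) ^ l := by
  rw [phase_eq_prod, Finset.prod_eq_single j]
  · simp
  · intro i _ hi; simp [hi]
  · simp

theorem continuous_toCircle_apply (j : Fin d) :
    Continuous fun k : Torus d => (k j).toCircle :=
  AddCircle.continuous_toCircle.comp (continuous_apply j)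

theorem continuous_phase (y : Fin d → ℤ) : Continuous fun k : Torus d => phase k y := by
  simp only [phase_eq_prod]
  exact continuous_finsetProd _ fun j _ =>
    (continuous_subtype_val.comp (continuous_toCircle_apply j)).zpow₀ _
      fun _ => Or.inl (Circle.coe_ne_zero _)

/-- The character `k ↦ e^{i k·y}` as a continuous function. -/
def phaseMap (y : Fin d → ℤ) : C(Torus d, ℂ) := ⟨fun k => phase k y, continuous_phase y⟩

@[simp] theorem phaseMap_apply (y : Fin d → ℤ) (k : Torus d) : phaseMap y k = phase k y := rfl

end Phase

/-! ### Mean values over the torus -/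

section Mean

variable {d : ℕ} {E : Type*} [NormedAddCommGroup E] [NormedSpace ℂ E]

theorem volume_real_torus : (volume : Measure (Torus d)).real Set.univ = (2 * Real.pi) ^ d := by
  rw [measureReal_def, ← Set.pi_univ Set.univ, volume_pi_pi, ENNReal.toReal_prod]
  simp [AddCircle.measure_univ, Real.pi_pos.le]

omit [NormedSpace ℂ E] in
theorem integrable_torus (F : C(Torus d, E)) : Integrable (fun t => F t) volume :=
  F.continuous.integrable_of_hasCompactSupport (HasCompactSupport.of_compactSpace _)

variable (d E) in
/-- The mean value of a continuous function on the torus. -/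
def torusMean : C(Torus d, E) →L[ℂ] E :=
  LinearMap.mkContinuous
    { toFun := fun F => ((2 * Real.pi) ^ d)⁻¹ • ∫ t, F t
      map_add' := fun F G => by
        simp only [ContinuousMap.add_apply]
        rw [integral_add (integrable_torus F) (integrable_torus G), smul_add]
      map_smul' := fun c F => by
        simp only [ContinuousMap.smul_apply, RingHom.id_apply]
        rw [integral_smul, smul_comm] }
    1 fun F => by
      have h := norm_integral_le_of_norm_le_const (μ := (volume : Measure (Torus d)))
        (Filter.Eventually.of_forall fun t => F.norm_coe_le_norm t)
      rw [volume_real_torus] at h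
      have hp : (0 : ℝ) < (2 * Real.pi) ^ d := by positivity
      simp only [LinearMap.coe_mk, AddHom.coe_mk, norm_smul, Real.norm_eq_abs, one_mul]
      rw [abs_of_pos (inv_pos.2 hp), inv_mul_le_iff₀ hp]
      exact h.trans_eq (mul_comm _ _)

theorem torusMean_apply (F : C(Torus d, E)) :
    torusMean d E F = ((2 * Real.pi) ^ d)⁻¹ • ∫ t, F t := rfl

theorem norm_torusMean_le (F : C(Torus d, E)) : ‖torusMean d E F‖ ≤ ‖F‖ := by
  simpa using (torusMean d E).le_of_opNorm_le (LinearMap.mkContinuous_norm_le _ zero_le_one _) F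

theorem map_torusMean [CompleteSpace E] {E' : Type*} [NormedAddCommGroup E'] [NormedSpace ℂ E']
    [CompleteSpace E']
    (T : E →L[ℂ] E') (F : C(Torus d, E)) :
    T (torusMean d E F) = torusMean d E' ((T : C(E, E')).comp F) := by
  rw [torusMean_apply, torusMean_apply]
  have : T (((2 * Real.pi) ^ d : ℝ)⁻¹ • ∫ t, F t) = ((2 * Real.pi) ^ d : ℝ)⁻¹ • T (∫ t, F t) :=
    (T.restrictScalars ℝ).map_smul _ _
  rw [this, ← T.integral_comp_comm (integrable_torus F)]
  rfl

theorem torusMean_const [CompleteSpace E] (e : E) :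
    torusMean d E (ContinuousMap.const _ e) = e := by
  rw [torusMean_apply]
  simp only [ContinuousMap.const_apply, integral_const, volume_real_torus]
  rw [smul_smul, inv_mul_cancel₀ (by positivity), one_smul]

theorem torusMean_phaseMap (y : Fin d → ℤ) :
    torusMean d ℂ (phaseMap y) = if y = 0 then 1 else 0 := by
  split_ifs with h
  · subst h
    have : phaseMap (0 : Fin d → ℤ) = ContinuousMap.const _ (1 : ℂ) := by
      ext k; simp [phase_zero_right]
    rw [this, torusMean_const]
  · obtain ⟨j, hj⟩ : ∃ j, y j ≠ 0 := by
      by_contra! h'; exact h (funext h')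
    rw [torusMean_apply]
    have h1 : ∫ t : Torus d, phaseMap y t = ∏ i, ∫ t : AddCircle (2 * Real.pi), fourier (y i) t := by
      rw [← integral_fintype_prod_volume_eq_prod]
      congr 1; ext t
      simp [phase_eq_prod, AddCircle.toCircle_zsmul]
    -- A half-period shift in the frequency `y j ≠ 0` changes the sign of the character and
    -- preserves the integral.
    have h2 : ∫ t : AddCircle (2 * Real.pi), fourier (y j) t = 0 :=
      integral_eq_zero_of_add_right_eq_neg (fourier_add_half_inv_index hj Real.two_pi_pos)
    rw [h1, Finset.prod_eq_zero (Finset.mem_univ j) h2, smul_zero]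

theorem torusMean_phaseMap_smul [CompleteSpace E] (y : Fin d → ℤ) (e : E) (F : C(Torus d, E))
    (hF : ∀ t, F t = phase t y • e) : torusMean d E F = if y = 0 then e else 0 := by
  have h := map_torusMean (ContinuousLinearMap.toSpanSingleton ℂ e) (phaseMap y)
  have h' : ((ContinuousLinearMap.toSpanSingleton ℂ e : ℂ →L[ℂ] E) : C(ℂ, E)).comp (phaseMap y)
      = F := by
    ext t; simp [hF]
  rw [h', torusMean_phaseMap] at h
  rw [← h]
  split_ifs <;> simp

/-- The majorant is kept complex-valued, so that its mean can be computed from orthogonality of the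
characters. -/
theorem norm_torusMean_le_re (F : C(Torus d, E)) (G : C(Torus d, ℂ))
    (h : ∀ t, ‖F t‖ ≤ (G t).re) : ‖torusMean d E F‖ ≤ (torusMean d ℂ G).re := by
  rw [torusMean_apply, torusMean_apply, norm_smul, Complex.smul_re, smul_eq_mul, Real.norm_eq_abs,
    abs_of_pos (by positivity)]
  refine mul_le_mul_of_nonneg_left ?_ (by positivity)
  have : (∫ t, G t).re = ∫ t, (G t).re := by
    exact (integral_re (integrable_torus G)).symm
  rw [this]
  exact norm_integral_le_of_norm_le (integrable_torus G).re (Filter.Eventually.of_forall h)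

instance : Measure.IsNegInvariant (volume : Measure (AddCircle (2 * Real.pi))) := by
  have : Measure.Regular (volume : Measure (AddCircle (2 * Real.pi))) := inferInstance
  infer_instance

theorem torusMean_sub_left (F : C(Torus d, E)) (t : Torus d) (G : C(Torus d, E))
    (hG : ∀ s, G s = F (t - s)) : torusMean d E G = torusMean d E F := by
  rw [torusMean_apply, torusMean_apply, ← integral_sub_left_eq_self (fun s => F s) volume t]
  simp only [hG]

end Mean

end Bloch

namespace Bloch

/-! ### The Fejér kernel and its positivity -/

section Fejer

theorem sum_Icc_neg_succ {A : Type*} [AddCommMonoid A] (m : ℕ) (f : ℤ → A) :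
    ∑ l ∈ Finset.Icc (-((m + 1 : ℕ) : ℤ)) ((m + 1 : ℕ) : ℤ), f l =
      (f (-((m : ℤ) + 1)) + f ((m : ℤ) + 1)) + ∑ l ∈ Finset.Icc (-(m : ℤ)) m, f l := by
  have : Finset.Icc (-((m + 1 : ℕ) : ℤ)) ((m + 1 : ℕ) : ℤ) =
      insert (-((m : ℤ) + 1)) (insert ((m : ℤ) + 1) (Finset.Icc (-(m : ℤ)) m)) := by
    ext l; simp only [Finset.mem_Icc, Finset.mem_insert]; omega
  rw [this, Finset.sum_insert, Finset.sum_insert, add_assoc]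
  · simp
  · simp only [Finset.mem_Icc, Finset.mem_insert]; omega

/-- The Dirichlet kernel is split at `l = 0`. The two halves are written as the cross terms produced
by adding one power to each factor in `sum_fejer_zpow`. -/
theorem sum_Icc_zpow {z : ℂ} (hz : z ≠ 0) (m : ℕ) :
    ∑ l ∈ Finset.Icc (-(m : ℤ)) m, z ^ l =
      z ^ m * ∑ r ∈ Finset.range m, z⁻¹ ^ r + z⁻¹ ^ m * ∑ r ∈ Finset.range m, z ^ r + 1 := by
  have key : ∀ w : ℂ, w ≠ 0 → ∀ m : ℕ, w ^ m * ∑ r ∈ Finset.range m, w⁻¹ ^ r =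
      ∑ r ∈ Finset.range m, w ^ (r + 1) := by
    intro w hw m
    induction m with
    | zero => simp
    | succ m ih =>
      have e : w ^ (m + 1) * w⁻¹ ^ m = w := by rw [inv_pow, pow_succ]; field_simp
      rw [Finset.sum_range_succ, Finset.sum_range_succ', mul_add, e, pow_succ', mul_assoc, ih,
        Finset.mul_sum]
      simp [pow_succ']
  have h2 := key z⁻¹ (inv_ne_zero hz) m
  rw [inv_inv] at h2
  rw [key z hz, h2]
  clear h2
  induction m with
  | zero => simp
  | succ m ih =>
    rw [sum_Icc_neg_succ, ih, Finset.sum_range_succ, Finset.sum_range_succ]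
    have e1 : z ^ (-((m : ℤ) + 1)) = z⁻¹ ^ (m + 1) := by
      rw [zpow_neg, inv_pow]; norm_cast
    have e2 : z ^ ((m : ℤ) + 1) = z ^ (m + 1) := by norm_cast
    rw [e1, e2]; ring

/-- Raising `m` by one raises every weight by one, that is, adds a Dirichlet kernel. On the other
side it adds the cross terms and the product `z^(m+1) z^(-(m+1)) = 1`. -/
theorem sum_fejer_zpow {z : ℂ} (hz : z ≠ 0) (m : ℕ) :
    ∑ l ∈ Finset.Icc (-(m : ℤ)) m, (((m : ℝ) + 1 - |(l : ℝ)| : ℝ) : ℂ) * z ^ l =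
      (∑ r ∈ Finset.range (m + 1), z ^ r) * ∑ r ∈ Finset.range (m + 1), z⁻¹ ^ r := by
  induction m with
  | zero => simp
  | succ m ih =>
    have h1 : ∑ l ∈ Finset.Icc (-((m + 1 : ℕ) : ℤ)) ((m + 1 : ℕ) : ℤ),
        ((((m + 1 : ℕ) : ℝ) + 1 - |(l : ℝ)| : ℝ) : ℂ) * z ^ l =
        ∑ l ∈ Finset.Icc (-((m + 1 : ℕ) : ℤ)) ((m + 1 : ℕ) : ℤ),
          (((m : ℝ) + 1 - |(l : ℝ)| : ℝ) : ℂ) * z ^ l +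
        ∑ l ∈ Finset.Icc (-((m + 1 : ℕ) : ℤ)) ((m + 1 : ℕ) : ℤ), z ^ l := by
      rw [← Finset.sum_add_distrib]
      refine Finset.sum_congr rfl fun l _ => ?_
      push_cast; ring
    -- The old weights vanish at the two new endpoints `l = ±(m+1)`, so the longer range does not
    -- change the old sum.
    have e1 : (m : ℝ) + 1 - |((-((m : ℤ) + 1) : ℤ) : ℝ)| = 0 := by
      push_cast
      rw [abs_neg, abs_of_nonneg (by positivity)]; ring
    have e2 : (m : ℝ) + 1 - |(((m : ℤ) + 1 : ℤ) : ℝ)| = 0 := by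
      push_cast
      rw [abs_of_nonneg (by positivity)]; ring
    have h0 : z ^ (m + 1) * z⁻¹ ^ (m + 1) = 1 := by
      rw [← mul_pow, mul_inv_cancel₀ hz, one_pow]
    rw [h1, sum_Icc_neg_succ m (fun l => (((m : ℝ) + 1 - |(l : ℝ)| : ℝ) : ℂ) * z ^ l), e1, e2, ih,
      sum_Icc_zpow hz, Finset.sum_range_succ (n := m + 1), Finset.sum_range_succ (n := m + 1)]
    simp only [Complex.ofReal_zero, zero_mul, zero_add]
    linear_combination -h0

variable {d : ℕ}

/-- The Fejér weights `∏_j (1 - |y_j| / (m+1))`. -/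
def fejerWeight (m : ℕ) (y : Fin d → ℤ) : ℝ := ∏ j, (1 - |(y j : ℝ)| / (m + 1))

theorem fejerWeight_zero (m : ℕ) : fejerWeight m (0 : Fin d → ℤ) = 1 := by simp [fejerWeight]

theorem fejerWeight_single (m : ℕ) (j : Fin d) (l : ℤ) :
    fejerWeight m (Pi.single j l) = 1 - |(l : ℝ)| / (m + 1) := by
  rw [fejerWeight, Finset.prod_eq_single j]
  · simp
  · intro i _ hi; simp [hi]
  · simp

variable (d) in
/-- The Fejér kernel on the torus. -/
def fejerKernel (m : ℕ) : C(Torus d, ℂ) :=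
  ∑ y ∈ VL d m, (fejerWeight m y : ℂ) • phaseMap y

theorem fejerKernel_apply (m : ℕ) (s : Torus d) :
    fejerKernel d m s = ∑ y ∈ VL d m, (fejerWeight m y : ℂ) * phase s y := by
  simp [fejerKernel, ContinuousMap.sum_apply]

/-- The kernel is a product over coordinates of `(m+1)⁻¹ |∑_{r ≤ m} z^r|²`, because `z⁻¹` is the
conjugate of `z` on the unit circle. -/
theorem fejerKernel_nonneg (m : ℕ) (s : Torus d) : 0 ≤ fejerKernel d m s := by
  have h : fejerKernel d m s = ∏ j, ∑ l ∈ Finset.Icc (-(m : ℤ)) m,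
      ((1 - |(l : ℝ)| / (m + 1) : ℝ) : ℂ) * ((s j).toCircle : ℂ) ^ l := by
    rw [fejerKernel_apply, Finset.prod_univ_sum]
    refine Finset.sum_congr rfl fun y _ => ?_
    rw [Finset.prod_mul_distrib, phase_eq_prod, fejerWeight, Complex.ofReal_prod]
  rw [h]
  refine Finset.prod_nonneg fun j _ => ?_
  set z : ℂ := ((s j).toCircle : ℂ) with hz
  have hz0 : z ≠ 0 := Circle.coe_ne_zero _
  have hc : z⁻¹ = star z := by
    rw [hz, ← Circle.coe_inv, Circle.coe_inv_eq_conj]; rfl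
  have h1 : ∑ l ∈ Finset.Icc (-(m : ℤ)) m, ((1 - |(l : ℝ)| / (m + 1) : ℝ) : ℂ) * z ^ l =
      (((m : ℝ) + 1)⁻¹ : ℝ) *
        ∑ l ∈ Finset.Icc (-(m : ℤ)) m, (((m : ℝ) + 1 - |(l : ℝ)| : ℝ) : ℂ) * z ^ l := by
    rw [Finset.mul_sum]
    refine Finset.sum_congr rfl fun l _ => ?_
    rw [← mul_assoc, ← Complex.ofReal_mul]
    congr 2
    have : (m : ℝ) + 1 ≠ 0 := by positivity
    field_simp
  rw [h1, sum_fejer_zpow hz0]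
  refine mul_nonneg (by exact_mod_cast (by positivity : (0 : ℝ) ≤ ((m : ℝ) + 1)⁻¹)) ?_
  have : ∑ r ∈ Finset.range (m + 1), z⁻¹ ^ r = star (∑ r ∈ Finset.range (m + 1), z ^ r) := by
    simp [hc, star_sum]
  rw [this]
  exact mul_star_self_nonneg _

theorem norm_fejerKernel (m : ℕ) (s : Torus d) :
    ‖fejerKernel d m s‖ = (fejerKernel d m s).re ∧ (fejerKernel d m s).im = 0 := by
  have h := Complex.nonneg_iff.1 (fejerKernel_nonneg m s)
  refine ⟨?_, h.2.symm⟩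
  have : fejerKernel d m s = ((fejerKernel d m s).re : ℂ) := Complex.ext rfl h.2.symm
  rw [this, Complex.norm_real, Real.norm_eq_abs, abs_of_nonneg h.1, Complex.ofReal_re]

theorem neg_mem_VL {m : ℕ} {y : Fin d → ℤ} : -y ∈ VL d m ↔ y ∈ VL d m := by
  simp only [VL, Fintype.mem_piFinset, Finset.mem_Icc, Pi.neg_apply]
  exact forall_congr' fun j => by omega

/-- By orthogonality only the frequency `-z` of the kernel survives. This gives exact moments of the
kernel, used for `z = 0` and `z = ±e_j`. -/
theorem torusMean_fejerKernel_mul (m : ℕ) (z : Fin d → ℤ) (hz : z ∈ VL d m) :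
    torusMean d ℂ (fejerKernel d m * phaseMap z) = fejerWeight m (-z) := by
  have : fejerKernel d m * phaseMap z =
      ∑ y ∈ VL d m, (fejerWeight m y : ℂ) • phaseMap (y + z) := by
    ext s
    simp [fejerKernel_apply, ContinuousMap.sum_apply, phase_add_right, Finset.sum_mul, mul_assoc]
  rw [this, map_sum]
  simp only [map_smul, torusMean_phaseMap, smul_eq_mul, mul_ite, mul_one, mul_zero,
    add_eq_zero_iff_eq_neg]
  rw [Finset.sum_ite_eq' (VL d m) (-z), if_pos (neg_mem_VL.2 hz)]

end Fejer

end Bloch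

namespace Bloch

/-! ### Fejér's theorem for functions with values in a Banach space -/

section FejerTheorem

variable {d : ℕ} {E : Type*} [NormedAddCommGroup E] [NormedSpace ℂ E]

variable (E) in
/-- The Fourier coefficient `(2π)^{-d} ∫ e^{-i t·y} F(t) dt`. -/
def fourierMean (y : Fin d → ℤ) : C(Torus d, E) →ₗ[ℂ] E where
  toFun F := torusMean d E (phaseMap (-y) • F)
  map_add' F G := by rw [smul_add, map_add]
  map_smul' c F := by
    have : phaseMap (-y) • c • F = c • phaseMap (-y) • F := by
      ext t; exact smul_comm _ _ _
    rw [this, map_smul, RingHom.id_apply]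

theorem fourierMean_apply (y : Fin d → ℤ) (F : C(Torus d, E)) :
    fourierMean E y F = torusMean d E (phaseMap (-y) • F) := rfl

theorem norm_fourierMean_le (y : Fin d → ℤ) (F : C(Torus d, E)) : ‖fourierMean E y F‖ ≤ ‖F‖ := by
  refine (norm_torusMean_le _).trans ((ContinuousMap.norm_le _ (norm_nonneg _)).2 fun t => ?_)
  rw [ContinuousMap.smul_apply', norm_smul, phaseMap_apply, norm_phase, one_mul]
  exact F.norm_coe_le_norm t

theorem map_fourierMean [CompleteSpace E] {E' : Type*} [NormedAddCommGroup E'] [NormedSpace ℂ E']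
    [CompleteSpace E'] (T : E →L[ℂ] E') (y : Fin d → ℤ) (F : C(Torus d, E)) :
    T (fourierMean E y F) = fourierMean E' y ((T : C(E, E')).comp F) := by
  rw [fourierMean_apply, map_torusMean, fourierMean_apply]
  congr 1
  ext t
  simp

theorem fourierMean_phase_smul [CompleteSpace E] (y z : Fin d → ℤ) (e : E) (F : C(Torus d, E))
    (hF : ∀ t, F t = phase t z • e) : fourierMean E y F = if z = y then e else 0 := by
  rw [fourierMean_apply, torusMean_phaseMap_smul (-y + z) e]
  · simp only [neg_add_eq_zero, eq_comm]
  · intro t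
    rw [ContinuousMap.smul_apply', hF, phaseMap_apply, smul_smul, phase_add_right]

/-- The Cesàro means of the Fourier series of `F`. -/
def fejerMean (F : C(Torus d, E)) (m : ℕ) (t : Torus d) : E :=
  ∑ y ∈ VL d m, (fejerWeight m y : ℂ) • phase t y • fourierMean E y F

/-- The Cesàro mean is the convolution of `F` with the Fejér kernel, after the substitution `s ↦ t -
s`. -/
theorem fejerMean_eq (F : C(Torus d, E)) (m : ℕ) (t : Torus d) (G : C(Torus d, E))
    (hG : ∀ s, G s = fejerKernel d m s • F (t - s)) : fejerMean F m t = torusMean d E G := by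
  let G' : C(Torus d, E) := ∑ y ∈ VL d m, ((fejerWeight m y : ℂ) * phase t y) • phaseMap (-y) • F
  have h1 : fejerMean F m t = torusMean d E G' := by
    simp only [G', map_sum, map_smul, fejerMean, fourierMean_apply, smul_smul]
  rw [h1]
  refine (torusMean_sub_left G' t G fun s => ?_).symm
  rw [hG, fejerKernel_apply]
  simp only [G', ContinuousMap.sum_apply, ContinuousMap.smul_apply, ContinuousMap.smul_apply',
    phaseMap_apply, Finset.sum_smul, smul_smul]
  refine Finset.sum_congr rfl fun y _ => ?_
  rw [← phase_neg_left, neg_sub, sub_eq_add_neg s t, phase_add_left, phase_neg_left]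
  congr 1
  linear_combination (-(fejerWeight m y : ℂ) * phase s y) * phase_mul_phase_neg t y

theorem one_sub_re_toCircle_nonneg (θ : AddCircle (2 * Real.pi)) :
    0 ≤ 2 - 2 * (θ.toCircle : ℂ).re := by
  have := Complex.re_le_norm (θ.toCircle : ℂ)
  rw [Circle.norm_coe] at this
  linarith

theorem eq_zero_of_re_toCircle {θ : AddCircle (2 * Real.pi)}
    (h : 2 - 2 * (θ.toCircle : ℂ).re = 0) : θ = 0 := by
  have h1 : (θ.toCircle : ℂ).re = 1 := by linarith
  have h2 : Complex.normSq (θ.toCircle : ℂ) = 1 := Circle.normSq_coe _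
  rw [Complex.normSq_apply, h1] at h2
  have h3 : (θ.toCircle : ℂ).im = 0 := by nlinarith
  have h4 : θ.toCircle = (0 : AddCircle (2 * Real.pi)).toCircle := by
    rw [AddCircle.toCircle_zero]
    exact Circle.ext (Complex.ext (by simpa using h1) (by simpa using h3))
  exact AddCircle.injective_toCircle Real.two_pi_pos.ne' h4

omit [NormedSpace ℂ E] in
-- The modulus of continuity is dominated by a trigonometric polynomial, whose mean against the
-- Fejér kernel is known exactly. Near `0` uniform continuity gives `ε`. Away from `0` the sum of
-- the `2 - 2 cos s_j` has a positive minimum by compactness and absorbs the bound `2‖F‖`.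
theorem exists_modulus (F : C(Torus d, E)) {ε : ℝ} (hε : 0 < ε) :
    ∃ C : ℝ, 0 ≤ C ∧ ∀ t s : Torus d,
      ‖F (t - s) - F t‖ ≤ ε + C * ∑ j, (2 - 2 * ((s j).toCircle : ℂ).re) := by
  obtain ⟨δ, hδ, hF⟩ := Metric.uniformContinuous_iff.1
    (CompactSpace.uniformContinuous_of_continuous F.continuous) ε hε
  let g : Torus d → ℝ := fun s => ∑ j, (2 - 2 * ((s j).toCircle : ℂ).re)
  have hg : Continuous g := continuous_finsetSum _ fun j _ =>
    continuous_const.sub (continuous_const.mul (Complex.continuous_re.comp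
      (continuous_subtype_val.comp (continuous_toCircle_apply j))))
  have hg0 : ∀ s, 0 ≤ g s := fun s => Finset.sum_nonneg fun j _ => one_sub_re_toCircle_nonneg _
  have hK : IsCompact {s : Torus d | δ ≤ ‖s‖} :=
    (isClosed_le continuous_const continuous_norm).isCompact
  have hpos : ∃ c : ℝ, 0 < c ∧ ∀ s : Torus d, δ ≤ ‖s‖ → c ≤ g s := by
    -- The set is empty for `d = 0` or large `δ`; any positive constant then serves.
    rcases Set.eq_empty_or_nonempty {s : Torus d | δ ≤ ‖s‖} with he | hne
    · refine ⟨1, one_pos, fun s hs => ?_⟩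
      have : s ∈ {s : Torus d | δ ≤ ‖s‖} := hs
      rw [he] at this
      exact this.elim
    · obtain ⟨s₀, hs₀, hmin⟩ := hK.exists_isMinOn hne hg.continuousOn
      refine ⟨g s₀, lt_of_le_of_ne (hg0 s₀) fun h0 => ?_, fun s hs => hmin hs⟩
      have h1 := (Finset.sum_eq_zero_iff_of_nonneg fun j _ => one_sub_re_toCircle_nonneg _).1 h0.symm
      have : s₀ = 0 := funext fun j => eq_zero_of_re_toCircle (h1 j (Finset.mem_univ j))
      rw [this] at hs₀
      simp only [Set.mem_ofPred_eq, norm_zero] at hs₀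
      linarith
  obtain ⟨c, hc, hcg⟩ := hpos
  refine ⟨2 * ‖F‖ / c, by positivity, fun t s => ?_⟩
  rcases lt_or_ge ‖s‖ δ with hs | hs
  · have h1 : dist (t - s) t < δ := by simpa [dist_eq_norm] using hs
    have h2 := (hF h1).le
    rw [dist_eq_norm] at h2
    have := mul_nonneg (by positivity : 0 ≤ 2 * ‖F‖ / c) (hg0 s)
    linarith
  · have h1 : ‖F (t - s) - F t‖ ≤ 2 * ‖F‖ := by
      have := norm_sub_le (F (t - s)) (F t)
      have a := F.norm_coe_le_norm (t - s)
      have b := F.norm_coe_le_norm t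
      linarith
    have h2 : 2 * ‖F‖ ≤ 2 * ‖F‖ / c * g s := by
      rw [div_mul_eq_mul_div, le_div_iff₀ hc]
      exact mul_le_mul_of_nonneg_left (hcg s hs) (by positivity)
    linarith

theorem zero_mem_VL (m : ℕ) : (0 : Fin d → ℤ) ∈ VL d m := by
  simp [VL]

theorem single_mem_VL {m : ℕ} (hm : 1 ≤ m) (j : Fin d) : (Pi.single j 1 : Fin d → ℤ) ∈ VL d m := by
  simp only [VL, Fintype.mem_piFinset, Finset.mem_Icc]
  intro i
  rcases eq_or_ne i j with rfl | h
  · simp only [Pi.single_eq_same]; omega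
  · simp only [Pi.single_eq_of_ne h]; omega

/-- The kernel is nonnegative with mean one, so the error is at most the mean of the kernel times
the modulus. Each `2 - 2 cos s_j` contributes `2 - 2(1 - 1/(m+1)) = 2/(m+1)`. The condition `1 ≤ m`
puts the frequencies `±e_j` inside the cube. -/
theorem norm_fejerMean_sub_le [CompleteSpace E] (F : C(Torus d, E)) {ε C : ℝ}
    (h : ∀ t s : Torus d,
      ‖F (t - s) - F t‖ ≤ ε + C * ∑ j, (2 - 2 * ((s j).toCircle : ℂ).re))
    {m : ℕ} (hm : 1 ≤ m) (t : Torus d) :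
    ‖fejerMean F m t - F t‖ ≤ ε + C * d * (2 / (m + 1)) := by
  let G₁ : C(Torus d, E) := ⟨fun s => fejerKernel d m s • F (t - s),
    (fejerKernel d m).continuous.smul (F.continuous.comp (continuous_const.sub continuous_id))⟩
  let G₂ : C(Torus d, E) := ∑ y ∈ VL d m,
    (fejerWeight m y : ℂ) • phaseMap y • ContinuousMap.const _ (F t)
  have e1 : fejerMean F m t = torusMean d E G₁ := fejerMean_eq F m t G₁ fun _ => rfl
  have e2 : F t = torusMean d E G₂ := by
    have hy : ∀ y : Fin d → ℤ, torusMean d E (phaseMap y • ContinuousMap.const _ (F t)) =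
        if y = 0 then F t else 0 := fun y => torusMean_phaseMap_smul y (F t) _ fun s => by
      rw [ContinuousMap.smul_apply', ContinuousMap.const_apply, phaseMap_apply]
    simp only [G₂, map_sum, map_smul, hy, smul_ite, smul_zero]
    rw [Finset.sum_ite_eq' (VL d m) 0, if_pos (zero_mem_VL m), fejerWeight_zero, Complex.ofReal_one,
      one_smul]
  -- This is the kernel times the modulus, with `2 cos s_j` written as the sum of the characters of
  -- `e_j` and `-e_j`, so that its mean is read off from the moments.
  let H : C(Torus d, ℂ) := (ε : ℂ) • (fejerKernel d m * phaseMap 0) + (C : ℂ) • ∑ j : Fin d,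
    ((2 : ℂ) • (fejerKernel d m * phaseMap 0) - fejerKernel d m * phaseMap (Pi.single j 1)
      - fejerKernel d m * phaseMap (Pi.single j (-1)))
  have hH : ∀ s, H s = ((‖fejerKernel d m s‖ *
      (ε + C * ∑ j, (2 - 2 * ((s j).toCircle : ℂ).re)) : ℝ) : ℂ) := by
    intro s
    obtain ⟨hk1, hk2⟩ := norm_fejerKernel m s
    have hk : fejerKernel d m s = (‖fejerKernel d m s‖ : ℂ) := by
      rw [hk1]; exact Complex.ext rfl hk2
    have hj : ∀ j : Fin d, phase s (Pi.single j 1) + phase s (Pi.single j (-1)) =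
        ((2 * ((s j).toCircle : ℂ).re : ℝ) : ℂ) := by
      intro j
      rw [phase_single, phase_single, zpow_one, zpow_neg_one, ← Circle.coe_inv,
        Circle.coe_inv_eq_conj, Complex.add_conj]
    simp only [H, ContinuousMap.add_apply, ContinuousMap.smul_apply, ContinuousMap.mul_apply,
      ContinuousMap.sum_apply, ContinuousMap.sub_apply, phaseMap_apply, phase_zero_right,
      smul_eq_mul]
    rw [Complex.ofReal_mul, ← hk, Complex.ofReal_add, Complex.ofReal_mul, Complex.ofReal_sum]
    simp only [Complex.ofReal_sub, ← hj, Complex.ofReal_ofNat]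
    rw [mul_add, mul_one, mul_comm (ε : ℂ)]
    congr 1
    rw [mul_left_comm, Finset.mul_sum, Finset.mul_sum, Finset.mul_sum]
    refine Finset.sum_congr rfl fun j _ => ?_
    ring
  have hmean : (torusMean d ℂ H).re = ε + C * d * (2 / (m + 1)) := by
    have a0 := torusMean_fejerKernel_mul m (0 : Fin d → ℤ) (zero_mem_VL m)
    have a1 := fun j : Fin d => torusMean_fejerKernel_mul m _ (single_mem_VL hm j)
    have a2 := fun j : Fin d => torusMean_fejerKernel_mul m (Pi.single j (-1))
      (by rw [Pi.single_neg]; exact neg_mem_VL.2 (single_mem_VL hm j))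
    simp only [H, map_add, map_smul, map_sum, map_sub, a0, a1, a2, neg_zero,
      fejerWeight_zero, ← Pi.single_neg, neg_neg, fejerWeight_single]
    simp only [Finset.sum_const, Finset.card_univ, Fintype.card_fin, smul_eq_mul, nsmul_eq_mul]
    simp only [Int.cast_neg, Int.cast_one, abs_neg, abs_one]
    norm_cast
    ring
  have e3 : fejerMean F m t - F t = torusMean d E (G₁ - G₂) := by rw [map_sub, ← e1, ← e2]
  rw [e3, ← hmean]
  refine norm_torusMean_le_re _ _ fun s => ?_
  rw [hH, Complex.ofReal_re]
  have : (G₁ - G₂) s = fejerKernel d m s • (F (t - s) - F t) := by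
    simp only [G₁, G₂, ContinuousMap.sub_apply, ContinuousMap.coe_mk, ContinuousMap.sum_apply,
      ContinuousMap.smul_apply, ContinuousMap.smul_apply', ContinuousMap.const_apply,
      phaseMap_apply, smul_smul]
    rw [← Finset.sum_smul, ← fejerKernel_apply, smul_sub]
  rw [this, norm_smul]
  exact mul_le_mul_of_nonneg_left (h t s) (norm_nonneg _)

/-- **Fejér's theorem** on the torus, for continuous functions with values in a Banach space. -/
theorem tendstoUniformly_fejerMean [CompleteSpace E] (F : C(Torus d, E)) :
    TendstoUniformly (fejerMean F) F Filter.atTop := by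
  rw [Metric.tendstoUniformly_iff]
  intro ε hε
  obtain ⟨C, hC, hF⟩ := exists_modulus F (half_pos hε)
  have hlim : Filter.Tendsto (fun m : ℕ => C * d * (2 / ((m : ℝ) + 1))) Filter.atTop (𝓝 0) := by
    have := (tendsto_one_div_add_atTop_nhds_zero_nat (𝕜 := ℝ)).const_mul (C * d * 2)
    rw [mul_zero] at this
    refine this.congr fun m => ?_
    ring
  filter_upwards [Filter.eventually_ge_atTop 1, hlim.eventually (gt_mem_nhds (half_pos hε))]
    with m hm hm' t
  rw [dist_comm, dist_eq_norm]
  have := norm_fejerMean_sub_le F hF hm t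
  linarith

end FejerTheorem

end Bloch

namespace Bloch

/-! ## Products of the generators -/

section ListProd

theorem prod_ofFn_zpow_add {G : Type*} [Group G] {d : ℕ} (g : Fin d → G)
    (hg : ∀ i j, Commute (g i) (g j)) (x y : Fin d → ℤ) :
    (List.ofFn fun j => g j ^ (x j + y j)).prod =
      (List.ofFn fun j => g j ^ x j).prod * (List.ofFn fun j => g j ^ y j).prod := by
  induction d with
  | zero => simp
  | succ d ih =>
    have hc : Commute (g 0 ^ y 0) (List.ofFn fun j : Fin d => g j.succ ^ x j.succ).prod := by
      refine Commute.list_prod_right _ _ fun a ha => ?_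
      obtain ⟨j, rfl⟩ := List.mem_ofFn.1 ha
      exact ((hg _ _).zpow_zpow _ _)
    simp only [List.ofFn_succ, List.prod_cons]
    rw [ih (fun j => g j.succ) (fun i j => hg _ _) (fun j => x j.succ) (fun j => y j.succ), zpow_add]
    simp only [mul_assoc]
    rw [← mul_assoc (g 0 ^ y 0), hc.eq]
    simp only [mul_assoc]

theorem prod_ofFn_zpow_single {G : Type*} [Group G] {d : ℕ} (g : Fin d → G) (j : Fin d) (l : ℤ) :
    (List.ofFn fun i => g i ^ (Pi.single j l : Fin d → ℤ) i).prod = g j ^ l := by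
  induction d with
  | zero => exact j.elim0
  | succ d ih =>
    rw [List.ofFn_succ, List.prod_cons]
    refine Fin.cases ?_ (fun i => ?_) j
    · have : (List.ofFn fun i : Fin d => g i.succ ^ (Pi.single 0 l : Fin (d + 1) → ℤ) i.succ).prod
          = 1 := List.prod_eq_one fun a ha => by
        obtain ⟨i, rfl⟩ := List.mem_ofFn.1 ha
        simp
      rw [this]; simp
    · have := ih (fun k => g k.succ) i
      rw [Pi.single_eq_of_ne (Fin.succ_ne_zero i).symm, zpow_zero, one_mul, ← this]
      congr 2
      funext k
      congr 1
      by_cases h : k = i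
      · subst h; simp
      · rw [Pi.single_eq_of_ne h, Pi.single_eq_of_ne (fun h' => h (Fin.succ_injective _ h'))]

theorem prod_ofFn_mul_central {C G : Type*} [CommMonoid C] [Monoid G] {d : ℕ} (ι : C →* G)
    (hι : ∀ c g, Commute (ι c) g) (c : Fin d → C) (g : Fin d → G) :
    (List.ofFn fun j => ι (c j) * g j).prod = ι (∏ j, c j) * (List.ofFn g).prod := by
  induction d with
  | zero => simp
  | succ d ih =>
    simp only [List.ofFn_succ, List.prod_cons, ih, Fin.prod_univ_succ, map_mul]
    simp only [mul_assoc]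
    rw [← mul_assoc (g 0), ← (hι _ (g 0)).eq]
    simp only [mul_assoc]

end ListProd

/-! ### Scalar unitaries, which are central -/

section Scalars

variable {B : Type*} [CStarAlgebra B]

variable (B) in
/-- The scalar unitaries. -/
def scal : Circle →* unitary B where
  toFun c := ⟨(c : ℂ) • (1 : B), by
    have h : (starRingEnd ℂ) (c : ℂ) * (c : ℂ) = 1 := by
      rw [← Circle.coe_inv_eq_conj, ← Circle.coe_mul]; simp
    constructor
    · simp [star_smul, smul_smul, mul_comm (c : ℂ), h]
    · simp [star_smul, smul_smul, h]⟩
  map_one' := Subtype.ext (by simp)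
  map_mul' a b := Subtype.ext (by simp [smul_smul, mul_comm])

theorem coe_scal (c : Circle) : (scal B c : B) = (c : ℂ) • (1 : B) := rfl

theorem coe_scal_mul (c : Circle) (v : unitary B) :
    ((scal B c * v : unitary B) : B) = (c : ℂ) • (v : B) := by
  rw [Submonoid.coe_mul, coe_scal, smul_mul_assoc, one_mul]

/-- The map induced by a *-homomorphism on the unitary groups. -/
def unitaryMap {B' : Type*} [CStarAlgebra B'] (ψ : B →⋆ₐ[ℂ] B') : unitary B →* unitary B' where
  toFun v := ⟨ψ v, by
    constructor
    · rw [← map_star, ← map_mul, Unitary.star_mul_self_of_mem v.2, map_one]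
    · rw [← map_star, ← map_mul, Unitary.mul_star_self_of_mem v.2, map_one]⟩
  map_one' := Subtype.ext (map_one ψ)
  map_mul' v w := Subtype.ext (map_mul ψ _ _)

theorem commute_scal (c : Circle) (v : unitary B) : Commute (scal B c) v :=
  Subtype.ext (by simp [coe_scal])

end Scalars

/-! ### Monomials of a representation and their linear span -/

namespace CovRep

variable {d N : ℕ} {X : Type*} [TopologicalSpace X] [CompactSpace X] {τ : Fin d → C(X, X)}
  {φ : Matrix (Fin d) (Fin d) ℝ} {B : Type*} [CStarAlgebra B]

/-- The ordered monomials `u_1^{x_1} ⋯ u_d^{x_d}`. -/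
def word (R : CovRep N τ φ B) (x : Fin d → ℤ) : unitary B := (List.ofFn fun j => R.u j ^ x j).prod

/-- The quadratic form `∑_{i<j} φ_ij x_i x_j`. -/
def _root_.Bloch.fluxForm (φ : Matrix (Fin d) (Fin d) ℝ) (x : Fin d → ℤ) : ℝ :=
  ∑ i, ∑ j, if i < j then φ i j * x i * x j else 0

/-- The symmetric monomials as unitaries. -/
def umono (R : CovRep N τ φ B) (x : Fin d → ℤ) : unitary B :=
  scal B (Circle.exp (-(fluxForm φ x / 2))) * R.word x

theorem mono_eq (R : CovRep N τ φ B) (x : Fin d → ℤ) : R.mono x = (R.umono x : B) := by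
  rw [umono, coe_scal_mul, mono, word, Circle.coe_exp, fluxForm]
  congr 2
  push_cast
  simp only [apply_ite ((↑) : ℝ → ℂ)]
  push_cast
  ring

/-- Modulo the central subgroup of scalar unitaries the generators commute, so there the exponents
of words add. The value of the phase is never needed for density of the span. -/
theorem word_add (R : CovRep N τ φ B) (x y : Fin d → ℤ) :
    ∃ c : Circle, R.word x * R.word y = scal B c * R.word (x + y) := by
  let Z : Subgroup (unitary B) := (scal B).range
  have : Z.Normal := ⟨by
    rintro _ ⟨c, rfl⟩ g
    rw [← (commute_scal c g).eq, mul_inv_cancel_right]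
    exact ⟨c, rfl⟩⟩
  let q := QuotientGroup.mk' Z
  have hq : ∀ i j, Commute (q (R.u i)) (q (R.u j)) := by
    intro i j
    rw [commute_iff_eq, ← map_mul, ← map_mul]
    refine QuotientGroup.eq.2 ?_
    refine ⟨(Circle.exp (φ i j))⁻¹, ?_⟩
    have h : R.u i * R.u j = scal B (Circle.exp (φ i j)) * (R.u j * R.u i) := by
      refine Subtype.ext ?_
      rw [coe_scal_mul, Circle.coe_exp, mul_comm (φ i j : ℂ)]
      exact R.comm i j
    rw [h, map_inv, mul_inv_rev, mul_assoc, (commute_scal _ _).inv_left.eq, ← mul_assoc,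
      inv_mul_cancel, one_mul]
  have h := prod_ofFn_zpow_add (fun j => q (R.u j)) hq x y
  have hw : ∀ x, q (R.word x) = (List.ofFn fun j => q (R.u j) ^ x j).prod := by
    intro x
    rw [word, map_list_prod, List.map_ofFn]
    simp [Function.comp_def]
  have h' : q (R.word (x + y)) = q (R.word x * R.word y) := by
    rw [map_mul, hw, hw, hw, ← h]; rfl
  obtain ⟨c, hc⟩ := QuotientGroup.eq.1 h'
  exact ⟨c, by rw [(commute_scal c _).eq, hc, mul_inv_cancel_left]⟩

theorem word_single (R : CovRep N τ φ B) (j : Fin d) (l : ℤ) : R.word (Pi.single j l) = R.u j ^ l :=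
  prod_ofFn_zpow_single _ _ _

theorem umono_zero (R : CovRep N τ φ B) : R.umono 0 = 1 := by
  have h1 : fluxForm φ (0 : Fin d → ℤ) = 0 := by simp [fluxForm]
  have h2 : R.word 0 = 1 := List.prod_eq_one fun a ha => by
    obtain ⟨j, rfl⟩ := List.mem_ofFn.1 ha
    simp
  rw [umono, h1, h2]; simp

theorem mono_zero (R : CovRep N τ φ B) : R.mono 0 = 1 := by rw [mono_eq, umono_zero]; rfl

theorem zpow_mul_mono (R : CovRep N τ φ B) (j : Fin d) (l : ℤ) (x : Fin d → ℤ) :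
    ∃ c : ℂ, ((R.u j ^ l : unitary B) : B) * R.mono x = c • R.mono (Pi.single j l + x) := by
  obtain ⟨c, hc⟩ := R.word_add (Pi.single j l) x
  rw [word_single] at hc
  have h : R.u j ^ l * R.umono x = scal B (Circle.exp (-(fluxForm φ x / 2)) * c *
      (Circle.exp (-(fluxForm φ (Pi.single j l + x) / 2)))⁻¹) * R.umono (Pi.single j l + x) := by
    rw [umono, umono, ← mul_assoc, ← (commute_scal _ (R.u j ^ l)).eq, mul_assoc, hc, ← mul_assoc,
      ← mul_assoc, ← map_mul, ← map_mul, inv_mul_cancel_right]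
  refine ⟨(Circle.exp (-(fluxForm φ x / 2)) * c *
      (Circle.exp (-(fluxForm φ (Pi.single j l + x) / 2)))⁻¹ : Circle), ?_⟩
  rw [mono_eq, mono_eq, ← Submonoid.coe_mul, h, coe_scal_mul]

theorem umono_twist (R : CovRep N τ φ B) (z : Fin d → Circle) (x : Fin d → ℤ) :
    (R.twist z).umono x = scal B (∏ j, z j ^ x j) * R.umono x := by
  have hu : ∀ j, (R.twist z).u j = scal B (z j) * R.u j :=
    fun j => Subtype.ext (coe_scal_mul _ _).symm
  have hw : (R.twist z).word x = scal B (∏ j, z j ^ x j) * R.word x := by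
    rw [word, word, ← prod_ofFn_mul_central (scal B) commute_scal]
    congr 2
    funext j
    rw [hu, (commute_scal _ _).mul_zpow, map_zpow]
  rw [umono, umono, hw, ← mul_assoc, ← mul_assoc, ← map_mul, ← map_mul, mul_comm]

theorem mono_twist (R : CovRep N τ φ B) (z : Fin d → Circle) (x : Fin d → ℤ) :
    (R.twist z).mono x = ((∏ j, z j ^ x j : Circle) : ℂ) • R.mono x := by
  rw [mono_eq, mono_eq, umono_twist, coe_scal_mul]

/-- Only the values of `ψ` on the unitary generators matter, so the two representations may live
over different spaces. -/
theorem map_mono {N' : ℕ} {X' : Type*} [TopologicalSpace X'] [CompactSpace X']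
    {τ' : Fin d → C(X', X')} {B' : Type*} [CStarAlgebra B'] (R : CovRep N τ φ B)
    (R' : CovRep N' τ' φ B') (ψ : B →⋆ₐ[ℂ] B') (h : ∀ j, ψ (R.u j : B) = R'.u j)
    (x : Fin d → ℤ) : ψ (R.mono x) = R'.mono x := by
  rw [mono, mono, map_smul]
  congr 1
  have hu : ∀ j, unitaryMap ψ (R.u j) = R'.u j := fun j => Subtype.ext (h j)
  have : unitaryMap ψ (R.word x) = R'.word x := by
    rw [word, word, map_list_prod, List.map_ofFn]
    simp [Function.comp_def, hu]
  exact congrArg Subtype.val this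

/-- The image of a representation under a *-homomorphism. -/
def map {B' : Type*} [CStarAlgebra B'] (R : CovRep N τ φ B) (ψ : B →⋆ₐ[ℂ] B') :
    CovRep N τ φ B' where
  π := ψ.comp R.π
  u j := unitaryMap ψ (R.u j)
  comm i j := by
    have := congrArg ψ (R.comm i j)
    rw [map_mul, map_smul, map_mul] at this
    exact this
  cov f j := by
    have := congrArg ψ (R.cov f j)
    rw [map_mul, map_mul] at this
    exact this

theorem star_mul_π (R : CovRep N τ φ B) (f : MatFun N X) (j : Fin d) :
    star (R.u j : B) * R.π f = R.π (f.comp (τ j)) * star (R.u j : B) := by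
  have h := R.cov f j
  have h1 : star (R.u j : B) * (R.π f * (R.u j : B)) * star (R.u j : B) =
      star (R.u j : B) * ((R.u j : B) * R.π (f.comp (τ j))) * star (R.u j : B) := by rw [h]
  rw [← mul_assoc, mul_assoc _ _ (star (R.u j : B)), ← Unitary.coe_star,
    Unitary.coe_mul_star_self, mul_one, ← mul_assoc, Unitary.coe_star, Unitary.coe_star_mul_self,
    one_mul] at h1
  exact h1

/-- The span of the elements `f u_x`. -/
def monoSpan (R : CovRep N τ φ B) : Submodule ℂ B :=
  Submodule.span ℂ (Set.range fun p : MatFun N X × (Fin d → ℤ) => R.π p.1 * R.mono p.2)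

theorem π_mul_mono_mem (R : CovRep N τ φ B) (f : MatFun N X) (x : Fin d → ℤ) :
    R.π f * R.mono x ∈ R.monoSpan := Submodule.subset_span ⟨(f, x), rfl⟩

/-- The span contains `1` and is stable under left multiplication by each generator and its adjoint,
hence by the whole generated algebra. A left inverse `σ` of `τ j` is what moves `u_j` to the right
of a function: `u_j f = (f ∘ σ) u_j`. -/
theorem adjoin_le_monoSpan (R : CovRep N τ φ B)
    (hτ : ∀ j, ∃ σ : C(X, X), σ.comp (τ j) = ContinuousMap.id X) {a : B}
    (ha : a ∈ StarAlgebra.adjoin ℂ (Set.range R.π ∪ Set.range fun j => (R.u j : B))) :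
    a ∈ R.monoSpan := by
  have hgen : ∀ g ∈ (Set.range R.π ∪ Set.range fun j => (R.u j : B)) ∪
      star (Set.range R.π ∪ Set.range fun j => (R.u j : B)), ∀ (f : MatFun N X) (x : Fin d → ℤ),
      g * (R.π f * R.mono x) ∈ R.monoSpan := by
    have h1 : ∀ (f' f : MatFun N X) (x : Fin d → ℤ),
        R.π f' * (R.π f * R.mono x) ∈ R.monoSpan := fun f' f x => by
      rw [← mul_assoc, ← map_mul]
      exact R.π_mul_mono_mem _ _
    rintro g ((⟨f', rfl⟩ | ⟨j, rfl⟩) | (⟨f', hf'⟩ | ⟨j, hj⟩)) f x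
    · exact h1 f' f x
    · obtain ⟨σ, hσ⟩ := hτ j
      have h2 : (R.u j : B) * R.π f = R.π (f.comp σ) * R.u j := by
        rw [R.cov, ContinuousMap.comp_assoc, hσ, ContinuousMap.comp_id]
      obtain ⟨c, hc⟩ := R.zpow_mul_mono j 1 x
      rw [zpow_one] at hc
      rw [← mul_assoc, h2, mul_assoc, hc, mul_smul_comm]
      exact Submodule.smul_mem _ _ (R.π_mul_mono_mem _ _)
    · have : g = R.π (star f') := by rw [map_star, hf', star_star]
      rw [this]
      exact h1 _ f x
    · have : g = star (R.u j : B) := by rw [← star_star g]; exact congrArg star hj.symm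
      obtain ⟨c, hc⟩ := R.zpow_mul_mono j (-1) x
      rw [zpow_neg_one, ← Unitary.star_eq_inv, Unitary.coe_star] at hc
      rw [this, ← mul_assoc, star_mul_π, mul_assoc, hc, mul_smul_comm]
      exact Submodule.smul_mem _ _ (R.π_mul_mono_mem _ _)
  have hmul : ∀ a ∈ Algebra.adjoin ℂ ((Set.range R.π ∪ Set.range fun j => (R.u j : B)) ∪
      star (Set.range R.π ∪ Set.range fun j => (R.u j : B))), ∀ w ∈ R.monoSpan,
      a * w ∈ R.monoSpan := by
    intro a ha
    induction ha using Algebra.adjoin_induction with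
    | mem g hg =>
      intro w hw
      induction hw using Submodule.span_induction with
      | mem w hw => obtain ⟨⟨f, x⟩, rfl⟩ := hw; exact hgen g hg f x
      | zero => rw [mul_zero]; exact Submodule.zero_mem _
      | add v w _ _ hv hw => rw [mul_add]; exact Submodule.add_mem _ hv hw
      | smul c w _ hw => rw [mul_smul_comm]; exact Submodule.smul_mem _ _ hw
    | algebraMap c =>
      intro w hw
      rw [← Algebra.smul_def]
      exact Submodule.smul_mem _ _ hw
    | add a b _ _ ha hb =>
      intro w hw
      rw [add_mul]
      exact Submodule.add_mem _ (ha w hw) (hb w hw)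
    | mul a b _ _ ha hb =>
      intro w hw
      rw [mul_assoc]
      exact ha _ (hb w hw)
  have h1 : (1 : B) ∈ R.monoSpan := by
    have := R.π_mul_mono_mem 1 0
    rwa [show R.π 1 = 1 from R.π.map_one', mono_zero, one_mul] at this
  have := hmul a ha 1 h1
  rwa [mul_one] at this

end CovRep

/-! ## Homomorphisms out of the universal algebra -/

section Universal

variable {d N : ℕ} {X : Type u} [TopologicalSpace X] [CompactSpace X] {τ : Fin d → C(X, X)}
  {φ : Matrix (Fin d) (Fin d) ℝ} {P : Constraint.{u} d}

/-- Evaluation of the universal algebra in a representation. -/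
def evalRep (r : RepIndex N τ φ P) : UnivAlg N τ φ P →⋆ₐ[ℂ] r.B where
  toFun a := a.1 r
  map_one' := rfl
  map_mul' _ _ := rfl
  map_zero' := rfl
  map_add' _ _ := rfl
  commutes' _ := rfl
  map_star' _ := rfl

theorem continuous_starAlgHom {A B : Type*} [CStarAlgebra A] [CStarAlgebra B]
    (ψ : A →⋆ₐ[ℂ] B) : Continuous ψ :=
  AddMonoidHomClass.continuous_of_bound ψ 1
    (fun x => by simpa using NonUnitalStarAlgHom.norm_apply_le ψ x)

/-- The target lies one universe above the algebras indexing the product, so the universal property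
does not apply to it directly. The map is built coordinatewise: the coordinate `r` of the image of
`a` is the coordinate of `a` at `R` evaluated in `r`. -/
theorem exists_lift {N' : ℕ} {X' : Type u} [TopologicalSpace X'] [CompactSpace X']
    {τ' : Fin d → C(X', X')} {φ' : Matrix (Fin d) (Fin d) ℝ} {P' : Constraint.{u} d}
    (R : CovRep N τ φ (UnivAlg N' τ' φ' P'))
    (hR : ∀ r : RepIndex N' τ' φ' P', P r.B (R.map (evalRep r)).u) :
    ∃ ψ : UnivAlg N τ φ P →⋆ₐ[ℂ] UnivAlg N' τ' φ' P',
      (∀ f, ψ ((univRep N τ φ P).π f) = R.π f) ∧ ∀ j, ψ ((univRep N τ φ P).u j) = R.u j := by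
  let big : BigProd N τ φ P →⋆ₐ[ℂ] BigProd N' τ' φ' P' :=
    { toFun := fun a => ⟨fun r => a ⟨r.B, R.map (evalRep r), hR r⟩, memℓp_infty ⟨‖a‖, by
        rintro _ ⟨r, rfl⟩
        exact lp.norm_apply_le_norm ENNReal.top_ne_zero a _⟩⟩
      map_one' := rfl
      map_mul' := fun _ _ => rfl
      map_zero' := rfl
      map_add' := fun _ _ => rfl
      commutes' := fun _ => rfl
      map_star' := fun _ => rfl }
  have hle : univSubalgebra N τ φ P ≤ (univSubalgebra N' τ' φ' P').comap big := by
    refine StarSubalgebra.topologicalClosure_minimal ?_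
      ((StarSubalgebra.isClosed_topologicalClosure _).preimage (continuous_starAlgHom big))
    refine StarAlgebra.adjoin_le ?_
    rintro _ (⟨f, rfl⟩ | ⟨j, rfl⟩)
    · exact (R.π f).2
    · exact (R.u j : UnivAlg N' τ' φ' P').2
  exact ⟨{
    toFun := fun a => ⟨big a.1, hle a.2⟩
    map_one' := rfl
    map_mul' := fun _ _ => rfl
    map_zero' := rfl
    map_add' := fun _ _ => rfl
    commutes' := fun _ => rfl
    map_star' := fun _ => rfl }, fun _ => rfl, fun _ => rfl⟩

/-- The universal algebra is by definition a closure in the product of all representations. The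
algebraic statement holds there, and the subspace topology carries the closure back. -/
theorem dense_monoSpan (hτ : ∀ j, ∃ σ : C(X, X), σ.comp (τ j) = ContinuousMap.id X) :
    Dense ((univRep N τ φ P).monoSpan : Set (UnivAlg N τ φ P)) := by
  let incl : UnivAlg N τ φ P →⋆ₐ[ℂ] BigProd N τ φ P := (univSubalgebra N τ φ P).subtype
  have hmono : ∀ x, incl ((univRep N τ φ P).mono x) = (bigRep N τ φ P).mono x :=
    CovRep.map_mono _ _ incl fun j => rfl
  have hspan : (bigRep N τ φ P).monoSpan =
      (univRep N τ φ P).monoSpan.map (incl : UnivAlg N τ φ P →ₗ[ℂ] BigProd N τ φ P) := by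
    rw [CovRep.monoSpan, CovRep.monoSpan, Submodule.map_span, ← Set.range_comp]
    congr 2
    funext p
    have : incl ((univRep N τ φ P).π p.1 * (univRep N τ φ P).mono p.2) =
        (bigRep N τ φ P).π p.1 * (bigRep N τ φ P).mono p.2 := by rw [map_mul, hmono]; rfl
    exact this.symm
  intro a
  have hind : Topology.IsInducing (Subtype.val : univSubalgebra N τ φ P → BigProd N τ φ P) :=
    Topology.IsInducing.subtypeVal
  have : a ∈ (Subtype.val : univSubalgebra N τ φ P → BigProd N τ φ P) ⁻¹'
      closure (Subtype.val '' ((univRep N τ φ P).monoSpan : Set (UnivAlg N τ φ P))) := by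
    have h1 : a.1 ∈ closure ((StarAlgebra.adjoin ℂ (Set.range (bigRep N τ φ P).π ∪
      Set.range fun j => ((bigRep N τ φ P).u j : BigProd N τ φ P)) :
        StarSubalgebra ℂ (BigProd N τ φ P)) : Set (BigProd N τ φ P)) := a.2
    refine closure_mono (fun b hb => ?_) h1
    have h2 := (bigRep N τ φ P).adjoin_le_monoSpan hτ hb
    rw [hspan] at h2
    exact h2
  exact (hind.closure_eq_preimage_closure_image _).symm.subset this

/-- Continuous linear maps on the universal algebra are determined by their values on the elements
`f u_x`. -/
theorem clm_ext (hτ : ∀ j, ∃ σ : C(X, X), σ.comp (τ j) = ContinuousMap.id X)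
    {E : Type*} [NormedAddCommGroup E] [NormedSpace ℂ E] (S T : UnivAlg N τ φ P →L[ℂ] E)
    (h : ∀ f x, S ((univRep N τ φ P).π f * (univRep N τ φ P).mono x) =
      T ((univRep N τ φ P).π f * (univRep N τ φ P).mono x)) : S = T := by
  refine ContinuousLinearMap.ext_on (dense_monoSpan hτ) ?_
  rintro _ ⟨⟨f, x⟩, rfl⟩
  exact h f x

end Universal

end Bloch

namespace Bloch

/-! ## Folding of the monomials -/

section Folding

theorem exp_neg_pi_mul_int (T U : ℤ) (L : ℕ) :
    (Circle.exp (-((2 * Real.pi * (T + 2 * L * U)) / 2)) : ℂ) = (-1) ^ T := by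
  rw [Circle.coe_exp]
  have : ((-((2 * Real.pi * (T + 2 * L * U)) / 2) : ℝ) : ℂ) * Complex.I =
      ((-T : ℤ) : ℂ) * (Real.pi * Complex.I) + ((-(L * U) : ℤ) : ℂ) * (2 * Real.pi * Complex.I) := by
    push_cast; ring
  rw [this, Complex.exp_add, Complex.exp_int_mul_two_pi_mul_I, mul_one, Complex.exp_int_mul,
    Complex.exp_pi_mul_I, zpow_neg, ← inv_zpow]
  norm_num

variable {d L : ℕ} {φ : Matrix (Fin d) (Fin d) ℝ} {n : Matrix (Fin d) (Fin d) ℤ}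

/-- The flux quantization cancels one factor `M` from the cross terms, which become `2π n_ij (x_i
y_j + x_j y_i + M y_i y_j)`. Since `M = 1 + 2L` is odd, the part `2L y_i y_j` contributes a multiple
of `2π` even after halving; the remainder is the exponent `T` of the sign. -/
theorem exp_fluxForm_add (hn : ∀ i j, φ i j = 2 * (n i j : ℝ) * Real.pi / (2 * (L : ℝ) + 1))
    (x y : Fin d → ℤ) :
    (Circle.exp (-(fluxForm φ (x + (2 * L + 1 : ℤ) • y) / 2)) : ℂ) =
      foldSign n x y * Circle.exp (-(fluxForm φ x / 2)) := by
  set T : ℤ := ∑ i, ∑ j, if i < j then n i j * (x i * y j + x j * y i + y i * y j) else 0 with hT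
  set U : ℤ := ∑ i, ∑ j, if i < j then n i j * (y i * y j) else 0 with hU
  have h : fluxForm φ (x + (2 * L + 1 : ℤ) • y) =
      2 * Real.pi * (T + 2 * L * U) + fluxForm φ x := by
    rw [fluxForm, fluxForm, hT, hU]
    push_cast
    simp only [Finset.mul_sum, ← Finset.sum_add_distrib, mul_add]
    refine Finset.sum_congr rfl fun i _ => Finset.sum_congr rfl fun j _ => ?_
    split_ifs
    · rw [hn]
      simp only [Pi.add_apply, Pi.smul_apply, smul_eq_mul]
      push_cast
      have : (2 * (L : ℝ) + 1) ≠ 0 := by positivity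
      field_simp
      ring
    · simp
  rw [h, add_div, neg_add, Circle.exp_add, Circle.coe_mul, exp_neg_pi_mul_int, foldSign]

theorem foldSign_mul_self (n : Matrix (Fin d) (Fin d) ℤ) (x y : Fin d → ℤ) :
    foldSign n x y * foldSign n x y = 1 := by
  rw [foldSign, ← mul_zpow]; norm_num

variable {N : ℕ} {X : Type*} [TopologicalSpace X] [CompactSpace X] {τ : Fin d → C(X, X)}
  {B : Type*} [CStarAlgebra B]

/-- Each `u_j ^ M` is a central scalar, so the exponents `M y_j` leave the ordered word as `e^{i
k·y}`. The normalizing phase of the symmetric monomial supplies the sign. -/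
theorem CovRep.mono_add_smul
    (hn : ∀ i j, φ i j = 2 * (n i j : ℝ) * Real.pi / (2 * (L : ℝ) + 1))
    (R : CovRep N τ φ B) (k : Torus d)
    (hk : ∀ j, (R.u j : B) ^ (2 * L + 1) = ((k j).toCircle : ℂ) • (1 : B)) (x y : Fin d → ℤ) :
    R.mono (x + (2 * L + 1 : ℤ) • y) = (foldSign n x y * phase k y) • R.mono x := by
  have hu : ∀ j, R.u j ^ (2 * L + 1 : ℤ) = scal B (k j).toCircle := fun j => by
    refine Subtype.ext ?_
    rw [coe_scal, ← hk j]
    norm_cast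
  have hw : R.word (x + (2 * L + 1 : ℤ) • y) = scal B (∏ j, (k j).toCircle ^ y j) * R.word x := by
    rw [word, word, ← prod_ofFn_mul_central (scal B) commute_scal]
    congr 2
    funext j
    rw [Pi.add_apply, Pi.smul_apply, smul_eq_mul, zpow_add, zpow_mul, hu, map_zpow,
      ((commute_scal (k j).toCircle (R.u j)).zpow_zpow _ _).eq]
  rw [mono_eq, mono_eq, umono, umono, coe_scal_mul, coe_scal_mul, hw, coe_scal_mul,
    exp_fluxForm_add hn, smul_smul, smul_smul, phase]
  congr 1
  ring

end Folding

/-! ## The regular representation -/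

section Regular

variable {d N L : ℕ} {Ω₀ : Type u} [TopologicalSpace Ω₀] [CompactSpace Ω₀]
  {φ : Matrix (Fin d) (Fin d) ℝ} {n : Matrix (Fin d) (Fin d) ℤ}

/-- Translation of the finite-volume configurations. -/
def finTranslate (v : Fin d → ZMod (2 * L + 1)) : C(FinConf d L Ω₀, FinConf d L Ω₀) where
  toFun ω x := ω (x - v)
  continuous_toFun := continuous_pi fun _ => continuous_apply _

variable (d N L Ω₀) in
/-- The algebra of the regular representation. -/
def RegAlg : Type u :=
  C(FinConf d L Ω₀, CStarMatrix (Fin N × (Fin d → ZMod (2 * L + 1)))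
    (Fin N × (Fin d → ZMod (2 * L + 1))) ℂ)

instance : CStarAlgebra (RegAlg d N L Ω₀) :=
  inferInstanceAs (CStarAlgebra C(FinConf d L Ω₀, CStarMatrix (Fin N × (Fin d → ZMod (2 * L + 1)))
    (Fin N × (Fin d → ZMod (2 * L + 1))) ℂ))

/-- The matrix entries of an element of the regular algebra. -/
def RegAlg.entry (a : RegAlg d N L Ω₀) (ω : FinConf d L Ω₀)
    (i j : Fin N × (Fin d → ZMod (2 * L + 1))) : ℂ :=
  (show C(FinConf d L Ω₀, CStarMatrix (Fin N × (Fin d → ZMod (2 * L + 1)))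
    (Fin N × (Fin d → ZMod (2 * L + 1))) ℂ) from a) ω i j

omit [CompactSpace Ω₀] in
theorem RegAlg.ext {a b : RegAlg d N L Ω₀} (h : ∀ ω i j, a.entry ω i j = b.entry ω i j) : a = b :=
  ContinuousMap.ext fun ω => CStarMatrix.ext fun i j => h ω i j

theorem RegAlg.mul_entry (a b : RegAlg d N L Ω₀) (ω : FinConf d L Ω₀)
    (i j : Fin N × (Fin d → ZMod (2 * L + 1))) :
    (a * b).entry ω i j = ∑ k, a.entry ω i k * b.entry ω k j := rfl

theorem continuous_cstarMatrix {X m : Type*} [TopologicalSpace X] [Fintype m]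
    {F : X → CStarMatrix m m ℂ} (h : ∀ i j, Continuous fun x => F x i j) : Continuous F :=
  continuous_pi fun i => continuous_pi fun j => h i j

theorem continuous_cstarMatrix_apply {X m : Type*} [TopologicalSpace X] [Fintype m]
    {F : X → CStarMatrix m m ℂ} (h : Continuous F) (i j : m) : Continuous fun x => F x i j :=
  (continuous_apply j).comp ((continuous_apply i).comp h)

/-- The diagonal representation of `C_N(Ω̂)`. -/
def regDiag (f : MatFun N (FinConf d L Ω₀)) : RegAlg d N L Ω₀ :=
  (⟨fun ω => CStarMatrix.ofMatrix fun i j =>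
      if i.2 = j.2 then f (finTranslate i.2 ω) i.1 j.1 else 0, by
    refine continuous_cstarMatrix fun i j => ?_
    show Continuous fun ω => if i.2 = j.2 then f (finTranslate i.2 ω) i.1 j.1 else 0
    by_cases h : i.2 = j.2
    · simp only [if_pos h]
      exact continuous_cstarMatrix_apply (f.continuous.comp (finTranslate i.2).continuous) _ _
    · simp only [if_neg h]
      exact continuous_const⟩ :
    C(FinConf d L Ω₀, CStarMatrix (Fin N × (Fin d → ZMod (2 * L + 1)))
      (Fin N × (Fin d → ZMod (2 * L + 1))) ℂ))

theorem regDiag_entry (f : MatFun N (FinConf d L Ω₀)) (ω : FinConf d L Ω₀)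
    (i j : Fin N × (Fin d → ZMod (2 * L + 1))) :
    (regDiag f).entry ω i j = if i.2 = j.2 then f (finTranslate i.2 ω) i.1 j.1 else 0 := rfl

theorem RegAlg.one_entry (ω : FinConf d L Ω₀) (i j : Fin N × (Fin d → ZMod (2 * L + 1))) :
    (1 : RegAlg d N L Ω₀).entry ω i j = if i = j then 1 else 0 := by
  show (1 : Matrix _ _ ℂ) i j = _
  exact Matrix.one_apply

theorem regDiag_smul (c : ℂ) (f : MatFun N (FinConf d L Ω₀)) :
    regDiag (c • f) = c • regDiag f := by
  refine RegAlg.ext fun ω i j => ?_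
  show (if i.2 = j.2 then c • f (finTranslate i.2 ω) i.1 j.1 else 0) =
    c • (if i.2 = j.2 then f (finTranslate i.2 ω) i.1 j.1 else 0)
  split_ifs
  · rfl
  · rw [smul_zero]

theorem regDiag_one : regDiag (1 : MatFun N (FinConf d L Ω₀)) = 1 := by
  refine RegAlg.ext fun ω i j => ?_
  rw [RegAlg.one_entry, regDiag_entry]
  have : (1 : MatFun N (FinConf d L Ω₀)) (finTranslate i.2 ω) i.1 j.1 =
    if i.1 = j.1 then 1 else 0 := Matrix.one_apply
  rw [this]
  simp only [Prod.ext_iff]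
  split_ifs <;> tauto

/-- The diagonal representation of `C_N(Ω̂)` as a homomorphism. -/
def regπ : MatFun N (FinConf d L Ω₀) →⋆ₐ[ℂ] RegAlg d N L Ω₀ where
  toFun := regDiag
  map_one' := regDiag_one
  map_mul' f g := RegAlg.ext fun ω i j => by
    rw [RegAlg.mul_entry, Fintype.sum_prod_type]
    simp only [regDiag_entry]
    by_cases h : i.2 = j.2
    · rw [if_pos h]
      have : (f * g) (finTranslate i.2 ω) i.1 j.1 =
        ∑ a, f (finTranslate i.2 ω) i.1 a * g (finTranslate i.2 ω) a j.1 := rfl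
      rw [this]
      refine Finset.sum_congr rfl fun a _ => ?_
      rw [Finset.sum_eq_single i.2, if_pos rfl, if_pos h]
      · intro v _ hv
        rw [if_neg (Ne.symm hv), zero_mul]
      · simp
    · rw [if_neg h]
      refine (Finset.sum_eq_zero fun a _ => Finset.sum_eq_zero fun v _ => ?_).symm
      by_cases h1 : i.2 = v
      · rw [if_neg (fun h2 : v = j.2 => h (h1.trans h2)), mul_zero]
      · rw [if_neg h1, zero_mul]
  map_zero' := by
    have := regDiag_smul (0 : ℂ) (0 : MatFun N (FinConf d L Ω₀))
    rwa [zero_smul, zero_smul] at this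
  map_add' f g := RegAlg.ext fun ω i j => by
    show (if i.2 = j.2 then f (finTranslate i.2 ω) i.1 j.1 + g (finTranslate i.2 ω) i.1 j.1 else 0)
      = (if i.2 = j.2 then f (finTranslate i.2 ω) i.1 j.1 else 0) +
        (if i.2 = j.2 then g (finTranslate i.2 ω) i.1 j.1 else 0)
    split_ifs
    · rfl
    · rw [add_zero]
  commutes' c := by
    rw [Algebra.algebraMap_eq_smul_one, Algebra.algebraMap_eq_smul_one, ← regDiag_one]
    exact regDiag_smul c 1
  map_star' f := RegAlg.ext fun ω i j => by
    show (if i.2 = j.2 then star (f (finTranslate i.2 ω) j.1 i.1) else 0) =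
      star (if j.2 = i.2 then f (finTranslate j.2 ω) j.1 i.1 else 0)
    by_cases h : i.2 = j.2
    · rw [if_pos h, if_pos h.symm, h]
    · rw [if_neg h, if_neg (Ne.symm h), star_zero]

/-- The phases of the regular representation. -/
def regPhase (n : Matrix (Fin d) (Fin d) ℤ) (j : Fin d) (v : Fin d → ZMod (2 * L + 1)) : Circle :=
  ZMod.toCircle (∑ l, if j < l then (n j l : ZMod (2 * L + 1)) * v l else 0)

/-- The weighted shifts of the regular representation. -/
def regShift (p : (Fin d → ZMod (2 * L + 1)) → Circle) (e : Fin d → ZMod (2 * L + 1)) :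
    RegAlg d N L Ω₀ :=
  (ContinuousMap.const _ (CStarMatrix.ofMatrix fun i j =>
    if i.1 = j.1 ∧ i.2 = j.2 + e then (p j.2 : ℂ) else 0) :
    C(FinConf d L Ω₀, CStarMatrix (Fin N × (Fin d → ZMod (2 * L + 1)))
      (Fin N × (Fin d → ZMod (2 * L + 1))) ℂ))

omit [CompactSpace Ω₀] in
theorem regShift_entry (p : (Fin d → ZMod (2 * L + 1)) → Circle) (e : Fin d → ZMod (2 * L + 1))
    (ω : FinConf d L Ω₀) (i j : Fin N × (Fin d → ZMod (2 * L + 1))) :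
    (regShift p e : RegAlg d N L Ω₀).entry ω i j =
      if i.1 = j.1 ∧ i.2 = j.2 + e then (p j.2 : ℂ) else 0 := rfl

theorem regShift_mul (p q : (Fin d → ZMod (2 * L + 1)) → Circle) (e e' : Fin d → ZMod (2 * L + 1)) :
    (regShift p e * regShift q e' : RegAlg d N L Ω₀) =
      regShift (fun v => p (v + e') * q v) (e' + e) := by
  refine RegAlg.ext fun ω i j => ?_
  rw [RegAlg.mul_entry]
  simp only [regShift_entry]
  rw [Finset.sum_eq_single (j.1, j.2 + e')]
  · simp [add_assoc]
  · intro k _ hk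
    rw [if_neg (c := k.1 = j.1 ∧ k.2 = j.2 + e') (fun h => hk (Prod.ext h.1 h.2)), mul_zero]
  · simp

theorem star_regShift (p : (Fin d → ZMod (2 * L + 1)) → Circle) (e : Fin d → ZMod (2 * L + 1)) :
    star (regShift p e : RegAlg d N L Ω₀) = regShift (fun v => (p (v - e))⁻¹) (-e) := by
  refine RegAlg.ext fun ω i j => ?_
  show star (if j.1 = i.1 ∧ j.2 = i.2 + e then (p i.2 : ℂ) else 0) =
    if i.1 = j.1 ∧ i.2 = j.2 + -e then (((p (j.2 - e))⁻¹ : Circle) : ℂ) else 0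
  by_cases h : j.1 = i.1 ∧ j.2 = i.2 + e
  · rw [if_pos h, if_pos ⟨h.1.symm, by rw [h.2]; abel⟩, Circle.coe_inv_eq_conj, h.2,
      add_sub_cancel_right]
    rfl
  · rw [if_neg h, if_neg (fun h' => h ⟨h'.1.symm, by rw [h'.2]; abel⟩), star_zero]

theorem regShift_one : (regShift (fun _ => 1) 0 : RegAlg d N L Ω₀) = 1 := by
  refine RegAlg.ext fun ω i j => ?_
  rw [RegAlg.one_entry, regShift_entry, add_zero]
  simp only [Prod.ext_iff, Circle.coe_one]

theorem smul_regShift (c : Circle) (p : (Fin d → ZMod (2 * L + 1)) → Circle)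
    (e : Fin d → ZMod (2 * L + 1)) :
    ((c : ℂ) • regShift p e : RegAlg d N L Ω₀) = regShift (fun v => c * p v) e := by
  refine RegAlg.ext fun ω i j => ?_
  show (c : ℂ) • (if i.1 = j.1 ∧ i.2 = j.2 + e then (p j.2 : ℂ) else 0) =
    if i.1 = j.1 ∧ i.2 = j.2 + e then ((c * p j.2 : Circle) : ℂ) else 0
  rw [smul_ite, smul_zero]
  rfl

theorem regShift_pow (p : (Fin d → ZMod (2 * L + 1)) → Circle) (e : Fin d → ZMod (2 * L + 1))
    (hp : ∀ v, p (v + e) = p v) (m : ℕ) :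
    (regShift p e : RegAlg d N L Ω₀) ^ m = regShift (fun v => p v ^ m) (m • e) := by
  induction m with
  | zero => simp [regShift_one]
  | succ m ih =>
    rw [pow_succ, ih, regShift_mul, succ_nsmul, add_comm e (m • e)]
    congr 1
    funext v
    rw [hp, pow_succ]

/-- The shift carries block `v` to block `v + e_j`, and block `v` reads `f` at the configuration
translated by `v`. Both sides thus evaluate `f` at the translate by `v + e_j`. -/
theorem regπ_mul_regShift (f : MatFun N (FinConf d L Ω₀)) (j : Fin d)
    (p : (Fin d → ZMod (2 * L + 1)) → Circle) :
    (regπ f * regShift p (cls L (Pi.single j 1)) : RegAlg d N L Ω₀) =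
      regShift p (cls L (Pi.single j 1)) * regπ (f.comp (finShift j)) := by
  refine RegAlg.ext fun ω i k => ?_
  set e : Fin d → ZMod (2 * L + 1) := cls L (Pi.single j 1) with he
  have hπ : ∀ g : MatFun N (FinConf d L Ω₀), regπ g = regDiag g := fun _ => rfl
  rw [RegAlg.mul_entry, RegAlg.mul_entry, hπ, hπ]
  simp only [regShift_entry, regDiag_entry]
  have hT : finShift j (finTranslate k.2 ω) = finTranslate (k.2 + e) ω := by
    funext x
    show ω (x - e - k.2) = ω (x - (k.2 + e))
    congr 1
    abel
  rw [Finset.sum_eq_single (k.1, k.2 + e), Finset.sum_eq_single (i.1, k.2)]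
  · simp only [ContinuousMap.comp_apply, hT, true_and, and_self, if_true]
    by_cases h : i.2 = k.2 + e
    · rw [if_pos h, if_pos h, h, mul_comm]
    · rw [if_neg h, if_neg h, zero_mul, zero_mul]
  · intro l _ hl
    by_cases h : l.2 = k.2
    · rw [if_neg, zero_mul]
      exact fun h' => hl (Prod.ext h'.1.symm h)
    · rw [if_neg h, mul_zero]
  · simp
  · intro l _ hl
    rw [if_neg (c := l.1 = k.1 ∧ l.2 = k.2 + e) (fun h => hl (Prod.ext h.1 h.2)), mul_zero]
  · simp

theorem exp_flux (hn : ∀ i j, φ i j = 2 * (n i j : ℝ) * Real.pi / (2 * (L : ℝ) + 1)) (i j : Fin d) :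
    Complex.exp (Complex.I * φ i j) = (ZMod.toCircle (n i j : ZMod (2 * L + 1)) : ℂ) := by
  rw [ZMod.toCircle_intCast, hn]
  congr 1
  push_cast
  ring

theorem flux_int_antisymm (hφ : φ.transpose = -φ)
    (hn : ∀ i j, φ i j = 2 * (n i j : ℝ) * Real.pi / (2 * (L : ℝ) + 1)) (i j : Fin d) :
    n j i = - n i j := by
  have h : φ j i = - φ i j := congrFun (congrFun hφ i) j
  rw [hn, hn] at h
  have h1 : (2 * (L : ℝ) + 1) ≠ 0 := by positivity
  field_simp at h
  exact_mod_cast h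

/-- The phase of the `j`-th shift sees only the coordinates `v_l` with `l > j`. For `i ≠ j` exactly
one of the two orders of the shifts picks up the flux. For `i = j` nothing is picked up, which makes
the `M`-th power equal to `1`. -/
theorem regPhase_add_single (j i : Fin d) (v : Fin d → ZMod (2 * L + 1)) :
    regPhase n j (v + cls L (Pi.single i 1)) =
      regPhase n j v * ZMod.toCircle (if j < i then (n j i : ZMod (2 * L + 1)) else 0) := by
  rw [regPhase, regPhase, ← AddChar.map_add_eq_mul]
  congr 1
  have : (if j < i then (n j i : ZMod (2 * L + 1)) else 0) =
      ∑ l, if j < l then (n j l : ZMod (2 * L + 1)) * cls L (Pi.single i 1) l else 0 := by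
    rw [Finset.sum_eq_single i]
    · simp [cls]
    · intro l _ hl
      simp [cls, Pi.single_eq_of_ne hl]
    · simp
  rw [this, ← Finset.sum_add_distrib]
  refine Finset.sum_congr rfl fun l _ => ?_
  split_ifs
  · rw [Pi.add_apply, mul_add]
  · rw [add_zero]

/-- The regular representation of the Bloch relations at `k = 0`. -/
def regRep (hφ : φ.transpose = -φ)
    (hn : ∀ i j, φ i j = 2 * (n i j : ℝ) * Real.pi / (2 * (L : ℝ) + 1)) :
    CovRep N (finShift (d := d) (L := L) (Ω₀ := Ω₀)) φ (RegAlg d N L Ω₀) where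
  π := regπ
  u j := ⟨regShift (regPhase n j) (cls L (Pi.single j 1)), by
    constructor
    · rw [star_regShift, regShift_mul, ← regShift_one, add_neg_cancel]
      congr 1
      funext v
      rw [add_sub_cancel_right, inv_mul_cancel]
    · rw [star_regShift, regShift_mul, ← regShift_one, neg_add_cancel]
      congr 1
      funext v
      rw [sub_eq_add_neg, mul_inv_cancel]⟩
  comm i j := by
    rw [exp_flux hn]
    simp only [regShift_mul, smul_regShift]
    rw [add_comm (cls L (Pi.single j 1))]
    congr 1
    funext v
    rw [regPhase_add_single, regPhase_add_single]
    -- If `j < i`, the flux appears on the other side as `n_ji = -n_ij`, so both orders give the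
    -- same commutation phase.
    have key : ZMod.toCircle (if i < j then (n i j : ZMod (2 * L + 1)) else 0) =
        ZMod.toCircle (n i j : ZMod (2 * L + 1)) *
          ZMod.toCircle (if j < i then (n j i : ZMod (2 * L + 1)) else 0) := by
      rw [← AddChar.map_add_eq_mul]
      congr 1
      have ha := flux_int_antisymm hφ hn i j
      rcases lt_trichotomy i j with h | h | h
      · rw [if_pos h, if_neg h.not_gt, add_zero]
      · subst h
        have : n i i = 0 := by omega
        simp [this]
      · rw [if_neg h.not_gt, if_pos h, ha]
        simp
    rw [key]
    simp only [mul_comm, mul_left_comm]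
  cov f j := regπ_mul_regShift f j _

theorem regRep_pow (hφ : φ.transpose = -φ)
    (hn : ∀ i j, φ i j = 2 * (n i j : ℝ) * Real.pi / (2 * (L : ℝ) + 1)) (j : Fin d) :
    ((regRep (N := N) (Ω₀ := Ω₀) hφ hn).u j : RegAlg d N L Ω₀) ^ (2 * L + 1) = 1 := by
  have h0 : ((2 * L + 1 : ℕ) : ZMod (2 * L + 1)) = 0 := ZMod.natCast_self _
  show regShift _ _ ^ (2 * L + 1) = _
  rw [regShift_pow, ← regShift_one]
  · congr 1
    · funext v
      rw [regPhase, ← AddChar.map_nsmul_eq_pow, nsmul_eq_mul, h0, zero_mul, AddChar.map_zero_eq_one]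
    · funext i
      rw [Pi.smul_apply, nsmul_eq_mul, h0, zero_mul, Pi.zero_apply]
  · intro v
    rw [regPhase_add_single, if_neg (lt_irrefl j), AddChar.map_zero_eq_one, mul_one]

/-- The diagonal block at `v = 0` is `f` itself. -/
theorem regπ_injective : Function.Injective (regπ (d := d) (N := N) (L := L) (Ω₀ := Ω₀)) := by
  intro f g h
  ext ω : 1
  refine CStarMatrix.ext fun a b => ?_
  have h2 : finTranslate (0 : Fin d → ZMod (2 * L + 1)) ω = ω := by
    funext x; show ω (x - 0) = ω x; rw [sub_zero]
  have h1 : (regDiag f).entry ω (a, 0) (b, 0) = (regDiag g).entry ω (a, 0) (b, 0) :=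
    congrArg (fun c : RegAlg d N L Ω₀ => c.entry ω (a, 0) (b, 0)) h
  rw [regDiag_entry, regDiag_entry, if_pos rfl, if_pos rfl, h2] at h1
  exact h1

/-- Multiplication by `2L+1` on the torus. -/
theorem torus_nsmul_surjective (L : ℕ) :
    Function.Surjective fun t : Torus d => (2 * L + 1) • t := by
  intro k
  have : ∀ j, ∃ θ : AddCircle (2 * Real.pi), (2 * L + 1) • θ = k j := by
    intro j
    obtain ⟨r, hr⟩ := QuotientAddGroup.mk_surjective (k j)
    refine ⟨((r / (2 * L + 1 : ℕ) : ℝ) : AddCircle (2 * Real.pi)), ?_⟩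
    rw [← AddCircle.coe_nsmul, nsmul_eq_mul, mul_div_cancel₀ _ (by positivity)]
    exact hr
  choose θ hθ using this
  exact ⟨θ, funext hθ⟩

theorem blochGen_π_injective (hφ : φ.transpose = -φ)
    (hn : ∀ i j, φ i j = 2 * (n i j : ℝ) * Real.pi / (2 * (L : ℝ) + 1)) (k : Torus d) :
    Function.Injective (blochGen N L Ω₀ φ k).π := by
  -- Only nonzero algebras index the universal product. If the regular algebra is zero, so is
  -- `C_N(Ω̂)`, which embeds in it.
  rcases subsingleton_or_nontrivial (RegAlg d N L Ω₀) with h | h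
  · have := (regπ_injective (d := d) (N := N) (L := L) (Ω₀ := Ω₀)).subsingleton
    exact Function.injective_of_subsingleton _
  -- The regular representation satisfies the constraint at `k = 0`. Multiplying its generators by
  -- `e^{i t_j}` with `Mt = k` moves it to `k`.
  · obtain ⟨t, rfl⟩ := torus_nsmul_surjective L k
    let R := (regRep (N := N) (Ω₀ := Ω₀) hφ hn).twist fun j => (t j).toCircle
    have hR : powConstraint L ((2 * L + 1) • t) (RegAlg d N L Ω₀) R.u := by
      intro j
      show (((t j).toCircle : ℂ) • ((regRep (N := N) (Ω₀ := Ω₀) hφ hn).u j : RegAlg d N L Ω₀)) ^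
        (2 * L + 1) = _
      rw [smul_pow, regRep_pow, Pi.smul_apply, AddCircle.toCircle_nsmul]
      rfl
    let r : RepIndex N (finShift (d := d) (L := L) (Ω₀ := Ω₀)) φ
      (powConstraint L ((2 * L + 1) • t)) := ⟨RegAlg d N L Ω₀, R, hR⟩
    intro f g hfg
    exact regπ_injective (congrArg (evalRep r) hfg)

theorem norm_blochGen_π (hφ : φ.transpose = -φ)
    (hn : ∀ i j, φ i j = 2 * (n i j : ℝ) * Real.pi / (2 * (L : ℝ) + 1)) (k : Torus d)
    (f : MatFun N (FinConf d L Ω₀)) : ‖(blochGen N L Ω₀ φ k).π f‖ = ‖f‖ :=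
  NonUnitalStarAlgHom.norm_map _ (blochGen_π_injective hφ hn k) f

end Regular

end Bloch

namespace Bloch

/-! ## The cube and the residue classes -/

section Cube

variable {d L : ℕ}

theorem rep_mem_VL (v : Fin d → ZMod (2 * L + 1)) : rep v ∈ VL d L := by
  simp only [VL, Fintype.mem_piFinset, Finset.mem_Icc, rep]
  intro i
  -- The modulus is odd, so this half-open range of minimal representatives is the symmetric
  -- interval from `-L` to `L`.
  have := ZMod.valMinAbs_mem_Ioc (v i)
  simp only [Set.mem_Ioc] at this
  push_cast at this
  omega

theorem cls_eq_iff {x y : Fin d → ℤ} :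
    cls L x = cls L y ↔ ∃ z : Fin d → ℤ, x = y + (2 * L + 1 : ℤ) • z := by
  constructor
  · intro h
    have h1 : ∀ i, ∃ c : ℤ, x i = y i + (2 * L + 1 : ℤ) * c := by
      intro i
      have h2 : ((y i : ℤ) : ZMod (2 * L + 1)) = (x i : ℤ) := (congrFun h i).symm
      rw [ZMod.intCast_eq_intCast_iff_dvd_sub] at h2
      obtain ⟨c, hc⟩ := h2
      push_cast at hc
      exact ⟨c, by linarith⟩
    choose z hz using h1
    exact ⟨z, funext hz⟩
  · rintro ⟨z, rfl⟩
    funext i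
    have h : ((2 * L + 1 : ℕ) : ZMod (2 * L + 1)) = 0 := ZMod.natCast_self _
    simp only [cls, Pi.add_apply, Pi.smul_apply, smul_eq_mul]
    push_cast at h ⊢
    rw [h, zero_mul, add_zero]

theorem cls_injOn {x y : Fin d → ℤ} (hx : x ∈ VL d L) (hy : y ∈ VL d L) (h : cls L x = cls L y) :
    x = y := by
  obtain ⟨z, hz⟩ := cls_eq_iff.1 h
  simp only [VL, Fintype.mem_piFinset, Finset.mem_Icc] at hx hy
  funext i
  have h1 := congrFun hz i
  simp only [Pi.add_apply, Pi.smul_apply, smul_eq_mul] at h1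
  have h2 := hx i
  have h3 := hy i
  have h4 : z i = 0 := by
    by_contra h0
    rcases lt_or_gt_of_ne h0 with h5 | h5
    · have : (2 * (L : ℤ) + 1) * z i ≤ (2 * (L : ℤ) + 1) * (-1) :=
        mul_le_mul_of_nonneg_left (by omega) (by positivity)
      linarith
    · have : (2 * (L : ℤ) + 1) * 1 ≤ (2 * (L : ℤ) + 1) * z i :=
        mul_le_mul_of_nonneg_left (by omega) (by positivity)
      linarith
  rw [h1, h4, mul_zero, add_zero]

theorem exists_VL_add (x : Fin d → ℤ) :
    ∃ (x₀ : VL d L) (y : Fin d → ℤ), x = x₀ + (2 * L + 1 : ℤ) • y := by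
  obtain ⟨y, hy⟩ := cls_eq_iff.1 (cls_rep (cls L x)).symm
  exact ⟨⟨rep (cls L x), rep_mem_VL _⟩, y, hy⟩

/-- The character of `(ℤ/(2L+1)ℤ)^d` attached to `w`, evaluated at a lattice point. -/
def zchar (w : Fin d → ZMod (2 * L + 1)) (x : Fin d → ℤ) : Circle :=
  ∏ j, ZMod.toCircle (w j) ^ x j

theorem zchar_add (w : Fin d → ZMod (2 * L + 1)) (x y : Fin d → ℤ) :
    zchar w (x + y) = zchar w x * zchar w y := by
  simp [zchar, zpow_add, Finset.prod_mul_distrib]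

/-- Orthogonality of characters, one coordinate of `(ℤ/Mℤ)^d` at a time. -/
theorem sum_zchar (x : Fin d → ℤ) :
    ∑ w : Fin d → ZMod (2 * L + 1), (zchar w x : ℂ) =
      if cls L x = 0 then ((2 * L + 1 : ℕ) : ℂ) ^ d else 0 := by
  have h1 : ∀ w : Fin d → ZMod (2 * L + 1),
      (zchar w x : ℂ) = ∏ j, ZMod.stdAddChar (w j * (x j : ZMod (2 * L + 1))) := by
    intro w
    refine (map_prod Circle.coeHom _ _).trans (Finset.prod_congr rfl fun j _ => ?_)
    have : w j * (x j : ZMod (2 * L + 1)) = x j • w j := by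
      rw [zsmul_eq_mul, mul_comm (w j)]
    rw [this, ZMod.stdAddChar_apply, AddChar.map_zsmul_eq_zpow]
    rfl
  have h2 : ∑ w : Fin d → ZMod (2 * L + 1),
      ∏ j, ZMod.stdAddChar (w j * (x j : ZMod (2 * L + 1))) =
      ∏ j, ∑ a : ZMod (2 * L + 1), ZMod.stdAddChar (a * (x j : ZMod (2 * L + 1))) := by
    rw [Finset.prod_univ_sum, Fintype.piFinset_univ]
  simp only [h1, h2, AddChar.sum_mulShift _ (ZMod.isPrimitive_stdAddChar (2 * L + 1)), ZMod.card]
  split_ifs with h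
  · have : ∀ j, (x j : ZMod (2 * L + 1)) = 0 := fun j => congrFun h j
    simp [this]
  · obtain ⟨j, hj⟩ : ∃ j, (x j : ZMod (2 * L + 1)) ≠ 0 := by
      by_contra! h'; exact h (funext h')
    exact Finset.prod_eq_zero (Finset.mem_univ j) (by rw [if_neg hj]; simp)

end Cube

/-! ## The Bloch algebras -/

section Synthesis

theorem injective_of_expanding {E F : Type*} [NormedAddCommGroup E] [NormedSpace ℂ E]
    [NormedAddCommGroup F] [NormedSpace ℂ F] (S : E →L[ℂ] F) (hS : ∀ c, ‖c‖ ≤ ‖S c‖) :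
    Function.Injective S := by
  refine (injective_iff_map_eq_zero S).2 fun c hc => ?_
  have := hS c
  rw [hc, norm_zero] at this
  exact norm_le_zero_iff.1 this

/-- A map that does not decrease norms on a complete space has closed range. -/
theorem surjective_of_expanding {E F : Type*} [NormedAddCommGroup E] [NormedSpace ℂ E]
    [CompleteSpace E] [NormedAddCommGroup F] [NormedSpace ℂ F] (S : E →L[ℂ] F)
    (hS : ∀ c, ‖c‖ ≤ ‖S c‖) (hd : Dense (Set.range S)) : Function.Surjective S := by
  have hanti : AntilipschitzWith 1 S :=
    AddMonoidHomClass.antilipschitz_of_bound S fun c => by simpa using hS c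
  intro b
  have := hd b
  rwa [(hanti.isClosed_range S.uniformContinuous).closure_eq] at this

/-- The inverse of an expanding continuous linear bijection. -/
def expandingInverse {E F : Type*} [NormedAddCommGroup E] [NormedSpace ℂ E] [NormedAddCommGroup F]
    [NormedSpace ℂ F] (S : E →L[ℂ] F) (hb : Function.Bijective S) (hS : ∀ c, ‖c‖ ≤ ‖S c‖) :
    F →L[ℂ] E :=
  LinearMap.mkContinuous (LinearEquiv.ofBijective (S : E →ₗ[ℂ] F) hb).symm.toLinearMap 1 fun b => by
    rw [one_mul]
    refine (hS _).trans_eq (congrArg norm ?_)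
    exact (LinearEquiv.ofBijective (S : E →ₗ[ℂ] F) hb).apply_symm_apply b

theorem apply_expandingInverse {E F : Type*} [NormedAddCommGroup E] [NormedSpace ℂ E]
    [NormedAddCommGroup F] [NormedSpace ℂ F] (S : E →L[ℂ] F) (hb : Function.Bijective S)
    (hS : ∀ c, ‖c‖ ≤ ‖S c‖) (b : F) : S (expandingInverse S hb hS b) = b :=
  (LinearEquiv.ofBijective (S : E →ₗ[ℂ] F) hb).apply_symm_apply b

theorem CovRep.continuous_π {d N : ℕ} {X : Type*} [TopologicalSpace X] [CompactSpace X]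
    {τ : Fin d → C(X, X)} {φ : Matrix (Fin d) (Fin d) ℝ} {B : Type*} [CStarAlgebra B]
    (R : CovRep N τ φ B) : Continuous R.π :=
  AddMonoidHomClass.continuous_of_bound R.π 1
    (fun f => by simpa using NonUnitalStarAlgHom.norm_apply_le R.π f)

/-- The map `(c_x)_x ↦ ∑_x c_x u_x`. -/
def CovRep.synth {d N : ℕ} {X : Type*} [TopologicalSpace X] [CompactSpace X] {τ : Fin d → C(X, X)}
    {φ : Matrix (Fin d) (Fin d) ℝ} {B : Type*} [CStarAlgebra B] (R : CovRep N τ φ B)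
    (S : Finset (Fin d → ℤ)) : (S → MatFun N X) →L[ℂ] B where
  toFun c := ∑ x : S, R.π (c x) * R.mono x
  map_add' c c' := by simp only [Pi.add_apply, map_add, add_mul, Finset.sum_add_distrib]
  map_smul' a c := by
    simp only [Pi.smul_apply, map_smul, smul_mul_assoc, ← Finset.smul_sum, RingHom.id_apply]
  cont := continuous_finsetSum _ fun x _ =>
    (R.continuous_π.comp (continuous_apply x)).mul continuous_const

/-- A *-homomorphism of C*-algebras as a continuous linear map. -/
def starCLM {A B : Type*} [CStarAlgebra A] [CStarAlgebra B] (ψ : A →⋆ₐ[ℂ] B) : A →L[ℂ] B :=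
  ⟨ψ.toAlgHom.toLinearMap, continuous_starAlgHom ψ⟩

@[simp] theorem starCLM_apply {A B : Type*} [CStarAlgebra A] [CStarAlgebra B] (ψ : A →⋆ₐ[ℂ] B)
    (a : A) : starCLM ψ a = ψ a := rfl

end Synthesis

/-! ### Phase twists of the Bloch algebras and projections onto residue classes -/

section BlochAlgebra

variable {d N L : ℕ} {Ω₀ : Type u} [TopologicalSpace Ω₀] [CompactSpace Ω₀]
  {φ : Matrix (Fin d) (Fin d) ℝ} {n : Matrix (Fin d) (Fin d) ℤ}

omit [CompactSpace Ω₀] in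
theorem finShift_leftInverse (j : Fin d) : ∃ σ : C(FinConf d L Ω₀, FinConf d L Ω₀),
    σ.comp (finShift j) = ContinuousMap.id _ := by
  refine ⟨finTranslate (-cls L (Pi.single j 1)), ?_⟩
  ext ω x
  show ω (x - -cls L (Pi.single j 1) - cls L (Pi.single j 1)) = ω x
  congr 1
  abel

/-- The hypothesis on `z` says that the unitaries `z_j û_j(k')` satisfy the power constraint at `k`.
One construction serves both the root-of-unity symmetries (`k = k'`) and the trivialization of the
field. -/
theorem exists_blochTwist (z : Fin d → Circle) (k k' : Torus d)
    (h : ∀ j, z j ^ (2 * L + 1) * (k' j).toCircle = (k j).toCircle) :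
    ∃ ψ : BlochAlg N L Ω₀ φ k →⋆ₐ[ℂ] BlochAlg N L Ω₀ φ k',
      (∀ f, ψ ((blochGen N L Ω₀ φ k).π f) = (blochGen N L Ω₀ φ k').π f) ∧
      ∀ j, ψ ((blochGen N L Ω₀ φ k).u j) = (((blochGen N L Ω₀ φ k').twist z).u j : _) := by
  refine exists_lift ((blochGen N L Ω₀ φ k').twist z) fun r j => ?_
  have h1 : ((((blochGen N L Ω₀ φ k').twist z).map (evalRep r)).u j : r.B) =
      (z j : ℂ) • (r.rep.u j : r.B) := rfl
  rw [h1, smul_pow, r.constr j, smul_smul, ← h j]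
  rfl

attribute [local irreducible] instCStarAlgebraUnivAlg

/-- The *-homomorphism `Â(k) → Â(k')` with `f ↦ f` and `û_j(k) ↦ z_j û_j(k')`. -/
def blochTwist (z : Fin d → Circle) (k k' : Torus d)
    (h : ∀ j, z j ^ (2 * L + 1) * (k' j).toCircle = (k j).toCircle) :
    BlochAlg N L Ω₀ φ k →⋆ₐ[ℂ] BlochAlg N L Ω₀ φ k' :=
  (exists_blochTwist z k k' h).choose

variable {z : Fin d → Circle} {k k' : Torus d}

theorem blochTwist_π (h : ∀ j, z j ^ (2 * L + 1) * (k' j).toCircle = (k j).toCircle)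
    (f : MatFun N (FinConf d L Ω₀)) :
    blochTwist z k k' h ((blochGen N L Ω₀ φ k).π f) = (blochGen N L Ω₀ φ k').π f :=
  (exists_blochTwist z k k' h).choose_spec.1 f

theorem blochTwist_mono (h : ∀ j, z j ^ (2 * L + 1) * (k' j).toCircle = (k j).toCircle)
    (x : Fin d → ℤ) :
    blochTwist z k k' h ((blochGen N L Ω₀ φ k).mono x) =
      ((∏ j, z j ^ x j : Circle) : ℂ) • (blochGen N L Ω₀ φ k').mono x := by
  rw [← CovRep.mono_twist]
  exact CovRep.map_mono _ _ _ (exists_blochTwist z k k' h).choose_spec.2 x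

theorem blochTwist_π_mul_mono (h : ∀ j, z j ^ (2 * L + 1) * (k' j).toCircle = (k j).toCircle)
    (f : MatFun N (FinConf d L Ω₀)) (x : Fin d → ℤ) :
    blochTwist z k k' h ((blochGen N L Ω₀ φ k).π f * (blochGen N L Ω₀ φ k).mono x) =
      ((∏ j, z j ^ x j : Circle) : ℂ) •
        ((blochGen N L Ω₀ φ k').π f * (blochGen N L Ω₀ φ k').mono x) := by
  rw [map_mul, blochTwist_π, blochTwist_mono, mul_smul_comm]

theorem blochTwist_inv (h : ∀ j, z j ^ (2 * L + 1) * (k' j).toCircle = (k j).toCircle)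
    (h' : ∀ j, (z j)⁻¹ ^ (2 * L + 1) * (k j).toCircle = (k' j).toCircle)
    (a : BlochAlg N L Ω₀ φ k) :
    blochTwist (fun j => (z j)⁻¹) k' k h' (blochTwist z k k' h a) = a := by
  have := clm_ext finShift_leftInverse
    ((starCLM (blochTwist (fun j => (z j)⁻¹) k' k h')).comp (starCLM (blochTwist z k k' h)))
    (ContinuousLinearMap.id ℂ (BlochAlg N L Ω₀ φ k)) fun f x => by
      simp only [ContinuousLinearMap.comp_apply, starCLM_apply, ContinuousLinearMap.id_apply]
      rw [blochTwist_π_mul_mono, map_smul, blochTwist_π_mul_mono, smul_smul, ← Circle.coe_mul,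
        ← Finset.prod_mul_distrib]
      simp
  exact DFunLike.congr_fun this a

theorem norm_blochTwist (h : ∀ j, z j ^ (2 * L + 1) * (k' j).toCircle = (k j).toCircle)
    (a : BlochAlg N L Ω₀ φ k) : ‖blochTwist z k k' h a‖ = ‖a‖ := by
  have h' : ∀ j, (z j)⁻¹ ^ (2 * L + 1) * (k j).toCircle = (k' j).toCircle := fun j => by
    rw [← h j, ← mul_assoc, ← mul_pow, inv_mul_cancel, one_pow, one_mul]
  refine le_antisymm (NonUnitalStarAlgHom.norm_apply_le _ a) ?_
  conv_lhs => rw [← blochTwist_inv h h' a]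
  exact NonUnitalStarAlgHom.norm_apply_le _ _

/-- Multiplication of the generators by roots of unity. -/
def rootTwist (k : Torus d) (w : Fin d → ZMod (2 * L + 1)) :
    BlochAlg N L Ω₀ φ k →⋆ₐ[ℂ] BlochAlg N L Ω₀ φ k :=
  blochTwist (fun j => ZMod.toCircle (w j)) k k fun j => by
    have h : ((2 * L + 1 : ℕ) : ZMod (2 * L + 1)) = 0 := ZMod.natCast_self _
    rw [← AddChar.map_nsmul_eq_pow, nsmul_eq_mul, h, zero_mul, AddChar.map_zero_eq_one, one_mul]

variable (N L Ω₀ φ) in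
/-- The projection of the Bloch algebra onto the class of `x` of the Fourier components. -/
def component (k : Torus d) (x : Fin d → ℤ) : BlochAlg N L Ω₀ φ k →L[ℂ] BlochAlg N L Ω₀ φ k :=
  (((2 * L + 1 : ℕ) : ℂ) ^ d)⁻¹ • ∑ w : Fin d → ZMod (2 * L + 1),
    (zchar w (-x) : ℂ) • starCLM (rootTwist k w)

theorem component_apply (k : Torus d) (x : Fin d → ℤ) (a : BlochAlg N L Ω₀ φ k) :
    component N L Ω₀ φ k x a = (((2 * L + 1 : ℕ) : ℂ) ^ d)⁻¹ •
      ∑ w : Fin d → ZMod (2 * L + 1), (zchar w (-x) : ℂ) • rootTwist k w a := by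
  simp [component]

theorem norm_component_le (k : Torus d) (x : Fin d → ℤ) (a : BlochAlg N L Ω₀ φ k) :
    ‖component N L Ω₀ φ k x a‖ ≤ ‖a‖ := by
  have h1 : ‖∑ w : Fin d → ZMod (2 * L + 1), (zchar w (-x) : ℂ) • rootTwist k w a‖ ≤
      ((2 * L + 1 : ℕ) : ℝ) ^ d * ‖a‖ := by
    refine (norm_sum_le _ _).trans ((Finset.sum_le_card_nsmul _ _ ‖a‖ fun w _ => ?_).trans_eq ?_)
    · rw [norm_smul, Circle.norm_coe, one_mul]
      exact NonUnitalStarAlgHom.norm_apply_le _ a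
    · rw [Finset.card_univ, nsmul_eq_mul, Fintype.card_fun, ZMod.card, Fintype.card_fin]
      push_cast
      rfl
  rw [component_apply, norm_smul, norm_inv, norm_pow, Complex.norm_natCast,
    inv_mul_le_iff₀ (by positivity)]
  exact h1

theorem component_π_mul_mono (k : Torus d) (x y : Fin d → ℤ) (f : MatFun N (FinConf d L Ω₀)) :
    component N L Ω₀ φ k x ((blochGen N L Ω₀ φ k).π f * (blochGen N L Ω₀ φ k).mono y) =
      if cls L y = cls L x then (blochGen N L Ω₀ φ k).π f * (blochGen N L Ω₀ φ k).mono y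
      else 0 := by
  rw [component_apply]
  simp only [rootTwist, blochTwist_π_mul_mono, smul_smul]
  rw [← Finset.sum_smul]
  have h1 : ∀ w : Fin d → ZMod (2 * L + 1),
      (zchar w (-x) : ℂ) * ((∏ j, ZMod.toCircle (w j) ^ y j : Circle) : ℂ) = zchar w (-x + y) := by
    intro w
    rw [zchar_add, Circle.coe_mul]
    rfl
  have h2 : cls L (-x + y) = 0 ↔ cls L y = cls L x := by
    have : cls L (-x + y) = cls L y - cls L x := by
      funext i; simp [cls]; ring
    rw [this, sub_eq_zero]
  have h3 : (((2 * L + 1 : ℕ) : ℂ) ^ d) ≠ 0 := pow_ne_zero _ (Nat.cast_ne_zero.2 (by omega))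
  simp only [h1, sum_zchar, h2]
  split_ifs
  · rw [smul_smul, inv_mul_cancel₀ h3, one_smul]
  · rw [zero_smul, smul_zero]

/-! ### Fourier coefficients in the Bloch algebra -/

variable (N L Ω₀ φ) in
/-- The map `(c_x)_x ↦ ∑_x c_x û_x(k)`. -/
def blochSynth (k : Torus d) :
    (VL d L → MatFun N (FinConf d L Ω₀)) →L[ℂ] BlochAlg N L Ω₀ φ k :=
  (blochGen N L Ω₀ φ k).synth (VL d L)

theorem blochSynth_apply (k : Torus d) (c : VL d L → MatFun N (FinConf d L Ω₀)) :
    blochSynth N L Ω₀ φ k c =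
      ∑ x : VL d L, (blochGen N L Ω₀ φ k).π (c x) * (blochGen N L Ω₀ φ k).mono x := rfl

theorem component_blochSynth (k : Torus d) (c : VL d L → MatFun N (FinConf d L Ω₀)) (x : VL d L) :
    component N L Ω₀ φ k x (blochSynth N L Ω₀ φ k c) =
      (blochGen N L Ω₀ φ k).π (c x) * (blochGen N L Ω₀ φ k).mono x := by
  rw [blochSynth_apply, map_sum, Finset.sum_eq_single x]
  · rw [component_π_mul_mono, if_pos rfl]
  · intro y _ hy
    rw [component_π_mul_mono, if_neg fun h => hy (Subtype.ext (cls_injOn y.2 x.2 h))]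
  · simp

/-- The class projection isolates `c_x û_x` without increasing the norm. This term has the norm of
`c_x`, because `û_x` is unitary and the embedding of `C_N(Ω̂)` is isometric. -/
theorem norm_le_norm_blochSynth (hφ : φ.transpose = -φ)
    (hn : ∀ i j, φ i j = 2 * (n i j : ℝ) * Real.pi / (2 * (L : ℝ) + 1)) (k : Torus d)
    (c : VL d L → MatFun N (FinConf d L Ω₀)) : ‖c‖ ≤ ‖blochSynth N L Ω₀ φ k c‖ := by
  refine (pi_norm_le_iff_of_nonneg (norm_nonneg _)).2 fun x => ?_
  rw [← norm_blochGen_π hφ hn k (c x),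
    ← CStarRing.norm_mul_coe_unitary _ ((blochGen N L Ω₀ φ k).umono x), ← CovRep.mono_eq,
    ← component_blochSynth]
  exact norm_component_le _ _ _

theorem blochSynth_bijective (hφ : φ.transpose = -φ)
    (hn : ∀ i j, φ i j = 2 * (n i j : ℝ) * Real.pi / (2 * (L : ℝ) + 1)) (k : Torus d) :
    Function.Bijective (blochSynth N L Ω₀ φ k) := by
  have hS := norm_le_norm_blochSynth (N := N) (Ω₀ := Ω₀) hφ hn k
  refine ⟨injective_of_expanding (E := VL d L → MatFun N (FinConf d L Ω₀)) _ hS, ?_⟩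
  have hle : (blochGen N L Ω₀ φ k).monoSpan ≤
      LinearMap.range (blochSynth N L Ω₀ φ k : (VL d L → MatFun N (FinConf d L Ω₀)) →ₗ[ℂ] _) := by
    refine Submodule.span_le.2 ?_
    rintro _ ⟨⟨f, x⟩, rfl⟩
    obtain ⟨x₀, y, rfl⟩ := exists_VL_add (L := L) x
    -- Folding puts `f û_{x₀+My}` into the slot `x₀`, with the folding factor absorbed into the
    -- coefficient.
    refine ⟨Pi.single x₀ ((foldSign n x₀ y * phase k y) • f), ?_⟩
    show blochSynth N L Ω₀ φ k _ = _
    dsimp only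
    rw [CovRep.mono_add_smul hn _ k (blochGen_pow N L Ω₀ φ k), blochSynth_apply,
      Finset.sum_eq_single x₀]
    · rw [Pi.single_eq_same, map_smul, smul_mul_assoc, mul_smul_comm]
    · intro x _ hx
      rw [Pi.single_eq_of_ne hx, map_zero, zero_mul]
    · simp
  have hd := (dense_monoSpan (N := N) (φ := φ) (P := powConstraint L k)
    (finShift_leftInverse (d := d) (L := L) (Ω₀ := Ω₀))).mono
    (show _ ⊆ Set.range (blochSynth N L Ω₀ φ k) from hle)
  exact surjective_of_expanding (E := VL d L → MatFun N (FinConf d L Ω₀)) _ hS hd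

theorem existsUnique_isBlochFourier (hφ : φ.transpose = -φ)
    (hn : ∀ i j, φ i j = 2 * (n i j : ℝ) * Real.pi / (2 * (L : ℝ) + 1)) (k : Torus d)
    (b : BlochAlg N L Ω₀ φ k) : ∃! c, IsBlochFourier k b c := by
  obtain ⟨c, hc, hu⟩ := (blochSynth_bijective hφ hn k).existsUnique b
  exact ⟨c, hc.symm, fun c' h => hu c' (Eq.symm h)⟩

/-- The Fourier coefficients as a linear map. -/
def blochCoeff (hφ : φ.transpose = -φ)
    (hn : ∀ i j, φ i j = 2 * (n i j : ℝ) * Real.pi / (2 * (L : ℝ) + 1)) (k : Torus d) :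
    BlochAlg N L Ω₀ φ k →L[ℂ] (VL d L → MatFun N (FinConf d L Ω₀)) :=
  expandingInverse (E := VL d L → MatFun N (FinConf d L Ω₀))
    (F := BlochAlg N L Ω₀ φ k) (blochSynth N L Ω₀ φ k) (blochSynth_bijective hφ hn k)
    (norm_le_norm_blochSynth hφ hn k)

variable (hφ : φ.transpose = -φ)
  (hn : ∀ i j, φ i j = 2 * (n i j : ℝ) * Real.pi / (2 * (L : ℝ) + 1))

theorem blochSynth_blochCoeff (k : Torus d) (b : BlochAlg N L Ω₀ φ k) :
    blochSynth N L Ω₀ φ k (blochCoeff hφ hn k b) = b :=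
  apply_expandingInverse (E := VL d L → MatFun N (FinConf d L Ω₀))
    (F := BlochAlg N L Ω₀ φ k) (blochSynth N L Ω₀ φ k) (blochSynth_bijective hφ hn k)
    (norm_le_norm_blochSynth hφ hn k) b

theorem blochCoeff_eq_iff (k : Torus d) (b : BlochAlg N L Ω₀ φ k)
    (c : VL d L → MatFun N (FinConf d L Ω₀)) :
    blochCoeff hφ hn k b = c ↔ IsBlochFourier k b c := by
  constructor
  · rintro rfl
    exact (blochSynth_blochCoeff hφ hn k b).symm
  · intro h
    refine (blochSynth_bijective hφ hn k).1 ?_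
    rw [blochSynth_blochCoeff]
    exact h

theorem norm_blochCoeff_le (k : Torus d) (b : BlochAlg N L Ω₀ φ k) :
    ‖blochCoeff hφ hn k b‖ ≤ ‖b‖ := by
  refine (norm_le_norm_blochSynth hφ hn k _).trans_eq (congrArg norm ?_)
  exact blochSynth_blochCoeff hφ hn k b

end BlochAlgebra

end Bloch

namespace Bloch

/-! ## The field of Bloch algebras -/

section Field

variable {d N L : ℕ} {Ω₀ : Type u} [TopologicalSpace Ω₀] [CompactSpace Ω₀]
  {φ : Matrix (Fin d) (Fin d) ℝ} {n : Matrix (Fin d) (Fin d) ℤ}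

attribute [local irreducible] instCStarAlgebraUnivAlg

variable (N Ω₀ φ) in
/-- The isomorphism `Â((2L+1)t) → Â(0)` with `û_j ↦ e^{i t_j} û_j`. -/
def trivialization (t : Torus d) :
    BlochAlg N L Ω₀ φ ((2 * L + 1) • t) →⋆ₐ[ℂ] BlochAlg N L Ω₀ φ 0 :=
  blochTwist (fun j => (t j).toCircle) _ _ fun j => by
    rw [Pi.zero_apply, AddCircle.toCircle_zero, mul_one, Pi.smul_apply, AddCircle.toCircle_nsmul]

theorem trivialization_π (t : Torus d) (f : MatFun N (FinConf d L Ω₀)) :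
    trivialization N Ω₀ φ t ((blochGen N L Ω₀ φ ((2 * L + 1) • t)).π f) =
      (blochGen N L Ω₀ φ 0).π f := blochTwist_π _ f

theorem trivialization_mono (t : Torus d) (x : Fin d → ℤ) :
    trivialization N Ω₀ φ t ((blochGen N L Ω₀ φ ((2 * L + 1) • t)).mono x) =
      phase t x • (blochGen N L Ω₀ φ 0).mono x := blochTwist_mono _ x

theorem norm_trivialization (t : Torus d) (a : BlochAlg N L Ω₀ φ ((2 * L + 1) • t)) :
    ‖trivialization N Ω₀ φ t a‖ = ‖a‖ := norm_blochTwist _ a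

theorem trivialization_injective (t : Torus d) :
    Function.Injective (trivialization (L := L) N Ω₀ φ t) := by
  refine (injective_iff_map_eq_zero (trivialization (L := L) N Ω₀ φ t)).2 fun a ha => ?_
  rw [← norm_eq_zero, ← norm_trivialization, ha, norm_zero]

theorem trivialization_blochSynth (t : Torus d) (c : VL d L → MatFun N (FinConf d L Ω₀)) :
    trivialization N Ω₀ φ t (blochSynth N L Ω₀ φ ((2 * L + 1) • t) c) =
      blochSynth N L Ω₀ φ 0 fun x => phase t x • c x := by
  rw [blochSynth_apply, blochSynth_apply, map_sum]
  refine Finset.sum_congr rfl fun x _ => ?_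
  rw [map_mul, trivialization_π, trivialization_mono, map_smul, smul_mul_assoc, mul_smul_comm]

theorem continuous_torus_nsmul (L : ℕ) : Continuous fun t : Torus d => (2 * L + 1) • t :=
  continuous_const_smul _

/-- Continuity in `k` may therefore be tested on the covering torus, where the field is trivial. -/
theorem isQuotientMap_torus_nsmul (L : ℕ) :
    Topology.IsQuotientMap fun t : Torus d => (2 * L + 1) • t :=
  (continuous_torus_nsmul L).isClosedMap.isQuotientMap (continuous_torus_nsmul L)
    (torus_nsmul_surjective L)

variable (hφ : φ.transpose = -φ)
  (hn : ∀ i j, φ i j = 2 * (n i j : ℝ) * Real.pi / (2 * (L : ℝ) + 1))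

theorem blochCoeff_trivialization (t : Torus d) (a : BlochAlg N L Ω₀ φ ((2 * L + 1) • t))
    (x : VL d L) :
    blochCoeff hφ hn 0 (trivialization N Ω₀ φ t a) x = phase t x • blochCoeff hφ hn _ a x := by
  have : blochCoeff hφ hn 0 (trivialization N Ω₀ φ t a) =
      fun x : VL d L => phase t x • blochCoeff hφ hn _ a x := by
    rw [blochCoeff_eq_iff]
    conv_lhs => rw [← blochSynth_blochCoeff hφ hn _ a]
    rw [trivialization_blochSynth]
    rfl
  rw [this]

/-- On the covering, the coefficient at `x` is `e^{-i t·x}` times a coefficient taken in the fixed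
algebra at `0`, where the coefficient map is continuous. -/
theorem continuous_blochCoeff (s : ∀ k : Torus d, BlochAlg N L Ω₀ φ k)
    (hs : Continuous fun t : Torus d => trivialization N Ω₀ φ t (s ((2 * L + 1) • t)))
    (x : VL d L) : Continuous fun k => blochCoeff hφ hn k (s k) x := by
  rw [(isQuotientMap_torus_nsmul L).continuous_iff]
  have h1 : Continuous fun t : Torus d => phase t (-x) •
      blochCoeff hφ hn 0 (trivialization N Ω₀ φ t (s ((2 * L + 1) • t))) x :=
    (continuous_phase _).smul ((continuous_apply x).comp ((blochCoeff hφ hn 0).continuous.comp hs))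
  refine h1.congr fun t => ?_
  rw [blochCoeff_trivialization, smul_smul, mul_comm (phase t _), phase_mul_phase_neg, one_smul]
  rfl

include hφ hn in
-- This replaces continuity of the coefficients by continuity into a single C*-algebra, a condition
-- visibly stable under the algebra operations and under locally uniform limits.
theorem mem_blochSections_iff (s : ∀ k : Torus d, BlochAlg N L Ω₀ φ k) :
    s ∈ blochSections N L Ω₀ φ ↔
      Continuous fun t : Torus d => trivialization N Ω₀ φ t (s ((2 * L + 1) • t)) := by
  constructor
  · rintro ⟨c, hc⟩
    have h1 : ∀ t : Torus d, trivialization N Ω₀ φ t (s ((2 * L + 1) • t)) =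
        blochSynth N L Ω₀ φ 0 fun x => phase t x • c x ((2 * L + 1) • t) := by
      intro t
      rw [← trivialization_blochSynth]
      exact congrArg _ (hc _)
    simp only [h1]
    exact (blochSynth N L Ω₀ φ 0).continuous.comp (continuous_pi fun x =>
      (continuous_phase _).smul ((c x).continuous.comp (continuous_torus_nsmul L)))
  · intro hs
    refine ⟨fun x => ⟨_, continuous_blochCoeff hφ hn s hs x⟩, fun k => ?_⟩
    exact (blochCoeff_eq_iff hφ hn k (s k) _).1 rfl

include hφ hn in
theorem isContinuousField_bloch :
    IsContinuousField (fun k : Torus d => BlochAlg N L Ω₀ φ k) (blochSections N L Ω₀ φ) where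
  zero_mem := by
    rw [mem_blochSections_iff hφ hn]
    refine continuous_zero.congr fun t => ?_
    exact (map_zero (trivialization N Ω₀ φ t)).symm
  add_mem s hs s' hs' := by
    rw [mem_blochSections_iff hφ hn] at hs hs' ⊢
    refine (hs.add hs').congr fun t => ?_
    exact (map_add (trivialization N Ω₀ φ t) _ _).symm
  smul_mem c s hs := by
    rw [mem_blochSections_iff hφ hn] at hs ⊢
    refine (hs.const_smul c).congr fun t => ?_
    exact (map_smul (trivialization N Ω₀ φ t) _ _).symm
  mul_mem s hs s' hs' := by
    rw [mem_blochSections_iff hφ hn] at hs hs' ⊢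
    refine (hs.mul hs').congr fun t => ?_
    exact (map_mul (trivialization N Ω₀ φ t) _ _).symm
  star_mem s hs := by
    rw [mem_blochSections_iff hφ hn] at hs ⊢
    refine hs.star.congr fun t => ?_
    exact (map_star (trivialization N Ω₀ φ t) _).symm
  dense k := by
    -- Every element of a fibre is attained, by the section with constant coefficients.
    have : (fun s : ∀ k, BlochAlg N L Ω₀ φ k => s k) '' blochSections N L Ω₀ φ = Set.univ := by
      refine Set.eq_univ_of_forall fun b => ?_
      let c := blochCoeff hφ hn k b
      refine ⟨fun k' => blochSynth N L Ω₀ φ k' c, ⟨fun x => ContinuousMap.const _ (c x), ?_⟩, ?_⟩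
      · intro k'
        rfl
      · exact blochSynth_blochCoeff hφ hn k b
    rw [this]
    exact dense_univ
  continuous_norm s hs := by
    rw [mem_blochSections_iff hφ hn] at hs
    rw [(isQuotientMap_torus_nsmul L).continuous_iff]
    refine hs.norm.congr fun t => ?_
    exact norm_trivialization t _
  mem_of_locally_approx s hs := by
    rw [mem_blochSections_iff hφ hn, continuous_iff_continuousAt]
    intro t
    refine continuousAt_of_locally_uniform_approx_of_continuousAt fun u hu => ?_
    obtain ⟨ε, hε, hεu⟩ := Metric.mem_uniformity_dist.1 hu
    obtain ⟨s', hs', hev⟩ := hs ((2 * L + 1) • t) (ε / 2) (half_pos hε)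
    refine ⟨_, (continuous_torus_nsmul L).continuousAt.eventually hev,
      fun t : Torus d => trivialization N Ω₀ φ t (s' ((2 * L + 1) • t)),
      ((mem_blochSections_iff hφ hn s').1 hs').continuousAt, fun t' ht' => hεu ?_⟩
    have h1 : ‖s ((2 * L + 1) • t') - s' ((2 * L + 1) • t')‖ ≤ ε / 2 := ht'
    rw [dist_eq_norm, ← map_sub, norm_trivialization]
    linarith

end Field

end Bloch

namespace Bloch

/-! ## The periodic algebra -/

section Periodic

variable {d N L : ℕ} {Ω₀ : Type u} [TopologicalSpace Ω₀] [CompactSpace Ω₀]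
  {φ : Matrix (Fin d) (Fin d) ℝ} {n : Matrix (Fin d) (Fin d) ℤ}

omit [CompactSpace Ω₀] in
theorem perShift_qInvMap (j : Fin d) :
    (perShift j).comp (qInvMap (d := d) (L := L) (Ω₀ := Ω₀)) = qInvMap.comp (finShift j) := by
  refine ContinuousMap.ext fun ω => Subtype.ext (funext fun x => ?_)
  show ω (cls L (x - Pi.single j 1)) = ω (cls L x - cls L (Pi.single j 1))
  congr 1
  funext i
  simp [cls]

omit [CompactSpace Ω₀] in
theorem qInvMap_comp_qMap :
    (qInvMap (d := d) (L := L) (Ω₀ := Ω₀)).comp qMap = ContinuousMap.id _ :=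
  ContinuousMap.ext fun ω => qHat.symm_apply_apply ω

omit [CompactSpace Ω₀] in
theorem qMap_comp_qInvMap :
    (qMap (d := d) (L := L) (Ω₀ := Ω₀)).comp qInvMap = ContinuousMap.id _ :=
  ContinuousMap.ext fun ω => qHat.apply_symm_apply ω

omit [CompactSpace Ω₀] in
theorem perShift_leftInverse (j : Fin d) : ∃ σ : C(PerConf d L Ω₀, PerConf d L Ω₀),
    σ.comp (perShift j) = ContinuousMap.id _ := by
  obtain ⟨σ, hσ⟩ := finShift_leftInverse (L := L) (Ω₀ := Ω₀) j
  refine ⟨(qInvMap.comp σ).comp qMap, ?_⟩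
  have h : qMap.comp (perShift (L := L) (Ω₀ := Ω₀) j) = (finShift j).comp qMap := by
    have h1 : perShift (L := L) (Ω₀ := Ω₀) j = (qInvMap.comp (finShift j)).comp qMap := by
      rw [← perShift_qInvMap, ContinuousMap.comp_assoc, qInvMap_comp_qMap, ContinuousMap.comp_id]
    rw [h1, ← ContinuousMap.comp_assoc, ← ContinuousMap.comp_assoc, qMap_comp_qInvMap,
      ContinuousMap.id_comp]
  rw [ContinuousMap.comp_assoc, h, ← ContinuousMap.comp_assoc, ContinuousMap.comp_assoc _ σ, hσ,
    ContinuousMap.comp_id, qInvMap_comp_qMap]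

variable (N L Ω₀ φ) in
/-- The representation of the periodic relations in the Bloch algebra. -/
def blochPerRep (k : Torus d) :
    CovRep N (perShift (d := d) (L := L) (Ω₀ := Ω₀)) φ (BlochAlg N L Ω₀ φ k) where
  π := (blochGen N L Ω₀ φ k).π.comp (ContinuousMap.compStarAlgHom' ℂ _ qInvMap)
  u := (blochGen N L Ω₀ φ k).u
  comm := (blochGen N L Ω₀ φ k).comm
  cov f j := by
    refine ((blochGen N L Ω₀ φ k).cov (f.comp qInvMap) j).trans ?_
    rw [ContinuousMap.comp_assoc, ← perShift_qInvMap, ← ContinuousMap.comp_assoc]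
    rfl

variable (N L Ω₀ φ) in
theorem exists_fold (k : Torus d) :
    ∃ ψ : PerAlg N L Ω₀ φ →⋆ₐ[ℂ] BlochAlg N L Ω₀ φ k,
      (∀ f, ψ ((perGen N L Ω₀ φ).π f) = (blochGen N L Ω₀ φ k).π (f.comp qInvMap)) ∧
      ∀ j, ψ ((perGen N L Ω₀ φ).u j) = (blochGen N L Ω₀ φ k).u j :=
  exists_lift (blochPerRep N L Ω₀ φ k) fun _ => trivial

attribute [local irreducible] instCStarAlgebraUnivAlg

variable (N L Ω₀ φ) in
/-- The *-homomorphism from the periodic algebra to the Bloch algebra at `k`. -/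
def fold (k : Torus d) : PerAlg N L Ω₀ φ →⋆ₐ[ℂ] BlochAlg N L Ω₀ φ k :=
  (exists_fold N L Ω₀ φ k).choose

theorem fold_π (k : Torus d) (f : MatFun N (PerConf d L Ω₀)) :
    fold N L Ω₀ φ k ((perGen N L Ω₀ φ).π f) = (blochGen N L Ω₀ φ k).π (f.comp qInvMap) :=
  (exists_fold N L Ω₀ φ k).choose_spec.1 f

theorem fold_u (k : Torus d) (j : Fin d) :
    fold N L Ω₀ φ k ((perGen N L Ω₀ φ).u j) = (blochGen N L Ω₀ φ k).u j :=
  (exists_fold N L Ω₀ φ k).choose_spec.2 j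

theorem fold_mono (k : Torus d) (x : Fin d → ℤ) :
    fold N L Ω₀ φ k ((perGen N L Ω₀ φ).mono x) = (blochGen N L Ω₀ φ k).mono x :=
  CovRep.map_mono _ _ _ (fold_u k) x

theorem fold_π_mul_mono (k : Torus d) (f : MatFun N (PerConf d L Ω₀)) (x : Fin d → ℤ) :
    fold N L Ω₀ φ k ((perGen N L Ω₀ φ).π f * (perGen N L Ω₀ φ).mono x) =
      (blochGen N L Ω₀ φ k).π (f.comp qInvMap) * (blochGen N L Ω₀ φ k).mono x := by
  rw [map_mul, fold_π, fold_mono]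

/-- Faithfulness is inherited from the Bloch algebra at `k = 0` through the homeomorphism `q`. -/
theorem perGen_π_injective (hφ : φ.transpose = -φ)
    (hn : ∀ i j, φ i j = 2 * (n i j : ℝ) * Real.pi / (2 * (L : ℝ) + 1)) :
    Function.Injective (perGen N L Ω₀ φ).π := by
  intro f g h
  have h1 := congrArg (fold N L Ω₀ φ 0) h
  rw [fold_π, fold_π] at h1
  have h2 := congrArg (fun F : MatFun N (FinConf d L Ω₀) => F.comp qMap)
    (blochGen_π_injective hφ hn 0 h1)
  simpa only [ContinuousMap.comp_assoc, qInvMap_comp_qMap, ContinuousMap.comp_id] using h2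

/-! ### The gauge action -/

/-- The gauge action of the torus, `ρ_t(u_j) = e^{-i t_j} u_j`. -/
def torusGauge (t : Torus d) : PerAlg N L Ω₀ φ →⋆ₐ[ℂ] PerAlg N L Ω₀ φ :=
  gauge N perShift φ fun j => (t j).toCircle⁻¹

theorem torusGauge_π_mul_mono (t : Torus d) (f : MatFun N (PerConf d L Ω₀)) (x : Fin d → ℤ) :
    torusGauge t ((perGen N L Ω₀ φ).π f * (perGen N L Ω₀ φ).mono x) =
      phase t (-x) • ((perGen N L Ω₀ φ).π f * (perGen N L Ω₀ φ).mono x) := by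
  have h : torusGauge t ((perGen N L Ω₀ φ).mono x) =
      (((perGen N L Ω₀ φ).twist fun j => (t j).toCircle⁻¹).mono x) :=
    CovRep.map_mono _ _ _ (gauge_u N perShift φ _) x
  have h2 : ((∏ j, ((t j).toCircle⁻¹) ^ x j : Circle) : ℂ) = phase t (-x) := by
    simp only [phase, Pi.neg_apply, zpow_neg, inv_zpow]
  have h3 : torusGauge t ((perGen N L Ω₀ φ).π f) = (perGen N L Ω₀ φ).π f := gauge_π N perShift φ _ f
  rw [map_mul, h3, h, CovRep.mono_twist, h2, mul_smul_comm]

/-- Orbits of monomials are characters times constants. The gauge maps are contractions, so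
approximating `a` approximates its orbit uniformly in `t`. -/
theorem continuous_torusGauge (a : PerAlg N L Ω₀ φ) : Continuous fun t => torusGauge t a := by
  have hspan : ∀ b ∈ (perGen N L Ω₀ φ).monoSpan, Continuous fun t => torusGauge t b := by
    intro b hb
    induction hb using Submodule.span_induction with
    | mem b hb =>
      obtain ⟨⟨f, x⟩, rfl⟩ := hb
      simp only [torusGauge_π_mul_mono]
      exact (continuous_phase _).smul continuous_const
    | zero => simp only [map_zero]; exact continuous_const
    | add b c _ _ hb hc => simp only [map_add]; exact hb.add hc
    | smul z b _ hb => simp only [map_smul]; exact hb.const_smul z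
  refine continuous_of_uniform_approx_of_continuous fun u hu => ?_
  obtain ⟨ε, hε, hεu⟩ := Metric.mem_uniformity_dist.1 hu
  obtain ⟨b, hb, hab⟩ := Metric.dense_iff.1 (dense_monoSpan (N := N) (φ := φ) (P := noConstraint)
    (perShift_leftInverse (d := d) (L := L) (Ω₀ := Ω₀))) a ε hε
  refine ⟨fun t => torusGauge t b, hspan b hab, fun t => hεu ?_⟩
  rw [dist_eq_norm, ← map_sub]
  refine (NonUnitalStarAlgHom.norm_apply_le _ _).trans_lt ?_
  rw [← dist_eq_norm, dist_comm]
  exact hb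

variable (N L Ω₀ φ) in
/-- The orbit map of the gauge action. -/
def gaugeOrbit : PerAlg N L Ω₀ φ →L[ℂ] C(Torus d, PerAlg N L Ω₀ φ) :=
  LinearMap.mkContinuous
    { toFun := fun a => ⟨fun t => torusGauge t a, continuous_torusGauge a⟩
      map_add' := fun a b => ContinuousMap.ext fun t => map_add (torusGauge t) a b
      map_smul' := fun c a => ContinuousMap.ext fun t => map_smul (torusGauge t) c a }
    1 fun a => by
      rw [one_mul]
      exact (ContinuousMap.norm_le _ (norm_nonneg _)).2 fun t =>
        NonUnitalStarAlgHom.norm_apply_le (torusGauge t) a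

theorem gaugeOrbit_zero (a : PerAlg N L Ω₀ φ) : gaugeOrbit N L Ω₀ φ a 0 = a := by
  have := clm_ext perShift_leftInverse
    (starCLM (torusGauge (0 : Torus d))) (ContinuousLinearMap.id ℂ (PerAlg N L Ω₀ φ)) fun f x => by
      rw [starCLM_apply, torusGauge_π_mul_mono, phase_zero_left, one_smul]
      rfl
  exact DFunLike.congr_fun this a

/-! ### Fourier coefficients in the periodic algebra -/

/-- The frequency is `-x` because `ρ_t` multiplies `u_x` by `e^{-i t·x}`. -/
theorem fourierCoeff_eq (a : PerAlg N L Ω₀ φ) (x : Fin d → ℤ) :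
    fourierCoeff a x =
      fourierMean _ (-x) (gaugeOrbit N L Ω₀ φ a) * star ((perGen N L Ω₀ φ).mono x) := by
  rw [fourierMean_apply, neg_neg]
  rfl

variable (N L Ω₀ φ) in
/-- The Fourier coefficient as a continuous linear map. -/
def fourierCoeffCLM (x : Fin d → ℤ) : PerAlg N L Ω₀ φ →L[ℂ] PerAlg N L Ω₀ φ :=
  LinearMap.mkContinuous
    { toFun := fun a => fourierCoeff a x
      map_add' := fun a b => by
        simp only [fourierCoeff_eq, map_add, add_mul]
      map_smul' := fun c a => by
        simp only [fourierCoeff_eq, map_smul, smul_mul_assoc, RingHom.id_apply] }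
    1 fun a => by
      rw [one_mul]
      show ‖fourierCoeff a x‖ ≤ ‖a‖
      rw [fourierCoeff_eq, CovRep.mono_eq, ← Unitary.coe_star, CStarRing.norm_mul_coe_unitary]
      refine (norm_fourierMean_le _ _).trans ?_
      exact (ContinuousMap.norm_le _ (norm_nonneg _)).2 fun t =>
        NonUnitalStarAlgHom.norm_apply_le (torusGauge t) a

theorem fourierCoeffCLM_apply (x : Fin d → ℤ) (a : PerAlg N L Ω₀ φ) :
    fourierCoeffCLM N L Ω₀ φ x a = fourierCoeff a x := rfl

theorem fourierCoeff_π_mul_mono (f : MatFun N (PerConf d L Ω₀)) (x y : Fin d → ℤ) :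
    fourierCoeff ((perGen N L Ω₀ φ).π f * (perGen N L Ω₀ φ).mono y) x =
      if y = x then (perGen N L Ω₀ φ).π f else 0 := by
  rw [fourierCoeff_eq, fourierMean_phase_smul (-x) (-y) _ _ fun t => torusGauge_π_mul_mono t f y]
  simp only [neg_inj]
  split_ifs with h
  · rw [h, mul_assoc, CovRep.mono_eq, ← Unitary.coe_star, Unitary.coe_mul_star_self, mul_one]
  · rw [zero_mul]

/-- The coefficient of a monomial is a function or zero. The copy of `C_N(Ω̃)` is closed, being an
isometric image, so density of the monomials suffices. -/
theorem fourierCoeff_mem_range (hφ : φ.transpose = -φ)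
    (hn : ∀ i j, φ i j = 2 * (n i j : ℝ) * Real.pi / (2 * (L : ℝ) + 1))
    (a : PerAlg N L Ω₀ φ) (x : Fin d → ℤ) : ∃ f, (perGen N L Ω₀ φ).π f = fourierCoeff a x := by
  have hclosed : IsClosed (Set.range (perGen N L Ω₀ φ).π) :=
    (NonUnitalStarAlgHom.isometry (perGen N L Ω₀ φ).π
      (perGen_π_injective hφ hn)).isClosedEmbedding.isClosed_range
  have hspan : ∀ b ∈ (perGen N L Ω₀ φ).monoSpan,
      fourierCoeffCLM N L Ω₀ φ x b ∈ Set.range (perGen N L Ω₀ φ).π := by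
    intro b hb
    induction hb using Submodule.span_induction with
    | mem b hb =>
      obtain ⟨⟨f, y⟩, rfl⟩ := hb
      rw [fourierCoeffCLM_apply, fourierCoeff_π_mul_mono]
      split_ifs
      · exact ⟨f, rfl⟩
      · exact ⟨0, map_zero _⟩
    | zero => exact ⟨0, by rw [map_zero, map_zero]⟩
    | add b c _ _ hb hc =>
      obtain ⟨f, hf⟩ := hb
      obtain ⟨g, hg⟩ := hc
      exact ⟨f + g, by rw [map_add, map_add, hf, hg]⟩
    | smul z b _ hb =>
      obtain ⟨f, hf⟩ := hb
      exact ⟨z • f, by rw [map_smul, map_smul, hf]⟩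
  have hd := dense_monoSpan (N := N) (φ := φ) (P := noConstraint)
    (perShift_leftInverse (d := d) (L := L) (Ω₀ := Ω₀))
  have := map_mem_closure (fourierCoeffCLM N L Ω₀ φ x).continuous (hd a) hspan
  rwa [hclosed.closure_eq] at this

theorem existsUnique_isFourier (hφ : φ.transpose = -φ)
    (hn : ∀ i j, φ i j = 2 * (n i j : ℝ) * Real.pi / (2 * (L : ℝ) + 1))
    (a : PerAlg N L Ω₀ φ) : ∃! c, IsFourier a c := by
  choose c hc using fourierCoeff_mem_range (N := N) (Ω₀ := Ω₀) hφ hn a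
  exact ⟨c, hc, fun c' hc' => funext fun x =>
    perGen_π_injective hφ hn ((hc' x).trans (hc x).symm)⟩

/-- The gauge orbit of `a` then has zero Fejér means. By Fejér's theorem these converge at `t = 0`
to `a`. -/
theorem eq_zero_of_fourierCoeff (a : PerAlg N L Ω₀ φ) (h : ∀ x, fourierCoeff a x = 0) : a = 0 := by
  have h1 : ∀ y, fourierMean _ y (gaugeOrbit N L Ω₀ φ a) = 0 := by
    intro y
    have h2 := h (-y)
    rw [fourierCoeff_eq, neg_neg, CovRep.mono_eq, ← Unitary.coe_star] at h2
    rw [← norm_eq_zero, ← CStarRing.norm_mul_coe_unitary _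
      (star ((perGen N L Ω₀ φ).umono (-y))), h2, norm_zero]
  have h3 := (tendstoUniformly_fejerMean (gaugeOrbit N L Ω₀ φ a)).tendsto_at 0
  have h4 : ∀ m, fejerMean (gaugeOrbit N L Ω₀ φ a) m 0 = 0 := fun m =>
    Finset.sum_eq_zero fun y _ => by rw [h1, smul_zero, smul_zero]
  simp only [h4] at h3
  rw [← gaugeOrbit_zero a]
  exact (tendsto_nhds_unique h3 tendsto_const_nhds)

end Periodic

end Bloch

namespace Bloch

/-! ## The Bloch decomposition -/

section Approximation

variable {d : ℕ} {E : Type*} [NormedAddCommGroup E] [NormedSpace ℂ E] [CompleteSpace E]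

theorem exists_forall_sum_norm_fejerMean_sub_le {ι : Type*} [Fintype ι] (c : ι → C(Torus d, E))
    {ε : ℝ} (hε : 0 < ε) : ∃ m, ∀ k, ∑ x, ‖fejerMean (c x) m k - c x k‖ ≤ ε := by
  -- The `+ 1` keeps the denominator positive when `ι` is empty.
  have hδ : 0 < ε / ((Fintype.card ι : ℝ) + 1) := by positivity
  have h : ∀ x, ∀ᶠ m in Filter.atTop, ∀ k,
      dist (c x k) (fejerMean (c x) m k) < ε / ((Fintype.card ι : ℝ) + 1) := fun x =>
    Metric.tendstoUniformly_iff.1 (tendstoUniformly_fejerMean (c x)) _ hδ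
  obtain ⟨m, hm⟩ := (Filter.eventually_all.2 h).exists
  refine ⟨m, fun k => (Finset.sum_le_card_nsmul _ _ (ε / ((Fintype.card ι : ℝ) + 1))
    fun x _ => ?_).trans ?_⟩
  · rw [← dist_eq_norm, dist_comm]
    exact (hm x k).le
  · rw [Finset.card_univ, nsmul_eq_mul, ← mul_div_assoc, div_le_iff₀ (by positivity)]
    nlinarith

theorem tendstoUniformly_map_fejerMean {E' : Type*} [NormedAddCommGroup E'] [NormedSpace ℂ E']
    (T : E →L[ℂ] E') (F : C(Torus d, E)) :
    TendstoUniformly (fun m k => T (fejerMean F m k)) (fun k => T (F k)) Filter.atTop :=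
  T.uniformContinuous.comp_tendstoUniformly (tendstoUniformly_fejerMean F)

variable (E) in
/-- The Fourier coefficient as a continuous linear map. -/
def fourierMeanCLM (y : Fin d → ℤ) : C(Torus d, E) →L[ℂ] E :=
  LinearMap.mkContinuous (fourierMean E y) 1 fun F => by
    rw [one_mul]
    exact norm_fourierMean_le y F

end Approximation

/-! ### Folding the periodic algebra into the field of Bloch algebras -/

section Folding

variable {d N L : ℕ} {Ω₀ : Type u} [TopologicalSpace Ω₀] [CompactSpace Ω₀]
  {φ : Matrix (Fin d) (Fin d) ℝ} {n : Matrix (Fin d) (Fin d) ℤ}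

attribute [local irreducible] instCStarAlgebraUnivAlg

/-- Both sides multiply `u_j` by `e^{i t_j}` and then fold at `0`. The pulled-back section of `a` is
thus the image of a gauge orbit, whose continuity is known. -/
theorem trivialization_fold (t : Torus d) (a : PerAlg N L Ω₀ φ) :
    trivialization N Ω₀ φ t (fold N L Ω₀ φ ((2 * L + 1) • t) a) =
      fold N L Ω₀ φ 0 (torusGauge (-t) a) := by
  have := clm_ext perShift_leftInverse
    ((starCLM (trivialization N Ω₀ φ t)).comp (starCLM (fold N L Ω₀ φ ((2 * L + 1) • t))))
    ((starCLM (fold N L Ω₀ φ 0)).comp (starCLM (torusGauge (-t)))) fun f x => by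
      simp only [ContinuousLinearMap.comp_apply, starCLM_apply]
      rw [fold_π_mul_mono, map_mul, trivialization_π, trivialization_mono, torusGauge_π_mul_mono,
        map_smul, fold_π_mul_mono, phase_neg_left, neg_neg, mul_smul_comm]
  exact DFunLike.congr_fun this a

theorem continuous_trivialization_fold (a : PerAlg N L Ω₀ φ) :
    Continuous fun t : Torus d =>
      trivialization N Ω₀ φ t (fold N L Ω₀ φ ((2 * L + 1) • t) a) := by
  simp only [trivialization_fold]
  exact (continuous_starAlgHom _).comp ((continuous_torusGauge a).comp continuous_neg)

variable (N L Ω₀ φ) in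
/-- The *-homomorphism of the periodic algebra into the product of the Bloch algebras. -/
def blochHom : PerAlg N L Ω₀ φ →⋆ₐ[ℂ] (∀ k : Torus d, BlochAlg N L Ω₀ φ k) where
  toFun a k := fold N L Ω₀ φ k a
  map_one' := funext fun k => map_one (fold N L Ω₀ φ k)
  map_mul' a b := funext fun k => map_mul (fold N L Ω₀ φ k) a b
  map_zero' := funext fun k => map_zero (fold N L Ω₀ φ k)
  map_add' a b := funext fun k => map_add (fold N L Ω₀ φ k) a b
  commutes' c := funext fun k => AlgHomClass.commutes (fold N L Ω₀ φ k) c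
  map_star' a := funext fun k => map_star (fold N L Ω₀ φ k) a

theorem blochHom_apply (a : PerAlg N L Ω₀ φ) (k : Torus d) :
    blochHom N L Ω₀ φ a k = fold N L Ω₀ φ k a := rfl

variable (N L Ω₀ φ) in
/-- The *-homomorphism of the periodic algebra into the continuous functions on the `(2L+1)`-fold
covering of the torus, over which the field of Bloch algebras is trivial. -/
def coverHom : PerAlg N L Ω₀ φ →⋆ₐ[ℂ] C(Torus d, BlochAlg N L Ω₀ φ 0) where
  toFun a := ⟨_, continuous_trivialization_fold a⟩
  map_one' := ContinuousMap.ext fun t =>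
    map_one ((trivialization N Ω₀ φ t).comp (fold N L Ω₀ φ ((2 * L + 1) • t)))
  map_mul' a b := ContinuousMap.ext fun t =>
    map_mul ((trivialization N Ω₀ φ t).comp (fold N L Ω₀ φ ((2 * L + 1) • t))) a b
  map_zero' := ContinuousMap.ext fun t =>
    map_zero ((trivialization N Ω₀ φ t).comp (fold N L Ω₀ φ ((2 * L + 1) • t)))
  map_add' a b := ContinuousMap.ext fun t =>
    map_add ((trivialization N Ω₀ φ t).comp (fold N L Ω₀ φ ((2 * L + 1) • t))) a b
  commutes' c := ContinuousMap.ext fun t =>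
    AlgHomClass.commutes ((trivialization N Ω₀ φ t).comp (fold N L Ω₀ φ ((2 * L + 1) • t))) c
  map_star' a := ContinuousMap.ext fun t =>
    map_star ((trivialization N Ω₀ φ t).comp (fold N L Ω₀ φ ((2 * L + 1) • t))) a

theorem coverHom_apply (a : PerAlg N L Ω₀ φ) (t : Torus d) :
    coverHom N L Ω₀ φ a t = trivialization N Ω₀ φ t (fold N L Ω₀ φ ((2 * L + 1) • t) a) := rfl

/-- The continuous functions on the torus with values in a normed space. -/
abbrev TorusMap (d : ℕ) (E : Type*) [NormedAddCommGroup E] : Type _ := C(Torus d, E)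

/-- The composition with a continuous map, as a continuous linear map. -/
def compCLM {X Y : Type u} [TopologicalSpace X] [CompactSpace X] [TopologicalSpace Y]
    [CompactSpace Y] (g : C(Y, X)) : MatFun N X →L[ℂ] MatFun N Y :=
  starCLM (A := MatFun N X) (B := MatFun N Y) (ContinuousMap.compStarAlgHom' ℂ _ g)

theorem compCLM_apply {X Y : Type u} [TopologicalSpace X] [CompactSpace X] [TopologicalSpace Y]
    [CompactSpace Y] (g : C(Y, X)) (f : MatFun N X) : compCLM g f = f.comp g := rfl

theorem comp_qMap_injective :
    Function.Injective fun f : MatFun N (FinConf d L Ω₀) => f.comp qMap := by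
  intro f g h
  have h2 := congrArg (fun F : MatFun N (PerConf d L Ω₀) => F.comp qInvMap) h
  simpa only [ContinuousMap.comp_assoc, qMap_comp_qInvMap, ContinuousMap.comp_id] using h2

/-! ### Coefficients of folded elements, injectivity, norm and range -/

section Coefficients

variable (hφ : φ.transpose = -φ)
  (hn : ∀ i j, φ i j = 2 * (n i j : ℝ) * Real.pi / (2 * (L : ℝ) + 1))

/-- The Fourier coefficients of the image of an element of the periodic algebra. -/
def foldCoeff (x : VL d L) : PerAlg N L Ω₀ φ →L[ℂ] TorusMap d (MatFun N (FinConf d L Ω₀)) :=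
  LinearMap.mkContinuous
    { toFun := fun a => ⟨fun k => blochCoeff hφ hn k (fold N L Ω₀ φ k a) x,
        continuous_blochCoeff hφ hn _ (continuous_trivialization_fold a) x⟩
      map_add' := fun a b => ContinuousMap.ext fun k => by
        simp only [ContinuousMap.coe_mk, ContinuousMap.add_apply, map_add, Pi.add_apply]
      map_smul' := fun c a => ContinuousMap.ext fun k => by
        simp only [ContinuousMap.coe_mk, ContinuousMap.smul_apply, map_smul, Pi.smul_apply,
          RingHom.id_apply] }
    1 fun a => by
      rw [one_mul]
      refine (ContinuousMap.norm_le _ (norm_nonneg _)).2 fun k => ?_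
      exact (norm_le_pi_norm (blochCoeff hφ hn k (fold N L Ω₀ φ k a)) x).trans
        ((norm_blochCoeff_le hφ hn k _).trans (NonUnitalStarAlgHom.norm_apply_le _ a))

theorem foldCoeff_apply (x : VL d L) (a : PerAlg N L Ω₀ φ) (k : Torus d) :
    foldCoeff hφ hn x a k = blochCoeff hφ hn k (fold N L Ω₀ φ k a) x := rfl

theorem foldCoeff_π_mul_mono (x x₀ : VL d L) (y : Fin d → ℤ) (f : MatFun N (PerConf d L Ω₀))
    (k : Torus d) :
    foldCoeff hφ hn x ((perGen N L Ω₀ φ).π f *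
      (perGen N L Ω₀ φ).mono (x₀ + (2 * L + 1 : ℤ) • y)) k =
      if x = x₀ then phase k y • foldSign n x₀ y • f.comp qInvMap else 0 := by
  have h : blochCoeff hφ hn k (fold N L Ω₀ φ k ((perGen N L Ω₀ φ).π f *
      (perGen N L Ω₀ φ).mono (x₀ + (2 * L + 1 : ℤ) • y))) =
      Pi.single x₀ ((foldSign n x₀ y * phase k y) • f.comp qInvMap) := by
    rw [blochCoeff_eq_iff, fold_π_mul_mono,
      CovRep.mono_add_smul hn _ k (blochGen_pow N L Ω₀ φ k), IsBlochFourier,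
      Finset.sum_eq_single x₀]
    · rw [Pi.single_eq_same, map_smul, smul_mul_assoc, mul_smul_comm]
    · intro x _ hx
      rw [Pi.single_eq_of_ne hx, map_zero, zero_mul]
    · simp
  rw [foldCoeff_apply, h, Pi.single_apply, mul_comm (foldSign n _ _), mul_smul]

theorem add_smul_inj {x x₀ : VL d L} {y y₀ : Fin d → ℤ}
    (h : (x₀ + (2 * L + 1 : ℤ) • y₀ : Fin d → ℤ) = x + (2 * L + 1 : ℤ) • y) : x = x₀ ∧ y₀ = y := by
  have hx : x = x₀ := by
    refine Subtype.ext (cls_injOn x.2 x₀.2 (cls_eq_iff.2 ⟨y₀ - y, ?_⟩))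
    rw [smul_sub, ← add_sub_assoc, h, add_sub_cancel_right]
  subst hx
  refine ⟨rfl, smul_right_injective _ (by omega : (2 * L + 1 : ℤ) ≠ 0) (add_left_cancel h)⟩

/-- Both sides are continuous and linear in `a`, so monomials suffice. For `f u_{x₀+My₀}` the folded
coefficient is supported at `x₀` and is a pure character of frequency `y₀`; the sign occurs twice
and cancels. -/
theorem fourierCoeff_add_smul (a : PerAlg N L Ω₀ φ) (x : VL d L) (y : Fin d → ℤ) :
    fourierCoeff a (x + (2 * L + 1 : ℤ) • y) = (perGen N L Ω₀ φ).π
      (foldSign n x y •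
        (fourierMean (MatFun N (FinConf d L Ω₀)) y (foldCoeff hφ hn x a)).comp qMap) := by
  let M : TorusMap d (MatFun N (FinConf d L Ω₀)) →L[ℂ] MatFun N (FinConf d L Ω₀) :=
    fourierMeanCLM (MatFun N (FinConf d L Ω₀)) y
  let S : PerAlg N L Ω₀ φ →L[ℂ] MatFun N (PerConf d L Ω₀) :=
    foldSign n x y • (compCLM qMap).comp (M.comp (foldCoeff hφ hn x))
  let P : MatFun N (PerConf d L Ω₀) →L[ℂ] PerAlg N L Ω₀ φ :=
    starCLM (A := MatFun N (PerConf d L Ω₀)) (perGen N L Ω₀ φ).π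
  have := clm_ext perShift_leftInverse (fourierCoeffCLM N L Ω₀ φ (x + (2 * L + 1 : ℤ) • y))
    (P.comp S) fun f z => by
      obtain ⟨x₀, y₀, rfl⟩ := exists_VL_add (L := L) z
      show fourierCoeff _ _ = (perGen N L Ω₀ φ).π
        (foldSign n x y •
          (fourierMean (MatFun N (FinConf d L Ω₀)) y (foldCoeff hφ hn x _)).comp qMap)
      rw [fourierCoeff_π_mul_mono]
      by_cases hx : x = x₀
      · subst hx
        rw [fourierMean_phase_smul y y₀ (foldSign n x y₀ • f.comp qInvMap) _ fun k => by
          rw [foldCoeff_π_mul_mono, if_pos rfl]]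
        by_cases hy : y₀ = y
        · subst hy
          rw [if_pos rfl, if_pos rfl, ← compCLM_apply, map_smul, map_smul, map_smul, smul_smul,
            foldSign_mul_self, one_smul, compCLM_apply, ContinuousMap.comp_assoc, qInvMap_comp_qMap,
            ContinuousMap.comp_id]
        · rw [if_neg hy, if_neg fun h => hy (add_smul_inj h).2, ContinuousMap.zero_comp, smul_zero,
            map_zero]
      · have h0 : foldCoeff hφ hn x ((perGen N L Ω₀ φ).π f *
            (perGen N L Ω₀ φ).mono (x₀ + (2 * L + 1 : ℤ) • y₀)) = 0 :=
          ContinuousMap.ext fun k => by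
            rw [foldCoeff_π_mul_mono, if_neg hx, ContinuousMap.zero_apply]
        rw [h0, map_zero, if_neg fun h => hx (add_smul_inj h).1, ContinuousMap.zero_comp, smul_zero,
          map_zero]
  exact DFunLike.congr_fun this a

include hφ hn in
theorem blochHom_injective : Function.Injective (blochHom N L Ω₀ φ) := by
  refine (injective_iff_map_eq_zero (blochHom N L Ω₀ φ)).2 fun a ha => ?_
  refine eq_zero_of_fourierCoeff a fun z => ?_
  obtain ⟨x, y, rfl⟩ := exists_VL_add (L := L) z
  have h0 : foldCoeff hφ hn x a = 0 := ContinuousMap.ext fun k => by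
    rw [foldCoeff_apply, ← blochHom_apply, ha, Pi.zero_apply, map_zero]
    rfl
  rw [fourierCoeff_add_smul hφ hn, h0, map_zero, ContinuousMap.zero_comp, smul_zero, map_zero]

include hφ hn in
theorem coverHom_injective : Function.Injective (coverHom N L Ω₀ φ) := by
  refine (injective_iff_map_eq_zero (coverHom N L Ω₀ φ)).2 fun a ha => ?_
  refine blochHom_injective hφ hn ?_
  rw [map_zero]
  funext k
  obtain ⟨t, rfl⟩ := torus_nsmul_surjective L k
  refine trivialization_injective t ?_
  have h := DFunLike.congr_fun ha t
  rw [coverHom_apply, ContinuousMap.zero_apply] at h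
  exact h.trans (map_zero (trivialization N Ω₀ φ t)).symm

include hφ hn in
-- An injective *-homomorphism of C*-algebras is isometric. The sup norm on the covering is bounded
-- by the fibre norms because each trivialization is isometric.
theorem isLUB_norm_blochHom (a : PerAlg N L Ω₀ φ) :
    IsLUB (Set.range fun k => ‖blochHom N L Ω₀ φ a k‖) ‖a‖ := by
  constructor
  · rintro _ ⟨k, rfl⟩
    exact NonUnitalStarAlgHom.norm_apply_le (fold N L Ω₀ φ k) a
  · intro b hb
    rw [← NonUnitalStarAlgHom.norm_map (coverHom N L Ω₀ φ) (coverHom_injective hφ hn) a]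
    refine (ContinuousMap.norm_le _ ((norm_nonneg _).trans (hb ⟨0, rfl⟩))).2 fun t => ?_
    rw [coverHom_apply, norm_trivialization]
    exact hb ⟨(2 * L + 1) • t, rfl⟩

variable (n φ) in
/-- The elements of the periodic algebra with the Fejér means of given functions as Fourier
coefficients. -/
def fejerElement (c : VL d L → TorusMap d (MatFun N (FinConf d L Ω₀))) (m : ℕ) :
    PerAlg N L Ω₀ φ :=
  ∑ x : VL d L, ∑ y ∈ VL d m, ((fejerWeight m y : ℂ) * foldSign n x y) •
    ((perGen N L Ω₀ φ).π ((fourierMean (MatFun N (FinConf d L Ω₀)) y (c x)).comp qMap) *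
      (perGen N L Ω₀ φ).mono (x + (2 * L + 1 : ℤ) • y))

include hn in
theorem fold_fejerElement (c : VL d L → TorusMap d (MatFun N (FinConf d L Ω₀))) (m : ℕ)
    (k : Torus d) :
    fold N L Ω₀ φ k (fejerElement φ n c m) =
      blochSynth N L Ω₀ φ k fun x => fejerMean (c x) m k := by
  rw [fejerElement, map_sum, blochSynth_apply]
  refine Finset.sum_congr rfl fun x _ => ?_
  rw [map_sum, fejerMean, map_sum, Finset.sum_mul]
  refine Finset.sum_congr rfl fun y _ => ?_
  rw [map_smul, fold_π_mul_mono, ContinuousMap.comp_assoc, qMap_comp_qInvMap,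
    ContinuousMap.comp_id, CovRep.mono_add_smul hn _ k (blochGen_pow N L Ω₀ φ k), map_smul,
    map_smul, smul_mul_assoc, smul_mul_assoc, mul_smul_comm, smul_smul, smul_smul]
  congr 1
  rw [mul_assoc, ← mul_assoc (foldSign n _ _), foldSign_mul_self, one_mul]

theorem norm_blochSynth_le (k : Torus d) (c : VL d L → MatFun N (FinConf d L Ω₀)) :
    ‖blochSynth N L Ω₀ φ k c‖ ≤ ∑ x, ‖c x‖ := by
  rw [blochSynth_apply]
  refine (norm_sum_le _ _).trans (Finset.sum_le_sum fun x _ => ?_)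
  rw [CovRep.mono_eq, CStarRing.norm_mul_coe_unitary]
  exact NonUnitalStarAlgHom.norm_apply_le (blochGen N L Ω₀ φ k).π (c x)

include hφ hn in
theorem range_blochHom : Set.range (blochHom N L Ω₀ φ) = blochSections N L Ω₀ φ := by
  refine Set.Subset.antisymm ?_ fun s hs => ?_
  · rintro _ ⟨a, rfl⟩
    exact (mem_blochSections_iff hφ hn _).2 (continuous_trivialization_fold a)
  · obtain ⟨c, hc⟩ := id hs
    let s' : C(Torus d, BlochAlg N L Ω₀ φ 0) := ⟨_, (mem_blochSections_iff hφ hn s).1 hs⟩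
    -- The product over `k` is not normed, so closedness of the range is used on the covering. There
    -- the image of the periodic algebra is isometric, hence complete.
    have hclosed : IsClosed (Set.range (coverHom N L Ω₀ φ)) :=
      (NonUnitalStarAlgHom.isometry (coverHom N L Ω₀ φ)
        (coverHom_injective hφ hn)).isClosedEmbedding.isClosed_range
    have hmem : s' ∈ closure (Set.range (coverHom N L Ω₀ φ)) := by
      refine Metric.mem_closure_iff.2 fun ε hε => ?_
      obtain ⟨m, hm⟩ := exists_forall_sum_norm_fejerMean_sub_le
        (E := MatFun N (FinConf d L Ω₀)) c (half_pos hε)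
      refine ⟨_, ⟨fejerElement φ n c m, rfl⟩, lt_of_le_of_lt ?_ (half_lt_self hε)⟩
      rw [dist_comm, dist_eq_norm]
      refine (ContinuousMap.norm_le _ (half_pos hε).le).2 fun t => ?_
      have h1 : (coverHom N L Ω₀ φ (fejerElement φ n c m) - s') t =
          trivialization N Ω₀ φ t (blochSynth N L Ω₀ φ ((2 * L + 1) • t) fun x =>
            fejerMean (c x) m ((2 * L + 1) • t) - c x ((2 * L + 1) • t)) := by
        have h2 : s ((2 * L + 1) • t) = blochSynth N L Ω₀ φ _ fun x => c x ((2 * L + 1) • t) :=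
          hc _
        have h3 : (fun x => fejerMean (c x) m ((2 * L + 1) • t) - c x ((2 * L + 1) • t)) =
          (fun x => fejerMean (c x) m ((2 * L + 1) • t)) - fun x => c x ((2 * L + 1) • t) := rfl
        rw [h3, map_sub, map_sub, ← h2, ← fold_fejerElement hn]
        rfl
      rw [h1, norm_trivialization]
      exact (norm_blochSynth_le _ _).trans (hm _)
    rw [hclosed.closure_eq] at hmem
    obtain ⟨a, ha⟩ := hmem
    refine ⟨a, funext fun k => ?_⟩
    obtain ⟨t, rfl⟩ := torus_nsmul_surjective L k
    exact trivialization_injective t (DFunLike.congr_fun ha t)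

end Coefficients

/-! ### The folding relations -/

section Relations

variable {c : (Fin d → ℤ) → MatFun N (PerConf d L Ω₀)}
  {F : VL d L → TorusMap d (MatFun N (FinConf d L Ω₀))}

/-- Evaluation at a configuration is continuous and linear and so commutes with the torus mean. The
pointwise integrals assemble into one integral in `C_N(Ω̂)`. -/
theorem blochRelation₂_iff :
    BlochRelation₂ n c (fun k x => F x k) ↔ ∀ (x : VL d L) (y : Fin d → ℤ),
      c (x + (2 * L + 1 : ℤ) • y) =
        foldSign n x y • (fourierMean (MatFun N (FinConf d L Ω₀)) y (F x)).comp qMap := by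
  refine forall_congr' fun x => forall_congr' fun y => ?_
  rw [ContinuousMap.ext_iff]
  refine forall_congr' fun ω => ?_
  have h := map_fourierMean (ContinuousMap.evalCLM ℂ (qHat ω)) y (F x)
  rw [fourierMean_apply _ (ContinuousMap.comp _ _), torusMean_apply] at h
  have h' : (foldSign n x y • (fourierMean (MatFun N (FinConf d L Ω₀)) y (F x)).comp qMap) ω =
      foldSign n x y • ((2 * Real.pi) ^ d)⁻¹ •
        ∫ k : Torus d, phase k (-y) • F x k (qHat ω) :=
    congrArg (fun z => foldSign n x y • z) h
  rw [h']

/-- After substitution the sign squares to `1`, and what remains is Fejér's theorem for `F x`. -/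
theorem blochRelation₁_of_blochRelation₂ (h : BlochRelation₂ n c fun k x => F x k) :
    BlochRelation₁ n c fun k x => F x k := by
  rw [blochRelation₂_iff] at h
  intro x
  have h1 := tendstoUniformly_map_fejerMean (E := MatFun N (FinConf d L Ω₀))
    (E' := MatFun N (PerConf d L Ω₀)) (compCLM qMap) (F x)
  refine Eq.mp (congrArg (fun G => TendstoUniformly G _ _) (funext fun m => funext fun k => ?_)) h1
  rw [fejerMean, map_sum]
  refine Finset.sum_congr rfl fun y _ => ?_
  rw [h x y, smul_smul (foldSign n _ _ * _), mul_comm (foldSign n _ _ * _), ← mul_assoc,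
    foldSign_mul_self, one_mul, map_smul, map_smul]
  rfl

theorem BlochRelation₁.unique {c' c'' : Torus d → VL d L → MatFun N (FinConf d L Ω₀)}
    (h' : BlochRelation₁ n c c') (h'' : BlochRelation₁ n c c'') : c' = c'' :=
  funext fun k => funext fun x => comp_qMap_injective
    (tendsto_nhds_unique ((h' x).tendsto_at k) ((h'' x).tendsto_at k))

theorem isFourier_iff_blochRelation₂ (hφ : φ.transpose = -φ)
    (hn : ∀ i j, φ i j = 2 * (n i j : ℝ) * Real.pi / (2 * (L : ℝ) + 1)) (a : PerAlg N L Ω₀ φ) :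
    IsFourier a c ↔ BlochRelation₂ n c fun k x => foldCoeff hφ hn x a k := by
  rw [blochRelation₂_iff]
  constructor
  · intro h x y
    refine perGen_π_injective hφ hn ?_
    rw [h, fourierCoeff_add_smul hφ hn]
  · intro h z
    obtain ⟨x, y, rfl⟩ := exists_VL_add (L := L) z
    rw [h, fourierCoeff_add_smul hφ hn]

theorem blochHom_eq_iff (hφ : φ.transpose = -φ)
    (hn : ∀ i j, φ i j = 2 * (n i j : ℝ) * Real.pi / (2 * (L : ℝ) + 1)) {a : PerAlg N L Ω₀ φ}
    (hc : IsFourier a c) {s : ∀ k : Torus d, BlochAlg N L Ω₀ φ k} (hs : s ∈ blochSections N L Ω₀ φ)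
    {c' : Torus d → VL d L → MatFun N (FinConf d L Ω₀)}
    (hc' : ∀ k, IsBlochFourier k (s k) (c' k)) :
    (blochHom N L Ω₀ φ a = s ↔ BlochRelation₁ n c c') ∧
      (blochHom N L Ω₀ φ a = s ↔ BlochRelation₂ n c c') := by
  have hc'' : ∀ k, blochCoeff hφ hn k (s k) = c' k := fun k =>
    (blochCoeff_eq_iff hφ hn k _ _).2 (hc' k)
  have ha := (isFourier_iff_blochRelation₂ hφ hn a).1 hc
  have h12 : blochHom N L Ω₀ φ a = s → BlochRelation₂ n c c' := by
    rintro rfl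
    obtain rfl : (fun k x => foldCoeff hφ hn x a k) = c' := funext hc''
    exact ha
  -- Membership of `s` in `Γ` enters here: it makes the coefficients continuous in `k`, as Fejér's
  -- theorem requires.
  have h21 : BlochRelation₂ n c c' → BlochRelation₁ n c c' := by
    let F : VL d L → TorusMap d (MatFun N (FinConf d L Ω₀)) := fun x =>
      ⟨_, continuous_blochCoeff hφ hn s ((mem_blochSections_iff hφ hn s).1 hs) x⟩
    obtain rfl : (fun k x => F x k) = c' := funext hc''
    exact blochRelation₁_of_blochRelation₂
  have h10 : BlochRelation₁ n c c' → blochHom N L Ω₀ φ a = s := by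
    intro h
    -- The coefficients of the image of `a` satisfy the same Cesàro relation with `c`, so they
    -- coincide with those of `s`.
    obtain rfl := h.unique (blochRelation₁_of_blochRelation₂ ha)
    funext k
    rw [blochHom_apply, ← blochSynth_blochCoeff hφ hn k (fold N L Ω₀ φ k a),
      ← blochSynth_blochCoeff hφ hn k (s k), hc'' k]
    rfl
  exact ⟨⟨fun h => h21 (h12 h), h10⟩, ⟨h12, fun h => h10 (h21 h)⟩⟩

end Relations

end Folding

end Bloch

theorem mainTheorem9 {d N L : ℕ} {Ω₀ : Type u} [TopologicalSpace Ω₀] [CompactSpace Ω₀]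
    [TopologicalSpace.MetrizableSpace Ω₀]
    (φ : Matrix (Fin d) (Fin d) ℝ) (hφ : φ.transpose = -φ)
    (n : Matrix (Fin d) (Fin d) ℤ)
    (hn : ∀ i j, φ i j = 2 * (n i j : ℝ) * Real.pi / (2 * (L : ℝ) + 1)) :
    (∀ a : Bloch.PerAlg N L Ω₀ φ, ∃! c, Bloch.IsFourier a c) ∧
    (∀ (k : Bloch.Torus d) (b : Bloch.BlochAlg N L Ω₀ φ k), ∃! c, Bloch.IsBlochFourier k b c) ∧
    Bloch.IsContinuousField (fun k : Bloch.Torus d => Bloch.BlochAlg N L Ω₀ φ k)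
      (Bloch.blochSections N L Ω₀ φ) ∧
    ∃ Θ : Bloch.PerAlg N L Ω₀ φ →⋆ₐ[ℂ] (∀ k : Bloch.Torus d, Bloch.BlochAlg N L Ω₀ φ k),
      Function.Injective Θ ∧
      Set.range Θ = Bloch.blochSections N L Ω₀ φ ∧
      (∀ a, IsLUB (Set.range fun k => ‖Θ a k‖) ‖a‖) ∧
      (∀ j k, Θ ((Bloch.perGen N L Ω₀ φ).u j) k = (Bloch.blochGen N L Ω₀ φ k).u j) ∧
      (∀ f k, Θ ((Bloch.perGen N L Ω₀ φ).π f) k =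
        (Bloch.blochGen N L Ω₀ φ k).π (f.comp Bloch.qInvMap)) ∧
      ∀ a c, Bloch.IsFourier a c →
        ∀ s ∈ Bloch.blochSections N L Ω₀ φ,
          ∀ c', (∀ k, Bloch.IsBlochFourier k (s k) (c' k)) →
            (Θ a = s ↔ Bloch.BlochRelation₁ n c c') ∧
            (Θ a = s ↔ Bloch.BlochRelation₂ n c c') := by
  refine ⟨Bloch.existsUnique_isFourier hφ hn, Bloch.existsUnique_isBlochFourier hφ hn,
    Bloch.isContinuousField_bloch hφ hn, Bloch.blochHom N L Ω₀ φ, Bloch.blochHom_injective hφ hn,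
    Bloch.range_blochHom hφ hn, Bloch.isLUB_norm_blochHom hφ hn, fun j k => Bloch.fold_u k j,
    fun f k => Bloch.fold_π k f, fun a c hc s hs c' hc' => ?_⟩
  exact Bloch.blochHom_eq_iff hφ hn hc hs hc'
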